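/- **Setting.** All Banach spaces are real, and all inclusions of Banach spaces are bounded injective linear embeddings. Let $Z\subseteq X$ be Banach spaces with $Z$ reflexive and dense in $X$. Let $U\subseteq X$ be nonempty and open, $T>0$, $U_Z:=U\cap Z$ (open in $Z$). Let $G,S:[0,T)\times U\to X$ be maps that restrict to maps $G,S:[0,T)\times U_Z\to Z$. Suppose that all four maps are continuous and satisfy the local semigroup property: $S_0(x)=x$, and $S_t(S_s(x))=S_{s+t}(x)$ whenever $s,t,s+t\in[0,T)$ and $S_s(x)$ lies in the domain ($U$, respectively $U_Z$). A continuous map $f:[0,T)\times V\to Y$ ($V$ open in a Banach space $E$) is *$C^k$ along curves* if all iterated mixed directional derivatives of $f$ of total order at most $k$, in $t\in[0,T)$ and in $x\in V$ along directions $\xi_1,\xi_2,\dots\in E$, exist and are jointly continuous in $t$, $x$ and the directions. Two such semigroups $G,S:[0,T)\times V\to E$ are *locally equivalent to a quasi-contraction in $V$ with the same distance function* if every $x_0\in V$ has an open neighbourhood $N\subseteq V$, a distance function $d$ on $N$ with $L_1d(x,y)\le\|x-y\|\le L_2d(x,y)$ for some $0<L_1<L_2$, and a $\beta>0$ such that,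 whenever $W\subseteq N$ is open, $0<\tau\le T$ and $G_t(W),S_t(W)\subseteq N$ for all $t\in[0,\tau)$, one has $d(G_t(x),G_t(y))\le e^{\beta t}d(x,y)$ and $d(S_t(x),S_t(y))\le e^{\beta t}d(x,y)$ for all $x,y\in W$, $t\in[0,\tau)$. Assume: (a) $G:[0,T)\times U\to X$ and $G:[0,T)\times U_Z\to Z$ are $C^2$, and $S:[0,T)\times U_Z\to X$ is $C^2$ along curves. (b) There is a Banach space $D$ densely embedded in $Z$ such that, with $U_D:=U\cap D$, the maps $G,S:[0,T)\times U_D\to Z$ are $C^1$ along curves. (c) $G$ and $S$ are locally equivalent to a quasi-contraction with the same distance function, both in $U$ (as maps to $X$) and in $U_Z$ (as maps to $Z$). (d) Let $\mathcal E(x):=\frac{d}{dt}\big|_{t=0}G_t(x)$ for $x\in U$ and $\Xi(z):=\frac{d}{dt}\big|_{t=0}S_t(z)\in X$ for $z\in U_Z$. There are Banach spaces $\widetilde X\supseteq X$ and $Z\subseteq\widetilde Z\subseteq X$ such that $\Xi$ is a $C^1$ map $U_Z\to\widetilde Z$ and extends to a $C^1$ map $\Xi:U\to\widetilde X$. For $0\le\nu\le1$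 consider $$\frac{du}{dt}=\mathcal E(u)+\nu\,\Xi(u),\qquad u|_{t=0}=z. \tag{1}$$ A solution on $[0,\tau)$ is a curve $u:[0,\tau)\to U$ that is continuous in $X$, differentiable in $\widetilde X$, and satisfies (1) in $\widetilde X$. **Claim.** For every $z_0\in U_Z$ there are $0<\tau\le T$ and an open neighbourhood $O(z_0)\subseteq U_Z$ of $z_0$ in $Z$, both independent of $\nu$, such that for all $\nu\in[0,1]$ and $z\in O(z_0)$: 1. Equation (1) has a solution $u^{(\nu)}=u^{(\nu)}(\cdot,z)\in C_b([0,\tau),X)\cap C^1_b([0,\tau),\widetilde X)$ with $u^{(\nu)}(t)\in Z$ for all $t\in[0,\tau)$. It is the only solution on $[0,\tau)$ with values in $U_Z$. For $\nu=0$ it is the only solution on $[0,\tau)$ at all. 2. The solution depends Lipschitz continuously on the initial data: there is a constant $L$, independent of $\nu$, with $\|u^{(\nu)}(t,z_1)-u^{(\nu)}(t,z_2)\|_X\le L\|z_1-z_2\|_X$ for all $z_1,z_2\in O(z_0)$ and $t\in[0,\tau)$. 3. The map $O(z_0)\times[0,1]\to C_b([0,\tau),X)\cap C_b([0,\tau),\widetilde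 X)$, $(z,\nu)\mapsto u^{(\nu)}(\cdot,z)$, is continuous. In particular $u^{(\nu)}(\cdot,z)\to u^{(0)}(\cdot,z)$ in this space as $\nu\to0+$. -/

import Mathlib

open Set Filter Topology
open scoped BoundedContinuousFunction

namespace LieTrotter

/-- The local semigroup property of a map `S : [0,T) × U → E`, written `S t x`. Values of `S` at
times outside `[0,T)` or points outside `U` play no role. -/
def LocalSemigroup {E : Type*} (T : ℝ) (U : Set E) (S : ℝ → E → E) : Prop :=
  ∀ x ∈ U, S 0 x = x ∧
    ∀ s ∈ Ico (0 : ℝ) T, ∀ t ∈ Ico (0 : ℝ) T, s + t ∈ Ico (0 : ℝ) T → S s x ∈ U →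
      S t (S s x) = S (s + t) x

/-- `d` is a distance function on `N`, equivalent there to the distance given by the norm.
(Nonnegativity and `d x y = 0 ↔ x = y` follow from the two-sided estimate.) -/
def IsEquivDist {E : Type*} [NormedAddCommGroup E] (N : Set E) (d : E → E → ℝ) : Prop :=
  (∀ x ∈ N, ∀ y ∈ N, d x y = d y x) ∧
  (∀ x ∈ N, ∀ y ∈ N, ∀ z ∈ N, d x z ≤ d x y + d y z) ∧
  ∃ L₁ L₂ : ℝ, 0 < L₁ ∧ L₁ < L₂ ∧
    ∀ x ∈ N, ∀ y ∈ N, L₁ * d x y ≤ ‖x - y‖ ∧ ‖x - y‖ ≤ L₂ * d x y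

/-- The maps `G, S : [0,T) × U → E` are locally equivalent to a quasi-contraction in `U` with the
same distance function. -/
def LocallyQuasiContraction {E : Type*} [NormedAddCommGroup E] (T : ℝ) (U : Set E)
    (G S : ℝ → E → E) : Prop :=
  ∀ x₀ ∈ U, ∃ N : Set E, IsOpen N ∧ x₀ ∈ N ∧ N ⊆ U ∧
    ∃ d : E → E → ℝ, IsEquivDist N d ∧ ∃ β : ℝ, 0 < β ∧
      ∀ V : Set E, IsOpen V → V ⊆ N → ∀ τ : ℝ, 0 < τ → τ ≤ T →
        (∀ t ∈ Ico (0 : ℝ) τ, MapsTo (G t) V N ∧ MapsTo (S t) V N) →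
        ∀ x ∈ V, ∀ y ∈ V, ∀ t ∈ Ico (0 : ℝ) τ,
          d (G t x) (G t y) ≤ Real.exp (β * t) * d x y ∧
          d (S t x) (S t y) ≤ Real.exp (β * t) * d x y

/-- The iterated mixed directional derivative of `f : [0,T) × U → F` encoded by a word: the letter
`true` is the derivative `D₁` in time (one-sided at `t = 0`), the letter `false` is the directional
derivative `D₂` in the space variable, and the head of the word is applied last. The entry of `ξ`
at the position of a letter `false` is the direction of that derivative; the entries of `ξ` at the
positions of the letters `true` are ignored. -/
noncomputable def mixedDeriv {E F : Type*} [NormedAddCommGroup E] [NormedSpace ℝ E]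
    [NormedAddCommGroup F] [NormedSpace ℝ F] (T : ℝ) (f : ℝ → E → F) :
    (w : List Bool) → (Fin w.length → E) → ℝ → E → F
  | [], _ => f
  | true :: w, ξ => fun t x =>
      derivWithin (fun s => mixedDeriv T f w (Fin.tail ξ) s x) (Ico 0 T) t
  | false :: w, ξ => fun t x => lineDeriv ℝ (mixedDeriv T f w (Fin.tail ξ) t) x (ξ 0)

/-- `f : [0,T) × U → F` is of class `C^k` along curves: all mixed directional derivatives up to
order `k` exist and are continuous jointly in time, point and directions. -/
def ContDiffAlongCurves {E F : Type*} [NormedAddCommGroup E] [NormedSpace ℝ E]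
    [NormedAddCommGroup F] [NormedSpace ℝ F] (k : ℕ) (T : ℝ) (U : Set E) (f : ℝ → E → F) : Prop :=
  ∀ w : List Bool,
    (w.length < k → ∀ ξ : Fin w.length → E, ∀ t ∈ Ico (0 : ℝ) T, ∀ x ∈ U,
      DifferentiableWithinAt ℝ (fun s => mixedDeriv T f w ξ s x) (Ico 0 T) t ∧
      ∀ η : E, LineDifferentiableAt ℝ (mixedDeriv T f w ξ t) x η) ∧
    (w.length ≤ k →
      ContinuousOn
        (fun p : ℝ × E × (Fin w.length → E) => mixedDeriv T f w p.2.2 p.1 p.2.1)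
        (Ico (0 : ℝ) T ×ˢ U ×ˢ univ))

/-- The generator `x ↦ d/dt|_{t=0} S_t(x)` (one-sided derivative). -/
noncomputable def generator {E : Type*} [NormedAddCommGroup E] [NormedSpace ℝ E]
    (S : ℝ → E → E) (x : E) : E :=
  derivWithin (fun t => S t x) (Ici 0) 0

/-- `f` restricted to `[0,τ)` belongs to `C_b([0,τ), E)`. -/
def MemCb {E : Type*} [NormedAddCommGroup E] (τ : ℝ) (f : ℝ → E) : Prop :=
  ContinuousOn f (Ico 0 τ) ∧ ∃ M : ℝ, ∀ t ∈ Ico (0 : ℝ) τ, ‖f t‖ ≤ M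

/-- `f` restricted to `[0,τ)` belongs to `C¹_b([0,τ), E)`. -/
def MemCb1 {E : Type*} [NormedAddCommGroup E] [NormedSpace ℝ E] (τ : ℝ) (f : ℝ → E) : Prop :=
  MemCb τ f ∧ DifferentiableOn ℝ f (Ico 0 τ) ∧ MemCb τ (derivWithin f (Ico 0 τ))

/-- `u : [0,τ) → U` is a solution of `du/dt = 𝓔(u) + ν Ξ(u)`, `u(0) = x₀`: it is continuous as a
curve in `X`, and differentiable as a curve in the larger space `Y`, into which `X` is embedded
by `j`, with the prescribed derivative. -/
structure IsSolution {X Y : Type*} [NormedAddCommGroup X] [NormedSpace ℝ X]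
    [NormedAddCommGroup Y] [NormedSpace ℝ Y] (j : X →L[ℝ] Y) (U : Set X)
    (𝓔 : X → X) (Ξ : X → Y) (ν τ : ℝ) (x₀ : X) (u : ℝ → X) : Prop where
  mem : ∀ t ∈ Ico (0 : ℝ) τ, u t ∈ U
  continuousOn : ContinuousOn u (Ico 0 τ)
  initial : u 0 = x₀
  hasDeriv : ∀ t ∈ Ico (0 : ℝ) τ,
    HasDerivWithinAt (fun s => j (u s)) (j (𝓔 (u t)) + ν • Ξ (u t)) (Ico 0 τ) t

end LieTrotter

/-! The solution is the limit of the Lie-Trotter products `F_ν(h) = G_h ∘ S_{νh}`, iterated with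
step sizes `τ / 2 ^ n`. Because `G` and `S` are quasi-contractions for one and the same distance,
`F_ν(h)` expands that distance at most by `e^{2βh}`, so local errors accumulate at most linearly
(`ContractiveNear.norm_sub_le`). Halving the step replaces `G_h G_h S_s S_s` by `G_h S_s G_h S_s`
with `s = νh`, and the commutator of `G_h` and `S_s` is `O(h²)` in `X` at points of `Z`
(`LocalBounds.norm_commutator_le`). About `τ / h` steps thus produce an error `O(h)`, and the dyadic
approximations form a Cauchy sequence (`OneStepScheme.norm_approx_succ_sub_le`). The constants do
not depend on `ν`, and the same stability estimate gives Lipschitz dependence on the initial value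
and on `ν`.

These estimates require the orbits to stay in a small ball of `Z`. The quasi-contraction in `Z`
reduces this to the orbit of a single point near `z₀`, and the dense space `D` supplies one that
moves with finite speed in `Z` (`exists_iterate_mem_ball`, `LocalBounds.exists_slow_point`).
Reflexivity makes closed balls of `Z` closed in `X`, so the limit remains `Z`-valued.

Uniqueness is also read off the distance `d`. Two Lipschitz curves whose velocity in `X` agrees
almost everywhere with that of the Lie-Trotter step separate at most exponentially
(`ContractiveNear.dist_le_of_tangentOn`). For `ν = 0` every solution is such a curve, since the
generator of `G` is continuous on `U`. For general `ν`, a `Z`-valued solution is such a curve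
wherever the generator of `S` is bounded along it: reflexivity makes the velocity measurable, and
the equation can be integrated in `X`. Local boundedness in `Z` is not assumed; it comes from
Baire's theorem (`Splitting.rightTangent_of_solution`). On the closure of the set of bad times, some
portion has values in a small `Z`-ball; across each gap the solution coincides with a constructed
one started at the left end of the gap. It is therefore bounded in `Z` on an interval to the right
of a bad time, which is a contradiction. -/

namespace LieTrotter

section

open MeasureTheory Metric

/-! ### Consequences of weak compactness in a reflexive space. -/

/-- The image of a bounded closed convex subset of a reflexive space under a bounded linear map is
closed. -/
theorem isClosed_image_of_reflexive {X Z : Type*} [NormedAddCommGroup X] [NormedSpace ℝ X]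
    [NormedAddCommGroup Z] [NormedSpace ℝ Z] (i : Z →L[ℝ] X)
    (hrefl : Function.Surjective (NormedSpace.inclusionInDoubleDual ℝ Z))
    {C : Set Z} (hC : IsClosed C) (hconv : Convex ℝ C) (hbdd : Bornology.IsBounded C) :
    IsClosed (i '' C) := by
  have hrange : range (NormedSpace.inclusionInDoubleDualWeak ℝ Z) = univ := by
    refine eq_univ_of_forall fun f => ?_
    obtain ⟨z, hz⟩ := hrefl (WeakDual.toStrongDual f)
    refine ⟨toWeakSpace ℝ Z z, ?_⟩
    refine DFunLike.ext _ _ fun g => ?_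
    exact congrArg (fun F => F g) hz
  -- A closed convex set is weakly closed; being bounded, it is weakly compact by Banach-Alaoglu and
  -- reflexivity. Its image is weakly compact, so weakly closed, so norm closed.
  have hcl : closure (toWeakSpace ℝ Z '' C) = toWeakSpace ℝ Z '' C := by
    rw [← hconv.toWeakSpace_closure ℝ, hC.closure_eq]
  have hcomp : IsCompact (toWeakSpace ℝ Z '' C) := by
    rw [← hcl]
    refine NormedSpace.isCompact_closure_of_isBounded (𝕜 := ℝ) (X := Z) _ ?_ ?_
    · rwa [preimage_image_eq _ (toWeakSpace ℝ Z).injective]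
    · rw [hrange]; exact subset_univ _
  have himg : IsCompact (WeakSpace.map i '' (toWeakSpace ℝ Z '' C)) :=
    hcomp.image (WeakSpace.map i).continuous
  have heq : WeakSpace.map i '' (toWeakSpace ℝ Z '' C) = toWeakSpace ℝ X '' (i '' C) := by
    rw [image_image, image_image]; rfl
  rw [heq] at himg
  have := himg.isClosed.preimage (toWeakSpaceCLM ℝ X).continuous
  have h2 : (toWeakSpaceCLM ℝ X) ⁻¹' (toWeakSpace ℝ X '' (i '' C)) = i '' C :=
    preimage_image_eq _ (toWeakSpace ℝ X).injective
  rwa [h2] at this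

/-- A separable set is covered by countably many of the given balls centred at its points. -/
theorem exists_countable_cover_ball {Z : Type*} [PseudoMetricSpace Z] {s : Set Z}
    (hs : TopologicalSpace.IsSeparable s) (r : Z → ℝ) (hr : ∀ x ∈ s, 0 < r x) :
    ∃ c : Set Z, c ⊆ s ∧ c.Countable ∧ s ⊆ ⋃ x ∈ c, ball x (r x) := by
  have := hs.secondCountableTopology
  obtain ⟨c, hc, hcu⟩ := TopologicalSpace.countable_cover_nhds
    (f := fun x : s => ball x (r x)) (fun x => ball_mem_nhds x (hr x x.2))
  refine ⟨Subtype.val '' c, by rintro _ ⟨x, -, rfl⟩; exact x.2, hc.image _, fun x hx => ?_⟩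
  have : (⟨x, hx⟩ : s) ∈ ⋃ x ∈ c, ball x (r x) := by rw [hcu]; trivial
  simp only [mem_iUnion] at this ⊢
  obtain ⟨y, hy, hxy⟩ := this
  exact ⟨y, ⟨y, hy, rfl⟩, hxy⟩

section Reflexive

variable {X Z α : Type*} [NormedAddCommGroup X] [NormedSpace ℝ X] [NormedAddCommGroup Z]
  [NormedSpace ℝ Z] [TopologicalSpace α] {i : Z →L[ℝ] X} {ζ : α → Z}

/-- The map `ζ` need not be continuous into `Z`, but by injectivity of `i` this set is the preimage
of the closed set `i '' C` under the continuous map `i ∘ ζ`. -/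
theorem isClosed_preimage_of_reflexive (hi : Function.Injective i)
    (hrefl : Function.Surjective (NormedSpace.inclusionInDoubleDual ℝ Z))
    (hζ : Continuous fun a => i (ζ a)) {C : Set Z} (hC : IsClosed C) (hconv : Convex ℝ C)
    (hbdd : Bornology.IsBounded C) : IsClosed (ζ ⁻¹' C) := by
  have := (isClosed_image_of_reflexive i hrefl hC hconv hbdd).preimage hζ
  convert this using 1
  ext a
  simp [hi.eq_iff]

/-- The closed span `W` of the values on a countable dense set is separable, and `W ∩ closedBall 0
M` has a closed preimage containing that dense set. -/
theorem isSeparable_range_of_bounded [TopologicalSpace.SeparableSpace α]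
    (hi : Function.Injective i)
    (hrefl : Function.Surjective (NormedSpace.inclusionInDoubleDual ℝ Z))
    (hζ : Continuous fun a => i (ζ a)) {M : ℝ} (hM : ∀ a, ‖ζ a‖ ≤ M) :
    TopologicalSpace.IsSeparable (range ζ) := by
  obtain ⟨s, hsc, hsd⟩ := TopologicalSpace.exists_countable_dense α
  set W := (Submodule.span ℝ (ζ '' s)).topologicalClosure
  have hW : TopologicalSpace.IsSeparable (W : Set Z) := by
    rw [Submodule.topologicalClosure_coe]
    exact ((hsc.image ζ).isSeparable.span (R := ℝ)).closure
  have hcl : IsClosed (ζ ⁻¹' ((W : Set Z) ∩ closedBall 0 M)) :=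
    isClosed_preimage_of_reflexive hi hrefl hζ
      ((Submodule.isClosed_topologicalClosure _).inter isClosed_closedBall)
      (W.convex.inter (convex_closedBall _ _)) (isBounded_closedBall.subset inter_subset_right)
  have hsub : s ⊆ ζ ⁻¹' ((W : Set Z) ∩ closedBall 0 M) := fun a ha =>
    ⟨Submodule.le_topologicalClosure _ (Submodule.subset_span ⟨a, ha, rfl⟩), by simpa using hM a⟩
  have huniv := (hsd.closure_eq ▸ closure_minimal hsub hcl : univ ⊆ _)
  refine hW.mono ?_
  rintro _ ⟨a, rfl⟩
  exact (huniv (mem_univ a)).1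

theorem isSeparable_range_of_reflexive [SecondCountableTopology α]
    (hi : Function.Injective i)
    (hrefl : Function.Surjective (NormedSpace.inclusionInDoubleDual ℝ Z))
    (hζ : Continuous fun a => i (ζ a)) : TopologicalSpace.IsSeparable (range ζ) := by
  have : range ζ ⊆ ⋃ n : ℕ, range (fun a : {a | ‖ζ a‖ ≤ n} => ζ a) := by
    rintro _ ⟨a, rfl⟩
    obtain ⟨n, hn⟩ := exists_nat_ge ‖ζ a‖
    exact mem_iUnion.2 ⟨n, ⟨a, hn⟩, rfl⟩
  refine TopologicalSpace.IsSeparable.mono (TopologicalSpace.IsSeparable.iUnion fun n => ?_) this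
  exact isSeparable_range_of_bounded hi hrefl (hζ.comp continuous_subtype_val)
    (M := n) fun a => a.2

/-- Inside the separable range an open set is covered by countably many closed balls contained in
it, and closed balls have closed preimages. -/
theorem measurable_of_reflexive [SecondCountableTopology α] [MeasurableSpace α] [BorelSpace α]
    [MeasurableSpace Z] [BorelSpace Z] (hi : Function.Injective i)
    (hrefl : Function.Surjective (NormedSpace.inclusionInDoubleDual ℝ Z))
    (hζ : Continuous fun a => i (ζ a)) : Measurable ζ := by
  refine measurable_of_isOpen fun O hO => ?_
  have hsep := isSeparable_range_of_reflexive hi hrefl hζ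
  have h1 : ∀ z : Z, ∃ r : ℝ, z ∈ O → 0 < r ∧ closedBall z r ⊆ O := fun z => by
    by_cases hz : z ∈ O
    · obtain ⟨r, hr, h⟩ := nhds_basis_closedBall.mem_iff.1 (hO.mem_nhds hz)
      exact ⟨r, fun _ => ⟨hr, h⟩⟩
    · exact ⟨0, fun h => absurd h hz⟩
  choose r hr using h1
  obtain ⟨c, hcs, hcc, hcov⟩ := exists_countable_cover_ball (hsep.mono inter_subset_right :
    TopologicalSpace.IsSeparable (O ∩ range ζ)) r fun x hx => (hr x hx.1).1
  have : ζ ⁻¹' O = ⋃ x ∈ c, ζ ⁻¹' closedBall x (r x) := by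
    ext a
    simp only [mem_preimage, mem_iUnion, exists_prop]
    constructor
    · intro ha
      have := hcov ⟨ha, mem_range_self a⟩
      simp only [mem_iUnion, exists_prop] at this
      obtain ⟨x, hx, hax⟩ := this
      exact ⟨x, hx, ball_subset_closedBall hax⟩
    · rintro ⟨x, hx, hax⟩
      exact (hr x (hcs hx).1).2 hax
  rw [this]
  exact MeasurableSet.biUnion hcc fun x _ => (isClosed_preimage_of_reflexive hi hrefl hζ
    isClosed_closedBall (convex_closedBall _ _) isBounded_closedBall).measurableSet

end Reflexive

/-! ### Gronwall inequalities and a criterion for differentiability. -/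

/-- Gronwall's inequality for a Lipschitz function whose differential inequality holds almost
everywhere. -/
theorem le_exp_mul_of_ae_deriv_le {φ : ℝ → ℝ} {a b β : ℝ} {K : NNReal} (hab : a ≤ b)
    (hφ : LipschitzOnWith K φ (Icc a b))
    (h : ∀ᵐ s, s ∈ Ioo a b → ∀ φ', HasDerivAt φ φ' s → φ' ≤ β * φ s) :
    φ b ≤ Real.exp (β * (b - a)) * φ a := by
  rw [← uIcc_of_le hab] at hφ
  have hac := hφ.absolutelyContinuousOnInterval
  have hexp : AbsolutelyContinuousOnInterval (fun s => Real.exp (-β * s)) a b :=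
    ContDiffOn.absolutelyContinuousOnInterval (by fun_prop)
  -- The product `e^{-βs} φ(s)` is absolutely continuous, so its increment is the integral of its
  -- derivative, which is nonpositive almost everywhere.
  have hψ := hexp.mul hac
  have hint := hψ.integral_deriv_eq_sub
  have h₁ : ∀ᵐ x : ℝ, x ≠ a := by simp [ae_iff, measure_singleton]
  have h₂ : ∀ᵐ x : ℝ, x ≠ b := by simp [ae_iff, measure_singleton]
  have hle : ∫ x in a..b, deriv ((fun s => Real.exp (-β * s)) * φ) x ≤ 0 := by
    rw [intervalIntegral.integral_of_le hab]
    refine integral_nonpos_of_ae ?_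
    rw [EventuallyLE, ae_restrict_iff' measurableSet_Ioc]
    filter_upwards [hac.ae_differentiableAt, h, h₂] with s hs1 hs2 hsb hs
    have hmem : s ∈ Ioo a b := ⟨hs.1, lt_of_le_of_ne hs.2 hsb⟩
    have hd := (hs1 (by rw [uIcc_of_le hab]; exact Ioc_subset_Icc_self hs)).hasDerivAt
    have hle := hs2 hmem _ hd
    have hE : HasDerivAt (fun s => Real.exp (-β * s)) (Real.exp (-β * s) * (-β)) s := by
      have := ((hasDerivAt_id s).const_mul (-β)).exp
      simpa using this
    rw [(hE.mul hd).deriv]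
    have : 0 < Real.exp (-β * s) := Real.exp_pos _
    simp only [Pi.zero_apply]
    nlinarith
  rw [hint] at hle
  simp only [Pi.mul_apply, sub_nonpos] at hle
  have h3 : Real.exp (β * b) * (Real.exp (-β * b) * φ b) = φ b := by
    rw [← mul_assoc, ← Real.exp_add]; simp
  have h4 : Real.exp (β * b) * (Real.exp (-β * a) * φ a) = Real.exp (β * (b - a)) * φ a := by
    rw [← mul_assoc, ← Real.exp_add]; ring_nf
  rw [← h3, ← h4]
  gcongr

/-- Discrete Gronwall: an error committed at any step is later amplified by at most the exponential
over the whole time. -/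
theorem le_exp_mul_of_step {a : ℕ → ℝ} {β h ε : ℝ} (hβ : 0 ≤ β) (hh : 0 ≤ h) (hε : 0 ≤ ε) {n : ℕ}
    (ha : ∀ k < n, a (k + 1) ≤ Real.exp (β * h) * a k + ε) :
    a n ≤ Real.exp (β * (n * h)) * (a 0 + n * ε) := by
  induction n with
  | zero => simp
  | succ n ih =>
    have h1 := ih fun k hk => ha k (hk.trans n.lt_succ_self)
    have h2 := ha n n.lt_succ_self
    have h3 : Real.exp (β * ((n + 1 : ℕ) * h)) = Real.exp (β * h) * Real.exp (β * (n * h)) := by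
      rw [← Real.exp_add]; push_cast; ring_nf
    have h4 : (1 : ℝ) ≤ Real.exp (β * ((n + 1 : ℕ) * h)) := Real.one_le_exp (by positivity)
    calc a (n + 1) ≤ Real.exp (β * h) * (Real.exp (β * (n * h)) * (a 0 + n * ε)) + ε := by
          refine h2.trans ?_; gcongr
      _ ≤ Real.exp (β * ((n + 1 : ℕ) * h)) * (a 0 + n * ε)
            + Real.exp (β * ((n + 1 : ℕ) * h)) * ε := by
          rw [h3, ← mul_assoc, ← h3]
          gcongr
          nlinarith
      _ = _ := by push_cast; ring

theorem hasDerivWithinAt_of_norm_le_sq {Y : Type*} [NormedAddCommGroup Y] [NormedSpace ℝ Y]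
    {f : ℝ → Y} {f' : Y} {s : Set ℝ} {t C : ℝ}
    (h : ∀ r ∈ s, ‖f r - f t - (r - t) • f'‖ ≤ C * (r - t) ^ 2) : HasDerivWithinAt f f' s t := by
  rw [hasDerivWithinAt_iff_isLittleO]
  have h1 : (fun r => f r - f t - (r - t) • f') =O[𝓝[s] t] fun r => (r - t) ^ 2 := by
    refine Asymptotics.IsBigO.of_bound C ?_
    filter_upwards [self_mem_nhdsWithin] with r hr
    simpa using h r hr
  refine h1.trans_isLittleO ?_
  have : (fun r : ℝ => (r - t) ^ 2) =o[𝓝 t] fun r => r - t := by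
    have h2 := (Asymptotics.isLittleO_pow_id (𝕜 := ℝ) (n := 2) (by norm_num)).comp_tendsto
      (k := fun r : ℝ => r - t) (l' := 𝓝 t) (by
        have : Tendsto (fun r : ℝ => r - t) (𝓝 t) (𝓝 (t - t)) :=
          (continuous_id.sub continuous_const).tendsto t
        simpa using this)
    exact h2
  exact this.mono nhdsWithin_le_nhds

/-! ### Convergence of abstract one-step schemes under dyadic refinement. -/

/-- A stable and consistent one-step approximation, depending on a parameter `ν ∈ [0,1]`, of the
equation `j(u)' = W ν u`; orbits of length `τ` starting in `A₀` stay in `A`. -/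
structure OneStepScheme {X Y : Type*} [NormedAddCommGroup X] [NormedSpace ℝ X]
    [NormedAddCommGroup Y] [NormedSpace ℝ Y] (j : X →L[ℝ] Y) (F : ℝ → ℝ → X → X)
    (W : ℝ → X → Y) (A₀ A : Set X) (κ C τ : ℝ) : Prop where
  τ_pos : 0 < τ
  C_nonneg : 0 ≤ C
  κ_nonneg : 0 ≤ κ
  mem : ∀ ν ∈ Icc (0 : ℝ) 1, ∀ h ∈ Ioc 0 τ, ∀ n : ℕ, n * h ≤ τ → ∀ x ∈ A₀, (F ν h)^[n] x ∈ A
  stable : ∀ ν ∈ Icc (0 : ℝ) 1, ∀ h ∈ Ioc 0 τ, ∀ n : ℕ, n * h ≤ τ → ∀ x y : ℕ → X, ∀ δ : ℝ,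
    0 ≤ δ → (∀ k ≤ n, x k ∈ A) → (∀ k ≤ n, y k ∈ A) → (∀ k < n, x (k + 1) = F ν h (x k)) →
    (∀ k < n, ‖F ν h (y k) - y (k + 1)‖ ≤ δ) → ‖x n - y n‖ ≤ κ * (‖x 0 - y 0‖ + n * δ)
  step : ∀ ν ∈ Icc (0 : ℝ) 1, ∀ h ∈ Ioc 0 τ, ∀ x ∈ A, ‖F ν h x - x‖ ≤ C * h
  consistent : ∀ ν ∈ Icc (0 : ℝ) 1, ∀ h, 0 < h → 2 * h ≤ τ → ∀ x ∈ A, F ν h x ∈ A →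
    ‖F ν (2 * h) x - F ν h (F ν h x)‖ ≤ C * h ^ 2
  param : ∀ ν ∈ Icc (0 : ℝ) 1, ∀ ν' ∈ Icc (0 : ℝ) 1, ∀ h ∈ Ioc 0 τ, ∀ x ∈ A,
    ‖F ν h x - F ν' h x‖ ≤ C * |ν - ν'| * h
  tangent : ∀ ν ∈ Icc (0 : ℝ) 1, ∀ h ∈ Ioc 0 τ, ∀ x ∈ A,
    ‖j (F ν h x) - j x - h • W ν x‖ ≤ C * h ^ 2
  -- The closure of `A` is needed because limits of orbits are only known to lie there.
  lipschitz : ∀ ν ∈ Icc (0 : ℝ) 1, ∀ x ∈ closure A, ∀ y ∈ closure A,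
    ‖W ν x - W ν y‖ ≤ C * ‖x - y‖

namespace OneStepScheme

variable {X Y : Type*} [NormedAddCommGroup X] [NormedSpace ℝ X]
    [NormedAddCommGroup Y] [NormedSpace ℝ Y] {j : X →L[ℝ] Y} {F : ℝ → ℝ → X → X}
    {W : ℝ → X → Y} {A₀ A : Set X} {κ C τ ν : ℝ} {x y : X}

/-- The `n`-th approximation: the orbit with step size `τ / 2 ^ n`. -/
noncomputable def approx (F : ℝ → ℝ → X → X) (τ ν : ℝ) (x : X) (n : ℕ) (t : ℝ) : X :=
  (F ν (τ / 2 ^ n))^[⌊t / (τ / 2 ^ n)⌋₊] x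

/-- The limit of the approximations. -/
noncomputable def limit (F : ℝ → ℝ → X → X) (τ ν : ℝ) (x : X) (t : ℝ) : X :=
  haveI : Nonempty X := ⟨x⟩
  limUnder atTop fun n => approx F τ ν x n t

theorem stepSize_mem (hτ : 0 < τ) (n : ℕ) : τ / 2 ^ n ∈ Ioc 0 τ :=
  ⟨by positivity, div_le_self hτ.le (one_le_pow₀ (by norm_num))⟩

theorem floor_mul_le {h t : ℝ} (hh : 0 < h) (ht : 0 ≤ t) : (⌊t / h⌋₊ : ℝ) * h ≤ t :=
  (le_div_iff₀ hh).1 (Nat.floor_le (div_nonneg ht hh.le))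

theorem lt_floor_mul_add {h t : ℝ} (hh : 0 < h) : t < (⌊t / h⌋₊ : ℝ) * h + h := by
  have := (div_lt_iff₀ hh).1 (Nat.lt_floor_add_one (t / h))
  linarith

theorem tendsto_stepSize (τ : ℝ) : Tendsto (fun n : ℕ => τ / 2 ^ n) atTop (𝓝 0) := by
  have := (tendsto_pow_atTop_nhds_zero_of_lt_one (r := (1 / 2 : ℝ)) (by norm_num)
    (by norm_num)).const_mul τ
  simpa [div_eq_mul_inv] using this

theorem tendsto_floor_mul (hτ : 0 < τ) {t : ℝ} (ht : 0 ≤ t) :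
    Tendsto (fun n : ℕ => (⌊t / (τ / 2 ^ n)⌋₊ : ℝ) * (τ / 2 ^ n)) atTop (𝓝 t) := by
  have h0 := (tendsto_const_nhds (x := t)).sub (tendsto_stepSize τ)
  rw [sub_zero] at h0
  refine tendsto_of_tendsto_of_tendsto_of_le_of_le h0 tendsto_const_nhds (fun n => ?_) fun n =>
    floor_mul_le (stepSize_mem hτ n).1 ht
  have := lt_floor_mul_add (t := t) (stepSize_mem hτ n).1
  simp only
  linarith

theorem norm_iterate_sub_le (H : OneStepScheme j F W A₀ A κ C τ) (hν : ν ∈ Icc (0 : ℝ) 1)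
    (hx : x ∈ A₀) {h : ℝ} (hh : h ∈ Ioc 0 τ) (m l : ℕ) (hl : ((m + l : ℕ) : ℝ) * h ≤ τ) :
    ‖(F ν h)^[m + l] x - (F ν h)^[m] x‖ ≤ C * (l * h) := by
  induction l with
  | zero => simp
  | succ l ih =>
    have hl' : ((m + l : ℕ) : ℝ) * h ≤ τ := by
      refine le_trans ?_ hl
      have := hh.1
      gcongr
      omega
    have h1 := ih hl'
    have h2 := H.step ν hν h hh _ (H.mem ν hν h hh _ hl' x hx)
    rw [← Function.iterate_succ_apply' (F ν h)] at h2
    calc _ ≤ ‖(F ν h)^[m + (l + 1)] x - (F ν h)^[m + l] x‖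
          + ‖(F ν h)^[m + l] x - (F ν h)^[m] x‖ := norm_sub_le_norm_sub_add_norm_sub _ _ _
      _ ≤ C * h + C * (l * h) := add_le_add h2 h1
      _ = _ := by push_cast; ring

/-- The `l` local errors `C h²` add up to `C (l h) h`. The variation of the vector field along the
orbit costs at most `h · C · C (l h)` per step, in total at most `C² (l h)²`. Only the second
contribution survives as `h → 0`. -/
theorem norm_iterate_tangent_le (H : OneStepScheme j F W A₀ A κ C τ) (hν : ν ∈ Icc (0 : ℝ) 1)
    (hx : x ∈ A₀) {h : ℝ} (hh : h ∈ Ioc 0 τ) (m l : ℕ) (hl : ((m + l : ℕ) : ℝ) * h ≤ τ) :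
    ‖j ((F ν h)^[m + l] x) - j ((F ν h)^[m] x) - (l * h) • W ν ((F ν h)^[m] x)‖
      ≤ C * (l * h * h) + C ^ 2 * (l * h) ^ 2 := by
  have hC := H.C_nonneg
  have hh0 := hh.1
  induction l with
  | zero => simp
  | succ l ih =>
    have hl' : ((m + l : ℕ) : ℝ) * h ≤ τ := by
      refine le_trans ?_ hl
      gcongr
      omega
    have hm' : (m : ℝ) * h ≤ τ := by
      refine le_trans ?_ hl
      gcongr
      omega
    have h1 := ih hl'
    have hA := H.mem ν hν h hh _ hl' x hx
    have hAm := H.mem ν hν h hh _ hm' x hx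
    have h2 := H.tangent ν hν h hh _ hA
    rw [← Function.iterate_succ_apply' (F ν h)] at h2
    have h3 := H.lipschitz ν hν _ (subset_closure hA) _ (subset_closure hAm)
    have h4 := H.norm_iterate_sub_le hν hx hh m l hl'
    set a := (F ν h)^[m] x
    set b := (F ν h)^[m + l] x
    set c := (F ν h)^[m + l + 1] x
    have heq : j ((F ν h)^[m + (l + 1)] x) - j a - (((l + 1 : ℕ) : ℝ) * h) • W ν a
        = (j b - j a - (l * h) • W ν a) + (j c - j b - h • W ν b) + h • (W ν b - W ν a) := by
      have : (F ν h)^[m + (l + 1)] x = c := rfl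
      rw [this]
      push_cast
      module
    rw [heq]
    have h5 : ‖h • (W ν b - W ν a)‖ ≤ h * (C * (C * (l * h))) := by
      rw [norm_smul, Real.norm_of_nonneg hh0.le]
      gcongr
      exact h3.trans (by gcongr)
    calc _ ≤ C * (l * h * h) + C ^ 2 * (l * h) ^ 2 + C * h ^ 2 + h * (C * (C * (l * h))) :=
          (norm_add₃_le).trans (by gcongr)
      _ ≤ _ := by
          push_cast
          have : 0 ≤ C ^ 2 * h ^ 2 * (l + 1) := by positivity
          nlinarith

theorem floor_mul_stepSize_le (H : OneStepScheme j F W A₀ A κ C τ) (n : ℕ) {t : ℝ}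
    (ht : t ∈ Icc 0 τ) : (⌊t / (τ / 2 ^ n)⌋₊ : ℝ) * (τ / 2 ^ n) ≤ τ :=
  (floor_mul_le (stepSize_mem H.τ_pos n).1 ht.1).trans ht.2

theorem approx_mem (H : OneStepScheme j F W A₀ A κ C τ) (hν : ν ∈ Icc (0 : ℝ) 1) (hx : x ∈ A₀)
    {t : ℝ} (ht : t ∈ Icc 0 τ) (n : ℕ) : approx F τ ν x n t ∈ A :=
  H.mem ν hν _ (stepSize_mem H.τ_pos n) _ (H.floor_mul_stepSize_le n ht) x hx

/-- Halving the step costs a defect `C h²` for each of at most `τ / (2h)` coarse steps, hence `O(h)`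
by stability. At time `t` the fine orbit may be one step ahead of the coarse one, which costs
another `C h`. -/
theorem norm_approx_succ_sub_le (H : OneStepScheme j F W A₀ A κ C τ) (hν : ν ∈ Icc (0 : ℝ) 1)
    (hx : x ∈ A₀) {t : ℝ} (ht : t ∈ Icc 0 τ) (n : ℕ) :
    ‖approx F τ ν x n t - approx F τ ν x (n + 1) t‖ ≤ (κ * C * τ + C) * (τ / 2 ^ n) := by
  have hC := H.C_nonneg
  have hκ := H.κ_nonneg
  have hτ := H.τ_pos
  set h := τ / 2 ^ (n + 1) with hdef
  have h2 : τ / 2 ^ n = 2 * h := by rw [hdef, pow_succ]; field_simp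
  have hh : h ∈ Ioc 0 τ := stepSize_mem hτ (n + 1)
  have hh2 : 2 * h ∈ Ioc 0 τ := h2 ▸ stepSize_mem hτ n
  have hh0 := hh.1
  set m := ⌊t / (2 * h)⌋₊ with hm
  have hmt : (m : ℝ) * (2 * h) ≤ t := floor_mul_le hh2.1 ht.1
  have hmt' : (t : ℝ) < m * (2 * h) + 2 * h := lt_floor_mul_add hh2.1
  obtain ⟨l, hl1, hl⟩ : ∃ l ≤ 1, ⌊t / h⌋₊ = 2 * m + l := by
    have h3 : 2 * m ≤ ⌊t / h⌋₊ := by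
      apply Nat.le_floor
      rw [le_div_iff₀ hh0]; push_cast; linarith
    have h4 : ⌊t / h⌋₊ < 2 * m + 2 := by
      rw [Nat.floor_lt (div_nonneg ht.1 hh0.le), div_lt_iff₀ hh0]; push_cast; linarith
    exact ⟨⌊t / h⌋₊ - 2 * m, by omega, by omega⟩
  have hMt : ((2 * m + l : ℕ) : ℝ) * h ≤ τ := by
    rw [← hl]; exact (floor_mul_le hh0 ht.1).trans ht.2
  have hmem : ∀ k ≤ 2 * m, (F ν h)^[k] x ∈ A := fun k hk => by
    refine H.mem ν hν h hh k (le_trans ?_ hMt) x hx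
    gcongr
    omega
  -- Every second point of the fine orbit is an approximate orbit of the coarse scheme.
  have key := H.stable ν hν (2 * h) hh2 m (hmt.trans ht.2) (fun k => (F ν (2 * h))^[k] x)
    (fun k => (F ν h)^[2 * k] x) (C * h ^ 2) (by positivity)
    (fun k hk => H.mem ν hν _ hh2 k (le_trans (by gcongr) (hmt.trans ht.2)) x hx)
    (fun k hk => hmem _ (by omega)) (fun k _ => Function.iterate_succ_apply' _ _ _)
    (fun k hk => by
      have := H.consistent ν hν h hh0 hh2.2 _ (hmem (2 * k) (by omega))
        (by rw [← Function.iterate_succ_apply' (F ν h)]; exact hmem _ (by omega))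
      rw [← Function.iterate_succ_apply' (F ν h), ← Function.iterate_succ_apply' (F ν h)] at this
      exact this)
  have h5 := H.norm_iterate_sub_le hν hx hh (2 * m) l hMt
  simp only [approx, h2, ← hdef, hl, ← hm]
  simp only [mul_zero, Function.iterate_zero, id_eq, sub_self, norm_zero, zero_add] at key
  have hl' : (l : ℝ) ≤ 1 := by exact_mod_cast hl1
  calc _ ≤ ‖(F ν (2 * h))^[m] x - (F ν h)^[2 * m] x‖
        + ‖(F ν h)^[2 * m] x - (F ν h)^[2 * m + l] x‖ := norm_sub_le_norm_sub_add_norm_sub _ _ _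
    _ ≤ κ * (m * (C * h ^ 2)) + C * (l * h) := by
        rw [norm_sub_rev _ ((F ν h)^[2 * m + l] x)]; exact add_le_add key h5
    _ ≤ κ * C * τ * (2 * h) + C * (2 * h) := by
        refine add_le_add ?_ ?_
        · have : (m : ℝ) * h ≤ 2 * τ := by
            have := hmt.trans ht.2
            have : 0 ≤ (m : ℝ) * h := by positivity
            linarith
          calc κ * (m * (C * h ^ 2)) = κ * C * (m * h) * h := by ring
            _ ≤ κ * C * (2 * τ) * h := by gcongr
            _ = _ := by ring
        · gcongr; nlinarith
    _ = _ := by ring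

theorem approx_pair (H : OneStepScheme j F W A₀ A κ C τ) {s t : ℝ} (hs : 0 ≤ s) (hst : s ≤ t)
    (ht : t ≤ τ) (n : ℕ) : ∃ l : ℕ, ⌊t / (τ / 2 ^ n)⌋₊ = ⌊s / (τ / 2 ^ n)⌋₊ + l ∧
      ((⌊s / (τ / 2 ^ n)⌋₊ + l : ℕ) : ℝ) * (τ / 2 ^ n) ≤ τ ∧
      (l : ℝ) * (τ / 2 ^ n) = (⌊t / (τ / 2 ^ n)⌋₊ : ℝ) * (τ / 2 ^ n)
        - (⌊s / (τ / 2 ^ n)⌋₊ : ℝ) * (τ / 2 ^ n) := by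
  have h0 := stepSize_mem H.τ_pos n
  obtain ⟨l, hl⟩ := Nat.exists_eq_add_of_le
    (Nat.floor_le_floor (div_le_div_of_nonneg_right hst h0.1.le) :
      ⌊s / (τ / 2 ^ n)⌋₊ ≤ ⌊t / (τ / 2 ^ n)⌋₊)
  refine ⟨l, hl, ?_, ?_⟩
  · rw [← hl]; exact H.floor_mul_stepSize_le n ⟨hs.trans hst, ht⟩
  · rw [hl]; push_cast; ring

theorem tendsto_approx [CompleteSpace X] (H : OneStepScheme j F W A₀ A κ C τ)
    (hν : ν ∈ Icc (0 : ℝ) 1) (hx : x ∈ A₀) {t : ℝ} (ht : t ∈ Icc 0 τ) :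
    Tendsto (fun n => approx F τ ν x n t) atTop (𝓝 (limit F τ ν x t)) := by
  have : CauchySeq fun n => approx F τ ν x n t := by
    refine cauchySeq_of_le_geometric_two (C := 2 * ((κ * C * τ + C) * τ)) fun n => ?_
    rw [dist_eq_norm]
    refine (H.norm_approx_succ_sub_le hν hx ht n).trans (le_of_eq ?_)
    ring
  exact this.tendsto_limUnder

variable [CompleteSpace X]

theorem limit_mem_closure (H : OneStepScheme j F W A₀ A κ C τ) (hν : ν ∈ Icc (0 : ℝ) 1)
    (hx : x ∈ A₀) {t : ℝ} (ht : t ∈ Icc 0 τ) : limit F τ ν x t ∈ closure A :=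
  mem_closure_of_tendsto (H.tendsto_approx hν hx ht)
    (Eventually.of_forall fun n => H.approx_mem hν hx ht n)

theorem limit_zero (H : OneStepScheme j F W A₀ A κ C τ) (hν : ν ∈ Icc (0 : ℝ) 1) (hx : x ∈ A₀) :
    limit F τ ν x 0 = x := by
  refine tendsto_nhds_unique (H.tendsto_approx hν hx ⟨le_rfl, H.τ_pos.le⟩) ?_
  simp [approx]

theorem norm_limit_sub_le_of_le (H : OneStepScheme j F W A₀ A κ C τ) (hν : ν ∈ Icc (0 : ℝ) 1)
    (hx : x ∈ A₀) {s t : ℝ} (hs : 0 ≤ s) (hst : s ≤ t) (ht : t ≤ τ) :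
    ‖limit F τ ν x t - limit F τ ν x s‖ ≤ C * (t - s) := by
  refine le_of_tendsto_of_tendsto'
    ((H.tendsto_approx hν hx ⟨hs.trans hst, ht⟩).sub
      (H.tendsto_approx hν hx ⟨hs, hst.trans ht⟩)).norm
    (((tendsto_floor_mul H.τ_pos (hs.trans hst)).sub
      (tendsto_floor_mul H.τ_pos hs)).const_mul C) fun n => ?_
  obtain ⟨l, hl, hlτ, hle⟩ := H.approx_pair hs hst ht n
  rw [← hle, approx, approx, hl]
  exact H.norm_iterate_sub_le hν hx (stepSize_mem H.τ_pos n) _ l hlτ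

theorem norm_limit_sub_le (H : OneStepScheme j F W A₀ A κ C τ) (hν : ν ∈ Icc (0 : ℝ) 1)
    (hx : x ∈ A₀) {s t : ℝ} (hs : s ∈ Icc 0 τ) (ht : t ∈ Icc 0 τ) :
    ‖limit F τ ν x t - limit F τ ν x s‖ ≤ C * |t - s| := by
  rcases le_total s t with hst | hst
  · rw [abs_of_nonneg (by linarith)]
    exact H.norm_limit_sub_le_of_le hν hx hs.1 hst ht.2
  · rw [norm_sub_rev, abs_sub_comm, abs_of_nonneg (by linarith)]
    exact H.norm_limit_sub_le_of_le hν hx ht.1 hst hs.2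

/-- This is the limit of `norm_iterate_tangent_le`: the term carrying the extra factor `h`
disappears. -/
theorem norm_limit_tangent_le_of_le (H : OneStepScheme j F W A₀ A κ C τ)
    (hν : ν ∈ Icc (0 : ℝ) 1) (hx : x ∈ A₀) {s t : ℝ} (hs : 0 ≤ s) (hst : s ≤ t) (ht : t ≤ τ) :
    ‖j (limit F τ ν x t) - j (limit F τ ν x s) - (t - s) • W ν (limit F τ ν x s)‖
      ≤ C ^ 2 * (t - s) ^ 2 := by
  have hs' : s ∈ Icc 0 τ := ⟨hs, hst.trans ht⟩
  have hlen := (tendsto_floor_mul H.τ_pos (hs.trans hst)).sub (tendsto_floor_mul H.τ_pos hs)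
  have hsl := H.tendsto_approx hν hx hs'
  have htl := H.tendsto_approx hν hx ⟨hs.trans hst, ht⟩
  have hW : Tendsto (fun n => W ν (approx F τ ν x n s)) atTop (𝓝 (W ν (limit F τ ν x s))) := by
    rw [tendsto_iff_norm_sub_tendsto_zero] at hsl ⊢
    refine squeeze_zero (fun _ => norm_nonneg _) (fun n => H.lipschitz ν hν _
      (subset_closure (H.approx_mem hν hx hs' n)) _ (H.limit_mem_closure hν hx hs')) ?_
    simpa using hsl.const_mul C
  have hR : Tendsto (fun n : ℕ => C * (((⌊t / (τ / 2 ^ n)⌋₊ : ℝ) * (τ / 2 ^ n)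
        - (⌊s / (τ / 2 ^ n)⌋₊ : ℝ) * (τ / 2 ^ n)) * (τ / 2 ^ n))
        + C ^ 2 * ((⌊t / (τ / 2 ^ n)⌋₊ : ℝ) * (τ / 2 ^ n)
        - (⌊s / (τ / 2 ^ n)⌋₊ : ℝ) * (τ / 2 ^ n)) ^ 2) atTop
        (𝓝 (C * ((t - s) * 0) + C ^ 2 * (t - s) ^ 2)) :=
    ((hlen.mul (tendsto_stepSize τ)).const_mul C).add ((hlen.pow 2).const_mul _)
  rw [mul_zero, mul_zero, zero_add] at hR
  refine le_of_tendsto_of_tendsto'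
    ((((j.continuous.tendsto _).comp htl).sub ((j.continuous.tendsto _).comp hsl)).sub
      (hlen.smul hW)).norm hR fun n => ?_
  obtain ⟨l, hl, hlτ, hle⟩ := H.approx_pair hs hst ht n
  simp only [Function.comp_apply]
  rw [← hle, approx, approx, hl]
  exact H.norm_iterate_tangent_le hν hx (stepSize_mem H.τ_pos n) _ l hlτ

theorem norm_limit_tangent_le (H : OneStepScheme j F W A₀ A κ C τ) (hν : ν ∈ Icc (0 : ℝ) 1)
    (hx : x ∈ A₀) {s t : ℝ} (hs : s ∈ Icc 0 τ) (ht : t ∈ Icc 0 τ) :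
    ‖j (limit F τ ν x t) - j (limit F τ ν x s) - (t - s) • W ν (limit F τ ν x s)‖
      ≤ 2 * C ^ 2 * (t - s) ^ 2 := by
  rcases le_total s t with hst | hst
  · refine (H.norm_limit_tangent_le_of_le hν hx hs.1 hst ht.2).trans ?_
    nlinarith [mul_nonneg (sq_nonneg C) (sq_nonneg (t - s))]
  -- For `t < s` the forward estimate is based at `t`; moving the vector field from `t` back to `s`
  -- costs another `C² (t - s)²`.
  · have h1 := H.norm_limit_tangent_le_of_le hν hx ht.1 hst hs.2
    have h2 := H.lipschitz ν hν _ (H.limit_mem_closure hν hx hs) _ (H.limit_mem_closure hν hx ht)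
    have h3 := H.norm_limit_sub_le_of_le hν hx ht.1 hst hs.2
    have hC := H.C_nonneg
    set a := limit F τ ν x s
    set b := limit F τ ν x t
    have heq : j b - j a - (t - s) • W ν a
        = -(j a - j b - (s - t) • W ν b) + (s - t) • (W ν a - W ν b) := by module
    have h4 : ‖(s - t) • (W ν a - W ν b)‖ ≤ (s - t) * (C * (C * (s - t))) := by
      rw [norm_smul, Real.norm_of_nonneg (by linarith)]
      have : 0 ≤ s - t := by linarith
      gcongr
      exact h2.trans (by gcongr)
    rw [heq]
    refine (norm_add_le _ _).trans ?_
    rw [norm_neg]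
    refine (add_le_add h1 h4).trans (le_of_eq ?_)
    ring

theorem hasDerivWithinAt_limit (H : OneStepScheme j F W A₀ A κ C τ) (hν : ν ∈ Icc (0 : ℝ) 1)
    (hx : x ∈ A₀) {t : ℝ} (ht : t ∈ Icc 0 τ) :
    HasDerivWithinAt (fun s => j (limit F τ ν x s)) (W ν (limit F τ ν x t)) (Icc 0 τ) t :=
  hasDerivWithinAt_of_norm_le_sq fun _ hr => H.norm_limit_tangent_le hν hx ht hr

/-- Lipschitz dependence of the limit on the initial value and on the parameter. -/
theorem norm_limit_sub_limit_le (H : OneStepScheme j F W A₀ A κ C τ) (hν : ν ∈ Icc (0 : ℝ) 1)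
    {ν' : ℝ} (hν' : ν' ∈ Icc (0 : ℝ) 1) (hx : x ∈ A₀) (hy : y ∈ A₀) {t : ℝ} (ht : t ∈ Icc 0 τ) :
    ‖limit F τ ν x t - limit F τ ν' y t‖ ≤ κ * (‖x - y‖ + C * τ * |ν - ν'|) := by
  have hC := H.C_nonneg
  have hκ := H.κ_nonneg
  refine le_of_tendsto
    ((H.tendsto_approx hν hx ht).sub (H.tendsto_approx hν' hy ht)).norm
    (Eventually.of_forall fun n => ?_)
  have hh := stepSize_mem H.τ_pos n
  have hle := H.floor_mul_stepSize_le n ht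
  set h := τ / 2 ^ n
  have hh0 := hh.1
  have hmem : ∀ {ν x}, ν ∈ Icc (0 : ℝ) 1 → x ∈ A₀ → ∀ k ≤ ⌊t / h⌋₊, (F ν h)^[k] x ∈ A :=
    fun hν hx k hk => H.mem _ hν h hh k (le_trans (by gcongr) hle) _ hx
  -- An orbit for `ν'` is an approximate orbit for `ν` with defect `C |ν - ν'| h` per step.
  have key := H.stable ν hν h hh ⌊t / h⌋₊ hle (fun k => (F ν h)^[k] x) (fun k => (F ν' h)^[k] y)
    (C * |ν - ν'| * h) (by positivity) (hmem hν hx) (hmem hν' hy)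
    (fun k _ => Function.iterate_succ_apply' _ _ _)
    (fun k hk => by
      rw [Function.iterate_succ_apply']
      exact H.param ν hν ν' hν' h hh _ (hmem hν' hy k hk.le))
  refine key.trans ?_
  simp only [Function.iterate_zero, id_eq]
  refine mul_le_mul_of_nonneg_left (add_le_add le_rfl ?_) hκ
  calc (⌊t / h⌋₊ : ℝ) * (C * |ν - ν'| * h) = C * (⌊t / h⌋₊ * h) * |ν - ν'| := by ring
    _ ≤ _ := by gcongr

end OneStepScheme

/-! ### Local stability from quasi-contraction, and confinement of orbits. -/

section LocalEstimates

variable {E Y : Type*} [NormedAddCommGroup E] [NormedAddCommGroup Y]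
  {T : ℝ} {U : Set E} {x₀ : E}

theorem exists_forall_of_eventually (hT : 0 < T) (hU : IsOpen U) (hx₀ : x₀ ∈ U)
    {P : ℝ × E → Prop} (h : ∀ᶠ p in 𝓝[Ico 0 T ×ˢ U] ((0 : ℝ), x₀), P p) :
    ∃ σ > 0, σ ≤ T ∧ ∃ ρ > 0, ball x₀ ρ ⊆ U ∧
      ∀ t ∈ Ico (0 : ℝ) σ, ∀ x ∈ ball x₀ ρ, P (t, x) := by
  rw [nhdsWithin_prod_eq] at h
  have h1 : (𝓝[Ico 0 T] (0 : ℝ)).HasBasis (fun σ => 0 < σ ∧ σ ≤ T) fun σ => Ico 0 σ := by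
    rw [nhdsWithin_Ico_eq_nhdsGE hT]
    refine (nhdsGE_basis (0 : ℝ)).to_hasBasis (fun σ hσ => ⟨min σ T, ⟨lt_min hσ hT,
      min_le_right _ _⟩, Ico_subset_Ico_right (min_le_left _ _)⟩) fun σ hσ => ⟨σ, hσ.1, le_rfl⟩
  have h2 : (𝓝[U] x₀).HasBasis (fun ρ => 0 < ρ ∧ ball x₀ ρ ⊆ U) fun ρ => ball x₀ ρ := by
    rw [hU.nhdsWithin_eq hx₀]
    obtain ⟨r, hr, hrU⟩ := Metric.isOpen_iff.1 hU x₀ hx₀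
    refine nhds_basis_ball.to_hasBasis (fun ρ hρ => ⟨min ρ r, ⟨lt_min hρ hr,
      (ball_subset_ball (min_le_right _ _)).trans hrU⟩, ball_subset_ball (min_le_left _ _)⟩)
      fun ρ hρ => ⟨ρ, hρ.1, le_rfl⟩
  obtain ⟨⟨σ, ρ⟩, ⟨⟨hσ, hσT⟩, hρ, hρU⟩, hP⟩ := (h1.prod h2).eventually_iff.1 h
  exact ⟨σ, hσ, hσT, ρ, hρ, hρU, fun t ht x hx => hP ⟨ht, hx⟩⟩

theorem exists_mapsTo_of_continuousOn (hT : 0 < T) (hU : IsOpen U) (hx₀ : x₀ ∈ U)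
    {f : ℝ → E → E} (hf : ContinuousOn (fun p : ℝ × E => f p.1 p.2) (Ico 0 T ×ˢ U))
    (h0 : f 0 x₀ = x₀) {N : Set E} (hN : N ∈ 𝓝 x₀) :
    ∃ σ > 0, σ ≤ T ∧ ∃ ρ > 0, ball x₀ ρ ⊆ U ∧
      ∀ t ∈ Ico (0 : ℝ) σ, ∀ x ∈ ball x₀ ρ, f t x ∈ N := by
  refine exists_forall_of_eventually hT hU hx₀ (P := fun p => f p.1 p.2 ∈ N) ?_
  have := hf (0, x₀) ⟨⟨le_rfl, hT⟩, hx₀⟩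
  exact this.eventually (by simpa [h0] using hN)

/-- On the ball of radius `ρ` around `x₀`, the maps `G t` and `S t`, `t < σ`, and the compositions
`G t ∘ S s` are quasi-contractions for the distance function `d`. -/
structure ContractiveNear (G S : ℝ → E → E) (U : Set E) (x₀ : E) (N : Set E) (d : E → E → ℝ)
    (L₁ L₂ β ρ σ : ℝ) : Prop where
  L₁_pos : 0 < L₁
  L₂_pos : 0 < L₂
  β_pos : 0 < β
  ρ_pos : 0 < ρ
  σ_pos : 0 < σ
  ball_subset : ball x₀ ρ ⊆ N
  symm : ∀ x ∈ N, ∀ y ∈ N, d x y = d y x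
  triangle : ∀ x ∈ N, ∀ y ∈ N, ∀ z ∈ N, d x z ≤ d x y + d y z
  le_norm : ∀ x ∈ N, ∀ y ∈ N, L₁ * d x y ≤ ‖x - y‖
  norm_le : ∀ x ∈ N, ∀ y ∈ N, ‖x - y‖ ≤ L₂ * d x y
  mem : ∀ s ∈ Ico 0 σ, ∀ t ∈ Ico 0 σ, ∀ x ∈ ball x₀ ρ, S s x ∈ U ∧ G t (S s x) ∈ N
  contr : ∀ s ∈ Ico 0 σ, ∀ t ∈ Ico 0 σ, ∀ x ∈ ball x₀ ρ, ∀ y ∈ ball x₀ ρ,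
    d (G t (S s x)) (G t (S s y)) ≤ Real.exp (β * (t + s)) * d x y

/-- The quasi-contraction property is available only on a set that both maps send into `N`. The ball
of radius `r` is such a set, and a smaller ball that `S` sends into it allows `G` to be applied
after `S`. -/
theorem LocallyQuasiContraction.exists_contractiveNear (hT : 0 < T) (hU : IsOpen U) (hx₀ : x₀ ∈ U)
    {G S : ℝ → E → E}
    (hG : ContinuousOn (fun p : ℝ × E => G p.1 p.2) (Ico 0 T ×ˢ U))
    (hS : ContinuousOn (fun p : ℝ × E => S p.1 p.2) (Ico 0 T ×ˢ U))
    (hG0 : G 0 x₀ = x₀) (hS0 : S 0 x₀ = x₀) (h : LocallyQuasiContraction T U G S) :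
    ∃ N d L₁ L₂ β ρ σ, ContractiveNear G S U x₀ N d L₁ L₂ β ρ σ := by
  obtain ⟨N, hNo, hxN, hNU, d, ⟨hsymm, htri, L₁, L₂, hL₁, hL, hd⟩, β, hβ, hc⟩ := h x₀ hx₀
  have hN := hNo.mem_nhds hxN
  obtain ⟨σ₁, hσ₁, hσ₁T, ρ₁, hρ₁, -, h1⟩ := exists_mapsTo_of_continuousOn hT hU hx₀ hG hG0 hN
  obtain ⟨σ₂, hσ₂, hσ₂T, ρ₂, hρ₂, -, h2⟩ := exists_mapsTo_of_continuousOn hT hU hx₀ hS hS0 hN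
  obtain ⟨ρ₀, hρ₀, hρ₀N⟩ := Metric.isOpen_iff.1 hNo x₀ hxN
  set r := min ρ₀ (min ρ₁ ρ₂) with hr
  have hr0 : 0 < r := lt_min hρ₀ (lt_min hρ₁ hρ₂)
  have hrN : ball x₀ r ⊆ N := (ball_subset_ball (min_le_left _ _)).trans hρ₀N
  obtain ⟨σ₃, hσ₃, hσ₃T, ρ₃, hρ₃, -, h3⟩ := exists_mapsTo_of_continuousOn hT hU hx₀ hS hS0
    (ball_mem_nhds x₀ hr0)
  set σ := min σ₁ (min σ₂ σ₃)
  have hσ : 0 < σ := lt_min hσ₁ (lt_min hσ₂ hσ₃)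
  have hσ1 : σ ≤ σ₁ := min_le_left _ _
  have hσ2 : σ ≤ σ₂ := (min_le_right _ _).trans (min_le_left _ _)
  have hσ3 : σ ≤ σ₃ := (min_le_right _ _).trans (min_le_right _ _)
  have hr1 : r ≤ ρ₁ := (min_le_right _ _).trans (min_le_left _ _)
  have hr2 : r ≤ ρ₂ := (min_le_right _ _).trans (min_le_right _ _)
  have hc' := hc (ball x₀ r) isOpen_ball hrN σ hσ (hσ1.trans hσ₁T) fun t ht =>
    ⟨fun x hx => h1 t ⟨ht.1, ht.2.trans_le hσ1⟩ x (ball_subset_ball hr1 hx),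
     fun x hx => h2 t ⟨ht.1, ht.2.trans_le hσ2⟩ x (ball_subset_ball hr2 hx)⟩
  have h3' : ∀ s ∈ Ico 0 σ, ∀ x ∈ ball x₀ (min r ρ₃), S s x ∈ ball x₀ r := fun s hs x hx =>
    h3 s ⟨hs.1, hs.2.trans_le hσ3⟩ x (ball_subset_ball (min_le_right _ _) hx)
  have hrr : ball x₀ (min r ρ₃) ⊆ ball x₀ r := ball_subset_ball (min_le_left _ _)
  refine ⟨N, d, L₁, L₂, β, min r ρ₃, σ, hL₁, hL₁.trans hL, hβ, lt_min hr0 hρ₃, hσ,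
    hrr.trans hrN, hsymm, htri, fun x hx y hy => (hd x hx y hy).1,
    fun x hx y hy => (hd x hx y hy).2, fun s hs t ht x hx => ?_, fun s hs t ht x hx y hy => ?_⟩
  · have := h3' s hs x hx
    exact ⟨hNU (hrN this), h1 t ⟨ht.1, ht.2.trans_le hσ1⟩ _ (ball_subset_ball hr1 this)⟩
  · have hx' := h3' s hs x hx
    have hy' := h3' s hs y hy
    refine (hc' _ hx' _ hy' t ht).1.trans ?_
    rw [mul_add, Real.exp_add, mul_assoc]
    gcongr
    exact (hc' _ (hrr hx) _ (hrr hy) s hs).2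

/-- The stability estimate for the Lie-Trotter iteration `G h ∘ S (ν * h)`. -/
theorem ContractiveNear.norm_sub_le {G S : ℝ → E → E} {N : Set E} {d : E → E → ℝ}
    {L₁ L₂ β ρ σ : ℝ} (H : ContractiveNear G S U x₀ N d L₁ L₂ β ρ σ) {ν h : ℝ}
    (hν : ν ∈ Icc (0 : ℝ) 1) (hh : h ∈ Ico 0 σ) {n : ℕ} (hn : n * h ≤ σ) {x y : ℕ → E} {δ : ℝ}
    (hδ : 0 ≤ δ) (hx0 : x 0 ∈ ball x₀ ρ) (hx : ∀ k < n, x k ∈ ball x₀ ρ)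
    (hy : ∀ k ≤ n, y k ∈ ball x₀ ρ) (hxs : ∀ k < n, x (k + 1) = G h (S (ν * h) (x k)))
    (hys : ∀ k < n, ‖G h (S (ν * h) (y k)) - y (k + 1)‖ ≤ δ) :
    ‖x n - y n‖ ≤ L₂ / L₁ * Real.exp (2 * β * σ) * (‖x 0 - y 0‖ + n * δ) := by
  have hL₁ := H.L₁_pos
  have hL₂ := H.L₂_pos
  have hβ := H.β_pos
  have hνh : ν * h ∈ Ico 0 σ := ⟨mul_nonneg hν.1 hh.1, by nlinarith [hν.1, hν.2, hh.1, hh.2]⟩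
  have hνh' : ν * h ≤ h := by nlinarith [hν.2, hh.1]
  -- The last point is not assumed to lie in the ball, so that the estimate can be used to prove
  -- that it does; as the image of its predecessor it lies in `N`, which is all that `d` requires.
  have hxN : x n ∈ N := by
    cases n with
    | zero => exact H.ball_subset hx0
    | succ n =>
      rw [hxs n n.lt_succ_self]
      exact (H.mem _ hνh _ hh _ (hx n n.lt_succ_self)).2
  have hstep : ∀ k < n, d (x (k + 1)) (y (k + 1))
      ≤ Real.exp (2 * β * h) * d (x k) (y k) + δ / L₁ := fun k hk => by
    have hxk := hx k hk
    have hyk := hy k hk.le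
    have h1 := H.contr _ hνh _ hh _ hxk _ hyk
    have hFx := (H.mem _ hνh _ hh _ hxk).2
    have hFy := (H.mem _ hνh _ hh _ hyk).2
    have hy' := H.ball_subset (hy (k + 1) hk)
    have h2 := H.le_norm _ hFy _ hy'
    rw [hxs k hk]
    refine (H.triangle _ hFx _ hFy _ hy').trans (add_le_add (h1.trans ?_) ?_)
    · have : 0 ≤ d (x k) (y k) := by
        have := (norm_nonneg _).trans (H.norm_le _ (H.ball_subset hxk) _ (H.ball_subset hyk))
        exact nonneg_of_mul_nonneg_right this hL₂
      have hexp : β * (h + ν * h) ≤ 2 * β * h := by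
        linarith [mul_le_mul_of_nonneg_left hνh' hβ.le]
      exact mul_le_mul_of_nonneg_right (Real.exp_le_exp.2 hexp) this
    · rw [le_div_iff₀ hL₁, mul_comm]
      exact h2.trans (hys k hk)
  have key := le_exp_mul_of_step (a := fun k => d (x k) (y k)) (by positivity) hh.1
    (div_nonneg hδ hL₁.le) hstep
  have h0 := H.le_norm _ (H.ball_subset hx0) _ (H.ball_subset (hy 0 n.zero_le))
  calc ‖x n - y n‖ ≤ L₂ * d (x n) (y n) := H.norm_le _ hxN _ (H.ball_subset (hy n le_rfl))
    _ ≤ L₂ * (Real.exp (2 * β * σ) * (‖x 0 - y 0‖ / L₁ + n * (δ / L₁))) := by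
        refine mul_le_mul_of_nonneg_left (key.trans ?_) hL₂.le
        have h1 : d (x 0) (y 0) ≤ ‖x 0 - y 0‖ / L₁ := by rwa [le_div_iff₀ hL₁, mul_comm]
        have h2 : Real.exp (2 * β * (n * h)) ≤ Real.exp (2 * β * σ) := by gcongr
        calc _ ≤ Real.exp (2 * β * (n * h)) * (‖x 0 - y 0‖ / L₁ + n * (δ / L₁)) := by gcongr
          _ ≤ _ := by gcongr
    _ = _ := by field_simp

/-- Orbits starting near a point that can be approximated by points moving with finite speed stay
in a given ball for a short time. -/
theorem exists_iterate_mem_ball {F : ℝ → ℝ → E → E} {z₀ : E} {κ ρ σ : ℝ} (hκ : 0 ≤ κ)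
    (hρ : 0 < ρ) (hσ : 0 < σ)
    (hstable : ∀ ν ∈ Icc (0 : ℝ) 1, ∀ h ∈ Ico 0 σ, ∀ n : ℕ, n * h ≤ σ → ∀ x y : ℕ → E, ∀ δ : ℝ,
      0 ≤ δ → x 0 ∈ ball z₀ ρ → (∀ k < n, x k ∈ ball z₀ ρ) → (∀ k ≤ n, y k ∈ ball z₀ ρ) →
      (∀ k < n, x (k + 1) = F ν h (x k)) → (∀ k < n, ‖F ν h (y k) - y (k + 1)‖ ≤ δ) →
      ‖x n - y n‖ ≤ κ * (‖x 0 - y 0‖ + n * δ))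
    (hslow : ∀ η > 0, ∃ z₁ ∈ ball z₀ η, ∃ C ≥ 0, ∃ σ₁ > 0, ∀ ν ∈ Icc (0 : ℝ) 1,
      ∀ h ∈ Ico 0 σ₁, ‖F ν h z₁ - z₁‖ ≤ C * h) :
    ∃ η > 0, η ≤ ρ ∧ ∃ τ > 0, τ < σ ∧ ∀ ν ∈ Icc (0 : ℝ) 1, ∀ h ∈ Ioc 0 τ, ∀ n : ℕ, n * h ≤ τ →
      ∀ z ∈ ball z₀ η, (F ν h)^[n] z ∈ ball z₀ ρ := by
  -- With this choice the final bound is `2κη + ρ/4 + η ≤ 3ρ/4`: distance to the orbit of `z₁`,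
  -- displacement of that orbit, and distance from `z₁` to `z₀`.
  set η := ρ / (4 * (κ + 1)) with hη
  have hη0 : 0 < η := by positivity
  have hηρ : 4 * (κ * η + η) = ρ := by rw [hη]; field_simp
  have hκη : 0 ≤ κ * η := by positivity
  obtain ⟨z₁, hz₁, C, hC, σ₁, hσ₁, hslow⟩ := hslow η hη0
  rw [mem_ball, dist_eq_norm] at hz₁
  set τ := min (min (σ / 2) (σ₁ / 2)) (ρ / (4 * (κ * C + 1))) with hτ
  have hτ0 : 0 < τ := by positivity
  have hτσ : τ < σ := lt_of_le_of_lt ((min_le_left _ _).trans (min_le_left _ _)) (by linarith)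
  have hτσ₁ : τ < σ₁ := lt_of_le_of_lt ((min_le_left _ _).trans (min_le_right _ _)) (by linarith)
  have hτC : κ * C * τ ≤ ρ / 4 := by
    have h1 : τ ≤ ρ / (4 * (κ * C + 1)) := min_le_right _ _
    have h2 : 0 ≤ κ * C := by positivity
    rw [le_div_iff₀ (by positivity)] at h1
    nlinarith
  have hηle : η ≤ ρ := by linarith
  have hz₁ρ : z₁ ∈ ball z₀ ρ := by rw [mem_ball, dist_eq_norm]; linarith
  have base : ∀ ν ∈ Icc (0 : ℝ) 1, ∀ h ∈ Ioc 0 τ, ∀ n : ℕ, n * h ≤ τ →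
      ‖(F ν h)^[n] z₁ - z₁‖ ≤ ρ / 4 ∧ (F ν h)^[n] z₁ ∈ ball z₀ ρ := by
    intro ν hν h hh n
    have hh' : h ∈ Ico 0 σ := ⟨hh.1.le, hh.2.trans_lt hτσ⟩
    induction n using Nat.strong_induction_on with
    | _ n ih =>
      intro hn
      have hb : ‖(F ν h)^[n] z₁ - z₁‖ ≤ ρ / 4 := by
        -- The constant sequence `z₁` is an approximate orbit with defect `C h`, so the true orbit
        -- of `z₁` is displaced by at most `κ C τ ≤ ρ / 4`. Stability at `n` needs the orbit in the
        -- ball only before `n`, which closes the induction.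
        have := hstable ν hν h hh' n (hn.trans hτσ.le) (fun k => (F ν h)^[k] z₁) (fun _ => z₁)
          (C * h) (mul_nonneg hC hh.1.le) hz₁ρ
          (fun k hk => (ih k hk (le_trans (by have := hh.1; gcongr) hn)).2) (fun _ _ => hz₁ρ)
          (fun k _ => Function.iterate_succ_apply' _ _ _)
          (fun k _ => hslow ν hν h ⟨hh.1.le, hh.2.trans_lt hτσ₁⟩)
        simp only [Function.iterate_zero, id_eq, sub_self, norm_zero, zero_add] at this
        refine this.trans (le_trans ?_ hτC)
        calc κ * (n * (C * h)) = κ * C * (n * h) := by ring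
          _ ≤ _ := by gcongr
      refine ⟨hb, ?_⟩
      rw [mem_ball, dist_eq_norm]
      have := norm_sub_le_norm_sub_add_norm_sub ((F ν h)^[n] z₁) z₁ z₀
      linarith
  refine ⟨η, hη0, hηle, τ, hτ0, hτσ, fun ν hν h hh n => ?_⟩
  have hh' : h ∈ Ico 0 σ := ⟨hh.1.le, hh.2.trans_lt hτσ⟩
  induction n using Nat.strong_induction_on with
  | _ n ih =>
    intro hn z hz
    have hle : ∀ k ≤ n, (k : ℝ) * h ≤ τ := fun k hk => le_trans (by have := hh.1; gcongr) hn
    -- The orbit of an arbitrary `z` is compared with that of `z₁`, an exact orbit, so with defect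
    -- zero.
    have hb := hstable ν hν h hh' n (hn.trans hτσ.le) (fun k => (F ν h)^[k] z)
      (fun k => (F ν h)^[k] z₁) 0 le_rfl (ball_subset_ball hηle hz)
      (fun k hk => ih k hk (hle k hk.le) z hz) (fun k hk => (base ν hν h hh k (hle k hk)).2)
      (fun k _ => Function.iterate_succ_apply' _ _ _)
      (fun k _ => by rw [Function.iterate_succ_apply', sub_self, norm_zero])
    simp only [Function.iterate_zero, id_eq, mul_zero, add_zero] at hb
    have hz1 := (base ν hν h hh n hn).1
    rw [mem_ball, dist_eq_norm] at hz ⊢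
    have h1 := norm_sub_le_norm_sub_add_norm_sub ((F ν h)^[n] z) ((F ν h)^[n] z₁) z₀
    have h2 := norm_sub_le_norm_sub_add_norm_sub ((F ν h)^[n] z₁) z₁ z₀
    have h3 := norm_sub_le_norm_sub_add_norm_sub z z₀ z₁
    rw [norm_sub_rev z₀ z₁] at h3
    have h4 : κ * ‖z - z₁‖ ≤ κ * (2 * η) := by gcongr; linarith
    linarith

end LocalEstimates

/-! ### Local Taylor and Lipschitz estimates for smooth semigroups. -/

section Smooth

variable {E Y : Type*} [NormedAddCommGroup E] [NormedSpace ℝ E] [NormedAddCommGroup Y]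
  [NormedSpace ℝ Y] {T : ℝ} {U : Set E} {x₀ : E}

theorem norm_sub_sub_smul_le {f f' : ℝ → Y} {σ K : ℝ}
    (hf : ∀ t ∈ Ico 0 σ, HasDerivWithinAt f (f' t) (Ico 0 σ) t)
    (hK : ∀ t ∈ Ico 0 σ, ‖f' t - f' 0‖ ≤ K * t) {t : ℝ} (ht : t ∈ Ico 0 σ) :
    ‖f t - f 0 - t • f' 0‖ ≤ K * t ^ 2 := by
  have hsub : Icc 0 t ⊆ Ico 0 σ := fun s hs => ⟨hs.1, hs.2.trans_lt ht.2⟩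
  have hd : ∀ s ∈ Icc 0 t, HasDerivWithinAt (fun s => f s - s • f' 0) (f' s - f' 0) (Icc 0 t) s :=
    fun s hs => by
      have h := ((hf s (hsub hs)).mono hsub).sub ((hasDerivWithinAt_id s _).smul_const (f' 0))
      rw [one_smul] at h
      exact h
  have := norm_image_sub_le_of_norm_deriv_le_segment' hd (C := K * t) (fun s hs => by
    refine (hK s (hsub (Ico_subset_Icc_self hs))).trans ?_
    have hKt : 0 ≤ K * t := (norm_nonneg _).trans (hK t ht)
    rcases hs.1.eq_or_lt with h0 | h0
    · rw [← h0, mul_zero]; exact hKt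
    · have : 0 ≤ K := nonneg_of_mul_nonneg_left hKt (h0.trans hs.2)
      gcongr
      exact hs.2.le) t ⟨ht.1, le_rfl⟩
  simp only [zero_smul, sub_zero] at this
  rw [sub_right_comm]
  refine this.trans (le_of_eq ?_)
  ring

theorem norm_sub_le_of_hasDerivWithinAt {f f' : ℝ → Y} {σ K : ℝ}
    (hf : ∀ t ∈ Ico 0 σ, HasDerivWithinAt f (f' t) (Ico 0 σ) t)
    (hK : ∀ t ∈ Ico 0 σ, ‖f' t‖ ≤ K) {s t : ℝ} (hs : s ∈ Ico 0 σ) (ht : t ∈ Ico 0 σ) :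
    ‖f t - f s‖ ≤ K * |t - s| :=
  (convex_Ico 0 σ).norm_image_sub_le_of_norm_hasDerivWithin_le hf hK hs ht

theorem generator_eq_of_hasDerivWithinAt {S : ℝ → E → E} {x v : E} {σ : ℝ} (hσ : 0 < σ)
    (h : HasDerivWithinAt (fun t => S t x) v (Ico 0 σ) 0) : generator S x = v :=
  HasDerivWithinAt.derivWithin (h.mono_of_mem_nhdsWithin (Ico_mem_nhdsGE hσ))
    (uniqueDiffOn_Ici 0 0 self_mem_Ici)

/-- Local estimates for a semigroup of class `C²` and its generator. -/
theorem exists_estimates_of_contDiffOn (hT : 0 < T) (hU : IsOpen U) (hx₀ : x₀ ∈ U)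
    {G : ℝ → E → E} (hG : ContDiffOn ℝ 2 (fun p : ℝ × E => G p.1 p.2) (Ico 0 T ×ˢ U))
    (hG0 : ∀ x ∈ U, G 0 x = x) :
    ∃ σ > 0, σ ≤ T ∧ ∃ ρ > 0, ball x₀ ρ ⊆ U ∧ ∃ K ≥ 0,
      (∀ t ∈ Ico 0 σ, ∀ x ∈ ball x₀ ρ, ‖G t x - x - t • generator G x‖ ≤ K * t ^ 2) ∧
      (∀ x ∈ ball x₀ ρ, ∀ y ∈ ball x₀ ρ, ‖generator G x - generator G y‖ ≤ K * ‖x - y‖) ∧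
      (∀ t ∈ Ico 0 σ, ∀ x ∈ ball x₀ ρ, ∀ y ∈ ball x₀ ρ, ‖G t x - G t y‖ ≤ K * ‖x - y‖) ∧
      (∀ t ∈ Ico 0 σ, ∀ x ∈ ball x₀ ρ, ‖G t x - x‖ ≤ K * t) := by
  obtain ⟨r, hr, hrU⟩ := Metric.isOpen_iff.1 hU x₀ hx₀
  -- Passing to a ball makes the domain convex, so that `C¹` maps on it are Lipschitz near the
  -- boundary time `0` as well.
  set s : Set (ℝ × E) := Ico 0 T ×ˢ ball x₀ r with hs
  have hconv : Convex ℝ s := (convex_Ico 0 T).prod (convex_ball x₀ r)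
  have hud : UniqueDiffOn ℝ s := (uniqueDiffOn_Ico 0 T).prod isOpen_ball.uniqueDiffOn
  have hGs : ContDiffOn ℝ 2 (fun p : ℝ × E => G p.1 p.2) s := hG.mono (prod_mono le_rfl hrU)
  have h0s : ((0 : ℝ), x₀) ∈ s := ⟨⟨le_rfl, hT⟩, mem_ball_self hr⟩
  -- `g` is the time derivative of `G`; it is `C¹`, hence locally Lipschitz jointly in time and
  -- space, and `g (0, ·)` is the generator.
  set g : ℝ × E → E := fun p => fderivWithin ℝ (fun p : ℝ × E => G p.1 p.2) s p (1, 0) with hg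
  have hgC : ContDiffOn ℝ 1 g s :=
    (hGs.fderivWithin hud (m := 1) (by norm_num)).clm_apply contDiffOn_const
  obtain ⟨K₁, V₁, hV₁, hK₁⟩ := (hgC _ h0s).exists_lipschitzOnWith hconv
  obtain ⟨K₂, V₂, hV₂, hK₂⟩ := ContDiffWithinAt.exists_lipschitzOnWith
    ((hGs.of_le (m := 1) (by norm_num)) _ h0s) hconv
  obtain ⟨σ, hσ, hσT, ρ, hρ, hρr, hP⟩ := exists_forall_of_eventually hT isOpen_ball
    (mem_ball_self hr) (P := fun p => p ∈ V₁ ∧ p ∈ V₂) (inter_mem hV₁ hV₂)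
  have hder : ∀ x ∈ ball x₀ r, ∀ t ∈ Ico 0 T,
      HasDerivWithinAt (fun t => G t x) (g (t, x)) (Ico 0 T) t := fun x hx t ht => by
    have h1 := ((hGs.differentiableOn (by norm_num)) (t, x) ⟨ht, hx⟩).hasFDerivWithinAt
    have h2 : HasDerivWithinAt (fun t : ℝ => (t, x)) ((1 : ℝ), (0 : E)) (Ico 0 T) t :=
      (hasDerivWithinAt_id t _).prodMk (hasDerivWithinAt_const t _ x)
    exact HasFDerivWithinAt.comp_hasDerivWithinAt t h1 h2
      (fun t ht => (⟨ht, hx⟩ : (t, x) ∈ s))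
  have hgen : ∀ x ∈ ball x₀ r, generator G x = g (0, x) := fun x hx =>
    generator_eq_of_hasDerivWithinAt hT (hder x hx 0 ⟨le_rfl, hT⟩)
  have h0 : (0 : ℝ) ∈ Ico 0 σ := ⟨le_rfl, hσ⟩
  have hle1 : (K₁ : ℝ) ≤ max K₁ K₂ := le_max_left _ _
  have hle2 : (K₂ : ℝ) ≤ max K₁ K₂ := le_max_right _ _
  have L1 : ∀ t ∈ Ico 0 σ, ∀ t' ∈ Ico 0 σ, ∀ x ∈ ball x₀ ρ, ∀ y ∈ ball x₀ ρ,
      ‖g (t, x) - g (t', y)‖ ≤ max K₁ K₂ * max |t - t'| ‖x - y‖ := by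
    intro t ht t' ht' x hx y hy
    refine (hK₁.norm_sub_le (hP t ht x hx).1 (hP t' ht' y hy).1).trans ?_
    exact mul_le_mul_of_nonneg_right hle1 (norm_nonneg _)
  have L2 : ∀ t ∈ Ico 0 σ, ∀ t' ∈ Ico 0 σ, ∀ x ∈ ball x₀ ρ, ∀ y ∈ ball x₀ ρ,
      ‖G t x - G t' y‖ ≤ max K₁ K₂ * max |t - t'| ‖x - y‖ := by
    intro t ht t' ht' x hx y hy
    refine (hK₂.norm_sub_le (hP t ht x hx).2 (hP t' ht' y hy).2).trans ?_
    exact mul_le_mul_of_nonneg_right hle2 (norm_nonneg _)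
  have hsub : Ico 0 σ ⊆ Ico 0 T := Ico_subset_Ico_right hσT
  refine ⟨σ, hσ, hσT, ρ, hρ, hρr.trans hrU, max K₁ K₂, le_max_of_le_left K₁.2,
    fun t ht x hx => ?_, fun x hx y hy => ?_, fun t ht x hx y hy => ?_, fun t ht x hx => ?_⟩
  · have := norm_sub_sub_smul_le (f := fun t => G t x) (f' := fun t => g (t, x)) (K := max K₁ K₂)
      (fun t ht => (hder x (hρr hx) t (hsub ht)).mono hsub) (fun t ht => by
        simpa [abs_of_nonneg ht.1, ht.1] using L1 t ht 0 h0 x hx x hx) ht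
    rwa [hG0 x (hrU (hρr hx)), ← hgen x (hρr hx)] at this
  · rw [hgen x (hρr hx), hgen y (hρr hy)]
    simpa using L1 0 h0 0 h0 x hx y hy
  · simpa using L2 t ht t ht x hx y hy
  · have := L2 t ht 0 h0 x hx x hx
    rw [hG0 x (hrU (hρr hx))] at this
    simpa [abs_of_nonneg ht.1, ht.1] using this

/-- Local estimates for a semigroup of class `C²` along curves and its generator. -/
theorem ContDiffAlongCurves.exists_estimates {X Z : Type*} [NormedAddCommGroup X] [NormedSpace ℝ X]
    [NormedAddCommGroup Z] [NormedSpace ℝ Z] {V : Set Z} {z₀ : Z} (hT : 0 < T)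
    (hV : IsOpen V) (hz₀ : z₀ ∈ V) {i : Z → X} {S : ℝ → X → X}
    (hS : ContDiffAlongCurves 2 T V fun t z => S t (i z)) (hS0 : ∀ z ∈ V, S 0 (i z) = i z) :
    ∃ σ > 0, σ ≤ T ∧ ∃ ρ > 0, ball z₀ ρ ⊆ V ∧ ∃ K ≥ 0,
      (∀ t ∈ Ico 0 σ, ∀ z ∈ ball z₀ ρ,
        ‖S t (i z) - i z - t • generator S (i z)‖ ≤ K * t ^ 2) ∧
      (∀ s ∈ Ico 0 σ, ∀ t ∈ Ico 0 σ, ∀ z ∈ ball z₀ ρ, ‖S t (i z) - S s (i z)‖ ≤ K * |t - s|) := by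
  set f : ℝ → Z → X := fun t z => S t (i z) with hf
  set f₁ : ℝ → Z → X := fun t z => derivWithin (fun s => f s z) (Ico 0 T) t with hf₁
  set f₂ : ℝ → Z → X := fun t z => derivWithin (fun s => f₁ s z) (Ico 0 T) t with hf₂
  have hd1 : ∀ t ∈ Ico 0 T, ∀ z ∈ V, HasDerivWithinAt (fun s => f s z) (f₁ t z) (Ico 0 T) t :=
    fun t ht z hz => (((hS []).1 (by simp) (fun _ => 0) t ht z hz).1).hasDerivWithinAt
  have hd2 : ∀ t ∈ Ico 0 T, ∀ z ∈ V, HasDerivWithinAt (fun s => f₁ s z) (f₂ t z) (Ico 0 T) t :=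
    fun t ht z hz => (((hS [true]).1 (by simp) (fun _ => 0) t ht z hz).1).hasDerivWithinAt
  have hc1 : ContinuousOn (fun p : ℝ × Z => f₁ p.1 p.2) (Ico 0 T ×ˢ V) :=
    ((hS [true]).2 (by simp)).comp (f := fun p : ℝ × Z => (p.1, p.2, fun _ => 0))
      (by fun_prop) fun p hp => ⟨hp.1, hp.2, trivial⟩
  have hc2 : ContinuousOn (fun p : ℝ × Z => f₂ p.1 p.2) (Ico 0 T ×ˢ V) :=
    ((hS [true, true]).2 (by simp)).comp (f := fun p : ℝ × Z => (p.1, p.2, fun _ => 0))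
      (by fun_prop) fun p hp => ⟨hp.1, hp.2, trivial⟩
  have h0 : ((0 : ℝ), z₀) ∈ Ico 0 T ×ˢ V := ⟨⟨le_rfl, hT⟩, hz₀⟩
  -- The first and second time derivatives are jointly continuous, so they are bounded by `K` near
  -- `(0, z₀)`; no Fréchet differentiability is needed.
  set K := max (‖f₁ 0 z₀‖ + 1) (‖f₂ 0 z₀‖ + 1) with hK
  have hK0 : 0 ≤ K := le_max_of_le_left (by positivity)
  obtain ⟨σ, hσ, hσT, ρ, hρ, hρV, hP⟩ := exists_forall_of_eventually hT hV hz₀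
    (P := fun p => ‖f₁ p.1 p.2‖ ≤ K ∧ ‖f₂ p.1 p.2‖ ≤ K) (by
      have e1 := (hc1 _ h0).norm.eventually_le_const (u := K)
        (lt_max_of_lt_left (lt_add_one _))
      have e2 := (hc2 _ h0).norm.eventually_le_const (u := K)
        (lt_max_of_lt_right (lt_add_one _))
      exact e1.and e2)
  have hsub : Ico 0 σ ⊆ Ico 0 T := Ico_subset_Ico_right hσT
  refine ⟨σ, hσ, hσT, ρ, hρ, hρV, K, hK0, fun t ht z hz => ?_, fun s hs t ht z hz =>
    norm_sub_le_of_hasDerivWithinAt (fun t ht => (hd1 t (hsub ht) z (hρV hz)).mono hsub)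
      (fun t ht => (hP t ht z hz).1) hs ht⟩
  have hgen : generator S (i z) = f₁ 0 z :=
    generator_eq_of_hasDerivWithinAt hT (hd1 0 ⟨le_rfl, hT⟩ z (hρV hz))
  have := norm_sub_sub_smul_le (f := fun t => f t z) (f' := fun t => f₁ t z) (K := K)
    (fun t ht => (hd1 t (hsub ht) z (hρV hz)).mono hsub) (fun t ht => by
      have := norm_sub_le_of_hasDerivWithinAt (fun t ht => (hd2 t (hsub ht) z (hρV hz)).mono hsub)
        (fun t ht => (hP t ht z hz).2) (⟨le_rfl, hσ⟩ : (0 : ℝ) ∈ Ico 0 σ) ht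
      simpa [abs_of_nonneg ht.1] using this) ht
  simp only [hf] at this
  rwa [hS0 z (hρV hz), ← hgen] at this

theorem exists_lipschitz_of_contDiffOn (hU : IsOpen U) (hx₀ : x₀ ∈ U) {f : E → Y}
    (hf : ContDiffOn ℝ 1 f U) :
    ∃ ρ > 0, ball x₀ ρ ⊆ U ∧ ∃ K ≥ 0, ∀ x ∈ ball x₀ ρ, ∀ y ∈ ball x₀ ρ,
      ‖f x - f y‖ ≤ K * ‖x - y‖ := by
  obtain ⟨K, V, hV, hK⟩ := (hf.contDiffAt (hU.mem_nhds hx₀)).exists_lipschitzOnWith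
  obtain ⟨ρ, hρ, h⟩ := Metric.mem_nhds_iff.1 (inter_mem hV (hU.mem_nhds hx₀))
  exact ⟨ρ, hρ, fun x hx => (h hx).2, K, K.2, fun x hx y hy =>
    hK.norm_sub_le (h hx).1 (h hy).1⟩

end Smooth

/-! ### Standing hypotheses and uniform local bounds. -/

/-- The hypotheses under which the Lie-Trotter product `G h ∘ S (ν * h)` is shown to converge. -/
structure Splitting {X Z Xt Zt : Type*}
    [NormedAddCommGroup X] [NormedSpace ℝ X] [NormedAddCommGroup Z] [NormedSpace ℝ Z]
    [NormedAddCommGroup Xt] [NormedSpace ℝ Xt] [NormedAddCommGroup Zt] [NormedSpace ℝ Zt]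
    (i : Z →L[ℝ] X) (j : X →L[ℝ] Xt) (k : Zt →L[ℝ] X) (U : Set X) (T : ℝ)
    (G S : ℝ → X → X) (GZ SZ : ℝ → Z → Z) (Ξ : X → Xt) (ΞZ : Z → Zt) : Prop where
  i_injective : Function.Injective i
  reflexive : Function.Surjective (NormedSpace.inclusionInDoubleDual ℝ Z)
  j_injective : Function.Injective j
  isOpen : IsOpen U
  T_pos : 0 < T
  map_GZ : ∀ t ∈ Ico 0 T, ∀ z ∈ i ⁻¹' U, i (GZ t z) = G t (i z)
  map_SZ : ∀ t ∈ Ico 0 T, ∀ z ∈ i ⁻¹' U, i (SZ t z) = S t (i z)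
  continuousOn_G : ContinuousOn (fun p : ℝ × X => G p.1 p.2) (Ico 0 T ×ˢ U)
  continuousOn_S : ContinuousOn (fun p : ℝ × X => S p.1 p.2) (Ico 0 T ×ˢ U)
  continuousOn_GZ : ContinuousOn (fun p : ℝ × Z => GZ p.1 p.2) (Ico 0 T ×ˢ (i ⁻¹' U))
  continuousOn_SZ : ContinuousOn (fun p : ℝ × Z => SZ p.1 p.2) (Ico 0 T ×ˢ (i ⁻¹' U))
  semigroup_G : LocalSemigroup T U G
  semigroup_S : LocalSemigroup T U S
  semigroup_GZ : LocalSemigroup T (i ⁻¹' U) GZ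
  semigroup_SZ : LocalSemigroup T (i ⁻¹' U) SZ
  contDiffOn_G : ContDiffOn ℝ 2 (fun p : ℝ × X => G p.1 p.2) (Ico 0 T ×ˢ U)
  contDiffOn_GZ : ContDiffOn ℝ 2 (fun p : ℝ × Z => GZ p.1 p.2) (Ico 0 T ×ˢ (i ⁻¹' U))
  contDiff_S : ContDiffAlongCurves 2 T (i ⁻¹' U) (fun t z => S t (i z))
  -- This is what is retained from the space `D`: a dense set of points at which the orbit of `SZ`
  -- has an initial velocity in `Z`.
  dense_differentiable : ∀ z ∈ i ⁻¹' U, ∀ η > 0, ∃ z₁ ∈ ball z η,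
    DifferentiableWithinAt ℝ (fun t => SZ t z₁) (Ico 0 T) 0
  contraction_X : LocallyQuasiContraction T U G S
  contraction_Z : LocallyQuasiContraction T (i ⁻¹' U) GZ SZ
  Ξ_eq : ∀ z ∈ i ⁻¹' U, Ξ (i z) = j (generator S (i z))
  ΞZ_eq : ∀ z ∈ i ⁻¹' U, k (ΞZ z) = generator S (i z)
  contDiffOn_Ξ : ContDiffOn ℝ 1 Ξ U
  contDiffOn_ΞZ : ContDiffOn ℝ 1 ΞZ (i ⁻¹' U)

/-- Uniform estimates near a point `z₀`: the maps preserve the chain of balls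
`R₁ ≤ R₂ ≤ R₃ ≤ R`, and all the constants are bounded by `K`. -/
structure LocalBounds {X Z Xt : Type*}
    [NormedAddCommGroup X] [NormedSpace ℝ X] [NormedAddCommGroup Z] [NormedSpace ℝ Z]
    [NormedAddCommGroup Xt] [NormedSpace ℝ Xt]
    (i : Z →L[ℝ] X) (U : Set X) (T : ℝ) (G S : ℝ → X → X) (GZ SZ : ℝ → Z → Z) (Ξ : X → Xt)
    (z₀ : Z) (ρ σ R R₃ R₂ R₁ K : ℝ) : Prop where
  ρ_pos : 0 < ρ
  σ_pos : 0 < σ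
  σ_le : σ ≤ T
  R₁_pos : 0 < R₁
  R₁_le : R₁ ≤ R₂
  R₂_le : R₂ ≤ R₃
  R₃_le : R₃ ≤ R
  K_nonneg : 0 ≤ K
  ball_subset : ball (i z₀) ρ ⊆ U
  mapsTo_i : ∀ z ∈ ball z₀ R, i z ∈ ball (i z₀) ρ
  mapsTo₁ : ∀ t ∈ Ico 0 σ, ∀ z ∈ ball z₀ R₁, SZ t z ∈ ball z₀ R₂ ∧ GZ t z ∈ ball z₀ R₂
  mapsTo₂ : ∀ t ∈ Ico 0 σ, ∀ z ∈ ball z₀ R₂, SZ t z ∈ ball z₀ R₃ ∧ GZ t z ∈ ball z₀ R₃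
  mapsTo₃ : ∀ t ∈ Ico 0 σ, ∀ z ∈ ball z₀ R₃, SZ t z ∈ ball z₀ R ∧ GZ t z ∈ ball z₀ R
  G_tangent : ∀ t ∈ Ico 0 σ, ∀ x ∈ ball (i z₀) ρ, ‖G t x - x - t • generator G x‖ ≤ K * t ^ 2
  genG_lip : ∀ x ∈ ball (i z₀) ρ, ∀ y ∈ ball (i z₀) ρ,
    ‖generator G x - generator G y‖ ≤ K * ‖x - y‖
  G_lip : ∀ t ∈ Ico 0 σ, ∀ x ∈ ball (i z₀) ρ, ∀ y ∈ ball (i z₀) ρ,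
    ‖G t x - G t y‖ ≤ K * ‖x - y‖
  G_step : ∀ t ∈ Ico 0 σ, ∀ x ∈ ball (i z₀) ρ, ‖G t x - x‖ ≤ K * t
  GZ_step : ∀ t ∈ Ico 0 σ, ∀ z ∈ ball z₀ R, ‖GZ t z - z‖ ≤ K * t
  S_tangent : ∀ t ∈ Ico 0 σ, ∀ z ∈ ball z₀ R,
    ‖S t (i z) - i z - t • generator S (i z)‖ ≤ K * t ^ 2
  S_lip : ∀ s ∈ Ico 0 σ, ∀ t ∈ Ico 0 σ, ∀ z ∈ ball z₀ R, ‖S t (i z) - S s (i z)‖ ≤ K * |t - s|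
  genS_lip : ∀ z ∈ ball z₀ R, ∀ z' ∈ ball z₀ R,
    ‖generator S (i z) - generator S (i z')‖ ≤ K * ‖z - z'‖
  Ξ_lip : ∀ x ∈ ball (i z₀) ρ, ∀ y ∈ ball (i z₀) ρ, ‖Ξ x - Ξ y‖ ≤ K * ‖x - y‖

section

variable {X Z Xt Zt : Type*}
    [NormedAddCommGroup X] [NormedSpace ℝ X] [NormedAddCommGroup Z] [NormedSpace ℝ Z]
    [NormedAddCommGroup Xt] [NormedSpace ℝ Xt] [NormedAddCommGroup Zt] [NormedSpace ℝ Zt]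
    {i : Z →L[ℝ] X} {j : X →L[ℝ] Xt} {k : Zt →L[ℝ] X} {U : Set X} {T : ℝ}
    {G S : ℝ → X → X} {GZ SZ : ℝ → Z → Z} {Ξ : X → Xt} {ΞZ : Z → Zt} {z₀ : Z}

theorem Splitting.isOpen_Z (H : Splitting i j k U T G S GZ SZ Ξ ΞZ) : IsOpen (i ⁻¹' U) :=
  H.isOpen.preimage i.continuous

theorem Splitting.exists_mapsTo_ball (H : Splitting i j k U T G S GZ SZ Ξ ΞZ)
    (hz₀ : z₀ ∈ i ⁻¹' U) {ε : ℝ} (hε : 0 < ε) :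
    ∃ σ > 0, ∃ ρ > 0, ρ ≤ ε ∧ ∀ t ∈ Ico 0 σ, ∀ z ∈ ball z₀ ρ,
      SZ t z ∈ ball z₀ ε ∧ GZ t z ∈ ball z₀ ε := by
  obtain ⟨σ₁, hσ₁, -, ρ₁, hρ₁, -, h1⟩ := exists_mapsTo_of_continuousOn H.T_pos H.isOpen_Z hz₀
    H.continuousOn_SZ (H.semigroup_SZ z₀ hz₀).1 (ball_mem_nhds z₀ hε)
  obtain ⟨σ₂, hσ₂, -, ρ₂, hρ₂, -, h2⟩ := exists_mapsTo_of_continuousOn H.T_pos H.isOpen_Z hz₀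
    H.continuousOn_GZ (H.semigroup_GZ z₀ hz₀).1 (ball_mem_nhds z₀ hε)
  refine ⟨min σ₁ σ₂, lt_min hσ₁ hσ₂, min ε (min ρ₁ ρ₂), lt_min hε (lt_min hρ₁ hρ₂),
    min_le_left _ _, fun t ht z hz => ⟨h1 t ⟨ht.1, ht.2.trans_le (min_le_left _ _)⟩ z ?_,
      h2 t ⟨ht.1, ht.2.trans_le (min_le_right _ _)⟩ z ?_⟩⟩
  · exact ball_subset_ball ((min_le_right _ _).trans (min_le_left _ _)) hz
  · exact ball_subset_ball ((min_le_right _ _).trans (min_le_right _ _)) hz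

theorem Splitting.exists_localBounds (H : Splitting i j k U T G S GZ SZ Ξ ΞZ)
    (hz₀ : z₀ ∈ i ⁻¹' U) {ρ₀ R₀ σ₀ : ℝ} (hρ₀ : 0 < ρ₀) (hR₀ : 0 < R₀) (hσ₀ : 0 < σ₀) :
    ∃ ρ σ R R₃ R₂ R₁ K, LocalBounds i U T G S GZ SZ Ξ z₀ ρ σ R R₃ R₂ R₁ K ∧
      ρ ≤ ρ₀ ∧ R ≤ R₀ ∧ σ ≤ σ₀ := by
  have hx₀ : i z₀ ∈ U := hz₀
  obtain ⟨σ₁, hσ₁, hσ₁T, ρ₁, hρ₁, hρ₁U, K₁, hK₁, hG1, hG2, hG3, hG4⟩ :=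
    exists_estimates_of_contDiffOn H.T_pos H.isOpen hx₀ H.contDiffOn_G
      fun x hx => (H.semigroup_G x hx).1
  obtain ⟨σ₂, hσ₂, -, ρ₂, hρ₂, -, K₂, hK₂, -, -, -, hGZ⟩ :=
    exists_estimates_of_contDiffOn H.T_pos H.isOpen_Z hz₀ H.contDiffOn_GZ
      fun x hx => (H.semigroup_GZ x hx).1
  obtain ⟨σ₃, hσ₃, -, ρ₃, hρ₃, hρ₃U, K₃, hK₃, hS1, hS2⟩ :=
    H.contDiff_S.exists_estimates H.T_pos H.isOpen_Z hz₀ fun z hz => (H.semigroup_S _ hz).1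
  obtain ⟨ρ₄, hρ₄, hρ₄U, K₄, hK₄, hΞZ⟩ :=
    exists_lipschitz_of_contDiffOn H.isOpen_Z hz₀ H.contDiffOn_ΞZ
  obtain ⟨ρ₅, hρ₅, hρ₅U, K₅, hK₅, hΞ⟩ :=
    exists_lipschitz_of_contDiffOn H.isOpen hx₀ H.contDiffOn_Ξ
  set ρ := min ρ₀ (min ρ₁ ρ₅) with hρ
  have hρpos : 0 < ρ := lt_min hρ₀ (lt_min hρ₁ hρ₅)
  have hρ1 : ρ ≤ ρ₁ := (min_le_right _ _).trans (min_le_left _ _)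
  have hρ5 : ρ ≤ ρ₅ := (min_le_right _ _).trans (min_le_right _ _)
  obtain ⟨ρ₆, hρ₆, hi₆⟩ := Metric.mem_nhds_iff.1
    (i.continuous.continuousAt.preimage_mem_nhds (ball_mem_nhds (i z₀) hρpos))
  set R := min (min R₀ ρ₂) (min ρ₃ (min ρ₄ ρ₆)) with hR
  have hRpos : 0 < R := lt_min (lt_min hR₀ hρ₂) (lt_min hρ₃ (lt_min hρ₄ hρ₆))
  have hR0 : R ≤ R₀ := (min_le_left _ _).trans (min_le_left _ _)
  have hR2 : R ≤ ρ₂ := (min_le_left _ _).trans (min_le_right _ _)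
  have hR3 : R ≤ ρ₃ := (min_le_right _ _).trans (min_le_left _ _)
  have hR4 : R ≤ ρ₄ := (min_le_right _ _).trans ((min_le_right _ _).trans (min_le_left _ _))
  have hR6 : R ≤ ρ₆ := (min_le_right _ _).trans ((min_le_right _ _).trans (min_le_right _ _))
  -- Three nested balls are built from the outside inwards. The consistency estimate applies up to
  -- three maps in succession to a point of the innermost one.
  obtain ⟨s₃, hs₃, R₃, hR₃, hR₃le, hm3⟩ := H.exists_mapsTo_ball hz₀ hRpos
  obtain ⟨s₂, hs₂, R₂, hR₂, hR₂le, hm2⟩ := H.exists_mapsTo_ball hz₀ hR₃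
  obtain ⟨s₁, hs₁, R₁, hR₁, hR₁le, hm1⟩ := H.exists_mapsTo_ball hz₀ hR₂
  obtain ⟨σ, hσ, hle⟩ : ∃ σ > 0, σ ≤ σ₀ ∧ σ ≤ σ₁ ∧ σ ≤ σ₂ ∧ σ ≤ σ₃ ∧ σ ≤ s₁ ∧ σ ≤ s₂ ∧ σ ≤ s₃ := by
    refine ⟨min σ₀ (min σ₁ (min σ₂ (min σ₃ (min s₁ (min s₂ s₃))))), by positivity, ?_⟩
    simp only [min_le_iff, le_refl, true_or, or_true, and_self]
  obtain ⟨h0, h1, h2, h3, h4, h5, h6⟩ := hle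
  -- The generator of `S` factors through `Zt` as `k ∘ ΞZ`, which gives it the Lipschitz constant
  -- `‖k‖ * K₄` from the norm of `Z` to that of `X`.
  set K := K₁ + K₂ + K₃ + ‖k‖ * K₄ + K₅ with hK
  have hkK : 0 ≤ ‖k‖ * K₄ := by positivity
  have hKK1 : K₁ ≤ K := by linarith
  have hKK2 : K₂ ≤ K := by linarith
  have hKK3 : K₃ ≤ K := by linarith
  have hKK4 : ‖k‖ * K₄ ≤ K := by linarith
  have hKK5 : K₅ ≤ K := by linarith
  have mono : ∀ {σ' t : ℝ}, σ ≤ σ' → t ∈ Ico 0 σ → t ∈ Ico 0 σ' :=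
    fun h ht => ⟨ht.1, ht.2.trans_le h⟩
  refine ⟨ρ, σ, R, R₃, R₂, R₁, K, ?_, min_le_left _ _, hR0, h0⟩
  constructor
  · exact hρpos
  · exact hσ
  · exact h1.trans hσ₁T
  · exact hR₁
  · exact hR₁le
  · exact hR₂le
  · exact hR₃le
  · positivity
  · exact (ball_subset_ball hρ1).trans hρ₁U
  · exact fun z hz => hi₆ (ball_subset_ball hR6 hz)
  · exact fun t ht => hm1 t (mono h4 ht)
  · exact fun t ht => hm2 t (mono h5 ht)
  · exact fun t ht => hm3 t (mono h6 ht)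
  · exact fun t ht x hx => (hG1 t (mono h1 ht) x (ball_subset_ball hρ1 hx)).trans (by gcongr)
  · exact fun x hx y hy => (hG2 x (ball_subset_ball hρ1 hx) y (ball_subset_ball hρ1 hy)).trans
      (by gcongr)
  · exact fun t ht x hx y hy => (hG3 t (mono h1 ht) x (ball_subset_ball hρ1 hx) y
      (ball_subset_ball hρ1 hy)).trans (by gcongr)
  · exact fun t ht x hx => (hG4 t (mono h1 ht) x (ball_subset_ball hρ1 hx)).trans
      (mul_le_mul_of_nonneg_right hKK1 ht.1)
  · exact fun t ht z hz => (hGZ t (mono h2 ht) z (ball_subset_ball hR2 hz)).trans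
      (mul_le_mul_of_nonneg_right hKK2 ht.1)
  · exact fun t ht z hz => (hS1 t (mono h3 ht) z (ball_subset_ball hR3 hz)).trans (by gcongr)
  · exact fun s hs t ht z hz => (hS2 s (mono h3 hs) t (mono h3 ht) z
      (ball_subset_ball hR3 hz)).trans (by gcongr)
  · intro z hz z' hz'
    rw [← H.ΞZ_eq z (hρ₄U (ball_subset_ball hR4 hz)),
      ← H.ΞZ_eq z' (hρ₄U (ball_subset_ball hR4 hz')), ← map_sub]
    calc ‖k (ΞZ z - ΞZ z')‖ ≤ ‖k‖ * (K₄ * ‖z - z'‖) := (k.le_opNorm _).trans (by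
          gcongr
          exact hΞZ z (ball_subset_ball hR4 hz) z' (ball_subset_ball hR4 hz'))
      _ = ‖k‖ * K₄ * ‖z - z'‖ := by ring
      _ ≤ _ := by gcongr
  · exact fun x hx y hy => (hΞ x (ball_subset_ball hρ5 hx) y (ball_subset_ball hρ5 hy)).trans
      (by gcongr)

end

/-- One step of the Lie-Trotter scheme. -/
def trotter {X : Type*} (G S : ℝ → X → X) (ν h : ℝ) (x : X) : X := G h (S (ν * h) x)

/-- The right-hand side of the evolution equation. -/
noncomputable def vectorField {X Xt : Type*} [NormedAddCommGroup X] [NormedSpace ℝ X]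
    [NormedAddCommGroup Xt] [NormedSpace ℝ Xt] (j : X →L[ℝ] Xt) (G : ℝ → X → X) (Ξ : X → Xt)
    (ν : ℝ) (x : X) : Xt := j (generator G x) + ν • Ξ x

theorem mul_mem_Ico {ν h σ : ℝ} (hν : ν ∈ Icc (0 : ℝ) 1) (hh : h ∈ Ico 0 σ) :
    ν * h ∈ Ico 0 σ ∧ ν * h ≤ h := by
  have h1 : ν * h ≤ h := by nlinarith [hν.2, hh.1]
  exact ⟨⟨mul_nonneg hν.1 hh.1, h1.trans_lt hh.2⟩, h1⟩

/-! ### Consistency of the Lie-Trotter step. -/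

section

variable {X Z Xt Zt : Type*}
    [NormedAddCommGroup X] [NormedSpace ℝ X] [NormedAddCommGroup Z] [NormedSpace ℝ Z]
    [NormedAddCommGroup Xt] [NormedSpace ℝ Xt] [NormedAddCommGroup Zt] [NormedSpace ℝ Zt]
    {i : Z →L[ℝ] X} {j : X →L[ℝ] Xt} {k : Zt →L[ℝ] X} {U : Set X} {T : ℝ}
    {G S : ℝ → X → X} {GZ SZ : ℝ → Z → Z} {Ξ : X → Xt} {ΞZ : Z → Zt} {z₀ z : Z}
    {ρ σ R R₃ R₂ R₁ K : ℝ}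

namespace LocalBounds

variable (B : LocalBounds i U T G S GZ SZ Ξ z₀ ρ σ R R₃ R₂ R₁ K)

include B

theorem ball_R₃ (hz : z ∈ ball z₀ R₃) : z ∈ ball z₀ R := ball_subset_ball B.R₃_le hz

theorem ball_R₂ (hz : z ∈ ball z₀ R₂) : z ∈ ball z₀ R :=
  B.ball_R₃ (ball_subset_ball B.R₂_le hz)

theorem ball_R₁ (hz : z ∈ ball z₀ R₁) : z ∈ ball z₀ R :=
  B.ball_R₂ (ball_subset_ball B.R₁_le hz)

theorem mem_U (hz : z ∈ ball z₀ R) : i z ∈ U := B.ball_subset (B.mapsTo_i z hz)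

theorem mem_Ico {t : ℝ} (ht : t ∈ Ico 0 σ) : t ∈ Ico 0 T := ⟨ht.1, ht.2.trans_le B.σ_le⟩

theorem map_SZ (H : Splitting i j k U T G S GZ SZ Ξ ΞZ) {t : ℝ} (ht : t ∈ Ico 0 σ)
    (hz : z ∈ ball z₀ R) : i (SZ t z) = S t (i z) := H.map_SZ t (B.mem_Ico ht) z (B.mem_U hz)

theorem map_GZ (H : Splitting i j k U T G S GZ SZ Ξ ΞZ) {t : ℝ} (ht : t ∈ Ico 0 σ)
    (hz : z ∈ ball z₀ R) : i (GZ t z) = G t (i z) := H.map_GZ t (B.mem_Ico ht) z (B.mem_U hz)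

theorem S_zero (H : Splitting i j k U T G S GZ SZ Ξ ΞZ) (hz : z ∈ ball z₀ R) :
    S 0 (i z) = i z := (H.semigroup_S _ (B.mem_U hz)).1

theorem S_step (H : Splitting i j k U T G S GZ SZ Ξ ΞZ) {t : ℝ} (ht : t ∈ Ico 0 σ)
    (hz : z ∈ ball z₀ R) : ‖S t (i z) - i z‖ ≤ K * t := by
  have := B.S_lip 0 ⟨le_rfl, B.σ_pos⟩ t ht z hz
  rwa [B.S_zero H hz, sub_zero, abs_of_nonneg ht.1] at this

/-- The error splits into the Taylor error of `G` at `S s (i z)`, that of `S` at `i z`, and the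
change of the generator of `G` between these points. The last is controlled by the distance in `X`,
so no estimate of `SZ s z - z` in `Z` is needed. -/
theorem norm_tangent_le (H : Splitting i j k U T G S GZ SZ Ξ ΞZ) {s h : ℝ}
    (hs : s ∈ Ico 0 σ) (hh : h ∈ Ico 0 σ) (hsh : s ≤ h) (hz : z ∈ ball z₀ R₃) :
    ‖G h (S s (i z)) - i z - h • generator G (i z) - s • generator S (i z)‖
      ≤ (2 * K + K ^ 2) * h ^ 2 := by
  have hK := B.K_nonneg
  have hzR := B.ball_R₃ hz
  have hS : S s (i z) ∈ ball (i z₀) ρ := by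
    rw [← B.map_SZ H hs hzR]
    exact B.mapsTo_i _ (B.mapsTo₃ s hs z hz).1
  have e1 := B.G_tangent h hh _ hS
  have e2 := B.genG_lip _ hS _ (B.mapsTo_i z hzR)
  have e3 := B.S_step H hs hzR
  have e4 := B.S_tangent s hs z hzR
  have e5 : ‖h • (generator G (S s (i z)) - generator G (i z))‖ ≤ h * (K * (K * h)) := by
    rw [norm_smul, Real.norm_of_nonneg hh.1]
    refine mul_le_mul_of_nonneg_left (e2.trans ?_) hh.1
    exact mul_le_mul_of_nonneg_left (e3.trans (by gcongr)) hK
  have e6 : K * s ^ 2 ≤ K * h ^ 2 := by have := hs.1; gcongr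
  rw [show G h (S s (i z)) - i z - h • generator G (i z) - s • generator S (i z)
    = (G h (S s (i z)) - S s (i z) - h • generator G (S s (i z)))
      + (S s (i z) - i z - s • generator S (i z))
      + h • (generator G (S s (i z)) - generator G (i z)) by module]
  refine norm_add₃_le.trans ?_
  linarith

/-- Both orders of composition have the same first-order expansion. When `G` acts first, the
generator of `S` has to be compared at `GZ h z` and `z`; it is Lipschitz only for the norm of `Z`,
so the smoothness of `GZ` in `Z` enters through `GZ_step`. -/
theorem norm_commutator_le (H : Splitting i j k U T G S GZ SZ Ξ ΞZ) {s h : ℝ}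
    (hs : s ∈ Ico 0 σ) (hh : h ∈ Ico 0 σ) (hsh : s ≤ h) (hz : z ∈ ball z₀ R₂) :
    ‖G h (S s (i z)) - S s (G h (i z))‖ ≤ (4 * K + 2 * K ^ 2) * h ^ 2 := by
  have hK := B.K_nonneg
  have hzR := B.ball_R₂ hz
  have hG := B.ball_R₃ (B.mapsTo₂ h hh z hz).2
  have e0 := B.norm_tangent_le H hs hh hsh (ball_subset_ball B.R₂_le hz)
  have e1 := B.S_tangent s hs _ hG
  have e2 := B.genS_lip _ hG _ hzR
  have e3 := B.GZ_step h hh z hzR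
  have e4 := B.G_tangent h hh _ (B.mapsTo_i z hzR)
  rw [B.map_GZ H hh hzR] at e1 e2
  have e5 : ‖s • (generator S (G h (i z)) - generator S (i z))‖ ≤ h * (K * (K * h)) := by
    rw [norm_smul, Real.norm_of_nonneg hs.1]
    exact mul_le_mul hsh (e2.trans (mul_le_mul_of_nonneg_left e3 hK)) (norm_nonneg _) hh.1
  have e6 : K * s ^ 2 ≤ K * h ^ 2 := by have := hs.1; gcongr
  rw [show G h (S s (i z)) - S s (G h (i z))
    = ((G h (S s (i z)) - i z - h • generator G (i z) - s • generator S (i z))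
      - (G h (i z) - i z - h • generator G (i z)))
      - (S s (G h (i z)) - G h (i z) - s • generator S (G h (i z)))
      - s • (generator S (G h (i z)) - generator S (i z)) by module]
  refine (norm_sub_le _ _).trans ((add_le_add_left ((norm_sub_le _ _).trans
    (add_le_add_left (norm_sub_le _ _) _)) _).trans ?_)
  linarith

/-- With `s = νh` and `y = S_s z`, the semigroup property gives `G_h G_h S_s y` for the double step
and `G_h S_s G_h y` for two single steps. They differ by the commutator at `y`, transported by the
Lipschitz map `G_h`. -/
theorem norm_consistent_le (H : Splitting i j k U T G S GZ SZ Ξ ΞZ) {ν h : ℝ}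
    (hν : ν ∈ Icc (0 : ℝ) 1) (h0 : 0 ≤ h) (hh : 2 * h < σ) (hz : z ∈ ball z₀ R₁) :
    ‖trotter G S ν (2 * h) (i z) - trotter G S ν h (trotter G S ν h (i z))‖
      ≤ K * (4 * K + 2 * K ^ 2) * h ^ 2 := by
  have hhσ : h ∈ Ico 0 σ := ⟨h0, by linarith⟩
  obtain ⟨hs, hsh⟩ := mul_mem_Ico hν hhσ
  have h2 : 2 * h ∈ Ico 0 σ := ⟨by linarith, hh⟩
  obtain ⟨h2s, -⟩ := mul_mem_Ico hν h2
  set s := ν * h with hsdef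
  have h2s' : ν * (2 * h) = s + s := by rw [hsdef]; ring
  rw [h2s'] at h2s
  have hzR := B.ball_R₁ hz
  set y := SZ s z with hy
  have hyR₂ : y ∈ ball z₀ R₂ := (B.mapsTo₁ s hs z hz).1
  have hyR := B.ball_R₂ hyR₂
  have hiy : i y = S s (i z) := B.map_SZ H hs hzR
  have hSy : SZ s y ∈ ball z₀ R₃ := (B.mapsTo₂ s hs y hyR₂).1
  have hGy : GZ h y ∈ ball z₀ R₃ := (B.mapsTo₂ h hhσ y hyR₂).2
  have hiSy : i (SZ s y) = S s (i y) := B.map_SZ H hs hyR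
  have hiGy : i (GZ h y) = G h (i y) := B.map_GZ H hhσ hyR
  have hSS : S (s + s) (i z) = S s (i y) := by
    rw [hiy]
    refine ((H.semigroup_S _ (B.mem_U hzR)).2 s (B.mem_Ico hs) s (B.mem_Ico hs)
      (B.mem_Ico h2s) ?_).symm
    rw [← hiy]; exact B.mem_U hyR
  have hGS : GZ h (SZ s y) ∈ ball z₀ R := (B.mapsTo₃ h hhσ _ hSy).2
  have hSG : SZ s (GZ h y) ∈ ball z₀ R := (B.mapsTo₃ s hs _ hGy).1
  have hiGS : i (GZ h (SZ s y)) = G h (S s (i y)) := by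
    rw [B.map_GZ H hhσ (B.ball_R₃ hSy), hiSy]
  have hiSG : i (SZ s (GZ h y)) = S s (G h (i y)) := by
    rw [B.map_SZ H hs (B.ball_R₃ hGy), hiGy]
  have hGG : G (2 * h) (S s (i y)) = G h (G h (S s (i y))) := by
    have hSU : S s (i y) ∈ U := by rw [← hiSy]; exact B.mem_U (B.ball_R₃ hSy)
    rw [two_mul] at h2 ⊢
    refine ((H.semigroup_G _ hSU).2 h (B.mem_Ico hhσ) h (B.mem_Ico hhσ) (B.mem_Ico h2) ?_).symm
    rw [← hiGS]; exact B.mem_U hGS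
  have hc := B.norm_commutator_le H hs hhσ hsh hyR₂
  rw [trotter, trotter, trotter, h2s', ← hsdef, hSS, ← hiy, hGG]
  refine (B.G_lip h hhσ _ ?_ _ ?_).trans ?_
  · rw [← hiGS]; exact B.mapsTo_i _ hGS
  · rw [← hiSG]; exact B.mapsTo_i _ hSG
  · rw [mul_assoc]; exact mul_le_mul_of_nonneg_left hc B.K_nonneg

theorem norm_trotter_sub_le (H : Splitting i j k U T G S GZ SZ Ξ ΞZ) {ν h : ℝ}
    (hν : ν ∈ Icc (0 : ℝ) 1) (hh : h ∈ Ico 0 σ) (hz : z ∈ ball z₀ R₁) :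
    ‖trotter G S ν h (i z) - i z‖ ≤ 2 * K * h := by
  obtain ⟨hs, hsh⟩ := mul_mem_Ico hν hh
  have hzR := B.ball_R₁ hz
  have e1 := B.S_step H hs hzR
  have hS : S (ν * h) (i z) ∈ ball (i z₀) ρ := by
    rw [← B.map_SZ H hs hzR]
    exact B.mapsTo_i _ (B.ball_R₂ (B.mapsTo₁ _ hs z hz).1)
  have e2 := B.G_step h hh _ hS
  have e3 : K * (ν * h) ≤ K * h := mul_le_mul_of_nonneg_left hsh B.K_nonneg
  refine (norm_sub_le_norm_sub_add_norm_sub _ (S (ν * h) (i z)) _).trans ?_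
  rw [trotter]
  linarith

theorem norm_trotter_param_le (H : Splitting i j k U T G S GZ SZ Ξ ΞZ) {ν ν' h : ℝ}
    (hν : ν ∈ Icc (0 : ℝ) 1) (hν' : ν' ∈ Icc (0 : ℝ) 1) (hh : h ∈ Ico 0 σ)
    (hz : z ∈ ball z₀ R₁) :
    ‖trotter G S ν h (i z) - trotter G S ν' h (i z)‖ ≤ K ^ 2 * |ν - ν'| * h := by
  have hzR := B.ball_R₁ hz
  have hS : ∀ {ν}, ν ∈ Icc (0 : ℝ) 1 → S (ν * h) (i z) ∈ ball (i z₀) ρ := fun hν => by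
    rw [← B.map_SZ H (mul_mem_Ico hν hh).1 hzR]
    exact B.mapsTo_i _ (B.ball_R₂ (B.mapsTo₁ _ (mul_mem_Ico hν hh).1 z hz).1)
  have e1 := B.S_lip _ (mul_mem_Ico hν' hh).1 _ (mul_mem_Ico hν hh).1 z hzR
  rw [← sub_mul, abs_mul, abs_of_nonneg hh.1] at e1
  refine (B.G_lip h hh _ (hS hν) _ (hS hν')).trans
    ((mul_le_mul_of_nonneg_left e1 B.K_nonneg).trans (le_of_eq ?_))
  ring

theorem vectorField_lip {ν : ℝ} (hν : ν ∈ Icc (0 : ℝ) 1) {x y : X} (hx : x ∈ ball (i z₀) ρ)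
    (hy : y ∈ ball (i z₀) ρ) :
    ‖vectorField j G Ξ ν x - vectorField j G Ξ ν y‖ ≤ (‖j‖ * K + K) * ‖x - y‖ := by
  have e1 := B.genG_lip x hx y hy
  have e2 := B.Ξ_lip x hx y hy
  have hK := B.K_nonneg
  rw [show vectorField j G Ξ ν x - vectorField j G Ξ ν y
    = j (generator G x - generator G y) + ν • (Ξ x - Ξ y) by
      simp only [vectorField, map_sub]; module]
  refine (norm_add_le _ _).trans ?_
  rw [norm_smul, Real.norm_of_nonneg hν.1]
  have e3 := (j.le_opNorm (generator G x - generator G y)).trans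
    (mul_le_mul_of_nonneg_left e1 (norm_nonneg j))
  have e4 : ν * ‖Ξ x - Ξ y‖ ≤ 1 * (K * ‖x - y‖) :=
    mul_le_mul hν.2 e2 (norm_nonneg _) zero_le_one
  linarith

theorem norm_trotter_tangent_le (H : Splitting i j k U T G S GZ SZ Ξ ΞZ) {ν h : ℝ}
    (hν : ν ∈ Icc (0 : ℝ) 1) (hh : h ∈ Ico 0 σ) (hz : z ∈ ball z₀ R₃) :
    ‖j (trotter G S ν h (i z)) - j (i z) - h • vectorField j G Ξ ν (i z)‖
      ≤ ‖j‖ * (2 * K + K ^ 2) * h ^ 2 := by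
  obtain ⟨hs, hsh⟩ := mul_mem_Ico hν hh
  have e := B.norm_tangent_le H hs hh hsh hz
  rw [vectorField, H.Ξ_eq z (B.mem_U (B.ball_R₃ hz)),
    show j (trotter G S ν h (i z)) - j (i z)
      - h • (j (generator G (i z)) + ν • j (generator S (i z)))
      = j (G h (S (ν * h) (i z)) - i z - h • generator G (i z)
        - (ν * h) • generator S (i z)) by
      simp only [map_sub, map_smul, trotter]; module]
  rw [mul_assoc]
  exact (j.le_opNorm _).trans (mul_le_mul_of_nonneg_left e (norm_nonneg j))

/-- A velocity of `SZ` at `z₁` bounds the `S`-part of the step by `C h`, and `GZ` moves all nearby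
points at speed at most `K`. The constants `C` and `σ₁` depend on `z₁`, hence on `η`, but not on
`ν`. -/
theorem exists_slow_point (H : Splitting i j k U T G S GZ SZ Ξ ΞZ) {η : ℝ} (hη : 0 < η) :
    ∃ z₁ ∈ ball z₀ η, ∃ C ≥ 0, ∃ σ₁ > 0, ∀ ν ∈ Icc (0 : ℝ) 1, ∀ h ∈ Ico 0 σ₁,
      ‖trotter GZ SZ ν h z₁ - z₁‖ ≤ C * h := by
  have hz₀U : z₀ ∈ i ⁻¹' U := B.mem_U (mem_ball_self
    (B.R₁_pos.trans_le (B.R₁_le.trans (B.R₂_le.trans B.R₃_le))))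
  obtain ⟨z₁, hz₁, hd⟩ := H.dense_differentiable z₀ hz₀U (min η R₁) (lt_min hη B.R₁_pos)
  have hz₁R := ball_subset_ball (min_le_right _ _) hz₁
  obtain ⟨C, hC, hO⟩ := hd.hasDerivWithinAt.hasFDerivWithinAt.isBigO_sub.exists_nonneg
  have h1 := hO.bound
  rw [nhdsWithin_Ico_eq_nhdsGE H.T_pos] at h1
  obtain ⟨σ₁, hσ₁, h2⟩ := (nhdsGE_basis (0 : ℝ)).eventually_iff.1 h1
  have hz₁0 : SZ 0 z₁ = z₁ := (H.semigroup_SZ z₁ (B.mem_U (B.ball_R₁ hz₁R))).1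
  refine ⟨z₁, ball_subset_ball (min_le_left _ _) hz₁, C + K, add_nonneg hC B.K_nonneg,
    min σ₁ σ, lt_min hσ₁ B.σ_pos, fun ν hν h hh => ?_⟩
  obtain ⟨hs, hsh⟩ := mul_mem_Ico hν hh
  have e1 := h2 (⟨hs.1, hs.2.trans_le (min_le_left _ _)⟩ : ν * h ∈ Ico 0 σ₁)
  rw [hz₁0, sub_zero, Real.norm_of_nonneg hs.1] at e1
  have e2 := B.GZ_step h ⟨hh.1, hh.2.trans_le (min_le_right _ _)⟩ (SZ (ν * h) z₁)
    (B.ball_R₂ (B.mapsTo₁ _ ⟨hs.1, hs.2.trans_le (min_le_right _ _)⟩ z₁ hz₁R).1)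
  refine (norm_sub_le_norm_sub_add_norm_sub _ (SZ (ν * h) z₁) _).trans ?_
  rw [trotter]
  have e3 : C * (ν * h) ≤ C * h := mul_le_mul_of_nonneg_left hsh hC
  linarith

end LocalBounds

end

/-! ### The local Lie-Trotter scheme and its limit. -/

section

variable {X Z Xt Zt : Type*}
    [NormedAddCommGroup X] [NormedSpace ℝ X] [NormedAddCommGroup Z] [NormedSpace ℝ Z]
    [NormedAddCommGroup Xt] [NormedSpace ℝ Xt] [NormedAddCommGroup Zt] [NormedSpace ℝ Zt]
    {i : Z →L[ℝ] X} {j : X →L[ℝ] Xt} {k : Zt →L[ℝ] X} {U : Set X} {T : ℝ}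
    {G S : ℝ → X → X} {GZ SZ : ℝ → Z → Z} {Ξ : X → Xt} {ΞZ : Z → Zt} {z₀ z : Z}

/-- The constants and estimates that describe the Lie-Trotter scheme near a point `z₀`. -/
structure LocalScheme (i : Z →L[ℝ] X) (j : X →L[ℝ] Xt) (U : Set X) (T : ℝ)
    (G S : ℝ → X → X) (GZ SZ : ℝ → Z → Z) (Ξ : X → Xt) (z₀ : Z) where
  N : Set X
  d : X → X → ℝ
  (L₁ L₂ β ρ' σ' : ℝ)
  contractive : ContractiveNear G S U (i z₀) N d L₁ L₂ β ρ' σ'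
  (ρ σ R R₃ R₂ R₁ K : ℝ)
  bounds : LocalBounds i U T G S GZ SZ Ξ z₀ ρ σ R R₃ R₂ R₁ K
  ρ_le : ρ ≤ ρ'
  (r τ κ C : ℝ)
  r_pos : 0 < r
  r_le : r ≤ R₁ / 2
  τ_lt : τ < σ
  scheme : OneStepScheme j (trotter G S) (vectorField j G Ξ) (i '' ball z₀ r)
    (i '' ball z₀ (R₁ / 2)) κ C τ

theorem Splitting.exists_localScheme (H : Splitting i j k U T G S GZ SZ Ξ ΞZ)
    (hz₀ : z₀ ∈ i ⁻¹' U) : Nonempty (LocalScheme i j U T G S GZ SZ Ξ z₀) := by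
  obtain ⟨N, d, L₁, L₂, β, ρ', σ', hX⟩ := H.contraction_X.exists_contractiveNear H.T_pos H.isOpen
    hz₀ H.continuousOn_G H.continuousOn_S (H.semigroup_G _ hz₀).1 (H.semigroup_S _ hz₀).1
  obtain ⟨N₂, d₂, M₁, M₂, β₂, ρ₂, σ₂, hZ⟩ := H.contraction_Z.exists_contractiveNear H.T_pos
    H.isOpen_Z hz₀ H.continuousOn_GZ H.continuousOn_SZ (H.semigroup_GZ _ hz₀).1
    (H.semigroup_SZ _ hz₀).1
  obtain ⟨ρ, σ, R, R₃, R₂, R₁, K, B, hρ, hR, hσ⟩ := H.exists_localBounds hz₀ hX.ρ_pos hZ.ρ_pos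
    (lt_min hX.σ_pos hZ.σ_pos)
  have hσX : σ ≤ σ' := hσ.trans (min_le_left _ _)
  have hσZ : σ ≤ σ₂ := hσ.trans (min_le_right _ _)
  have hR₁ := B.R₁_pos
  have hK := B.K_nonneg
  have hhalf : R₁ / 2 < R₁ := by linarith
  have hA : ∀ {z}, z ∈ ball z₀ (R₁ / 2) → z ∈ ball z₀ R₁ := fun hz =>
    ball_subset_ball hhalf.le hz
  have hAρ : ∀ {z}, z ∈ ball z₀ R₁ → i z ∈ ball (i z₀) ρ := fun hz =>
    B.mapsTo_i _ (B.ball_R₁ hz)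
  have hZρ : ∀ {z}, z ∈ ball z₀ (R₁ / 2) → z ∈ ball z₀ ρ₂ := fun hz =>
    ball_subset_ball hR (B.ball_R₁ (hA hz))
  have hM₁ := hZ.L₁_pos
  have hM₂ := hZ.L₂_pos
  -- The contraction property in `Z` serves only to confine orbits to a ball of `Z`; convergence
  -- takes place in `X`. The radius `R₁ / 2` leaves room for the closed ball inside `ball z₀ R₁`.
  obtain ⟨r, hr, hrR, τ, hτ, hτσ, hmem⟩ := exists_iterate_mem_ball (F := trotter GZ SZ) (z₀ := z₀)
    (κ := M₂ / M₁ * Real.exp (2 * β₂ * σ₂)) (ρ := R₁ / 2) (σ := σ) (by positivity)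
    (by positivity) B.σ_pos
    (fun ν hν h hh n hn x y δ hδ hx0 hx hy hxs hys =>
      hZ.norm_sub_le hν ⟨hh.1, hh.2.trans_le hσZ⟩ (hn.trans hσZ) hδ (hZρ hx0)
        (fun k hk => hZρ (hx k hk)) (fun k hk => hZρ (hy k hk)) hxs hys)
    (fun η hη => B.exists_slow_point H hη)
  have hIco : ∀ {h}, h ∈ Ioc 0 τ → h ∈ Ico 0 σ := fun hh => ⟨hh.1.le, hh.2.trans_lt hτσ⟩
  have hL₁ := hX.L₁_pos
  have hL₂ := hX.L₂_pos
  have hj := norm_nonneg j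
  obtain ⟨C, hC0, hC1, hC2, hC3, hC4, hC5⟩ : ∃ C, 0 ≤ C ∧ 2 * K ≤ C ∧
      K * (4 * K + 2 * K ^ 2) ≤ C ∧ K ^ 2 ≤ C ∧ ‖j‖ * (2 * K + K ^ 2) ≤ C ∧ ‖j‖ * K + K ≤ C := by
    have h1 : 0 ≤ ‖j‖ * K := by positivity
    have h2 : 0 ≤ ‖j‖ * (2 * K + K ^ 2) := by positivity
    have h3 : 0 ≤ K * (4 * K + 2 * K ^ 2) := by positivity
    have h4 : 0 ≤ K ^ 2 := by positivity
    exact ⟨2 * K + K * (4 * K + 2 * K ^ 2) + K ^ 2 + ‖j‖ * (2 * K + K ^ 2) + (‖j‖ * K + K),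
      by positivity, by linarith, by linarith, by linarith, by linarith, by linarith⟩
  -- By reflexivity, the closure in `X` adds only images of points of the closed `Z`-ball.
  have hcl : closure (i '' ball z₀ (R₁ / 2)) ⊆ ball (i z₀) ρ := by
    refine (closure_minimal (image_mono ball_subset_closedBall)
      (isClosed_image_of_reflexive i H.reflexive isClosed_closedBall (convex_closedBall _ _)
        isBounded_closedBall)).trans ?_
    rintro _ ⟨z, hz, rfl⟩
    exact hAρ (closedBall_subset_ball hhalf hz)
  refine ⟨⟨N, d, L₁, L₂, β, ρ', σ', hX, ρ, σ, R, R₃, R₂, R₁, K, B, hρ, r, τ,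
    L₂ / L₁ * Real.exp (2 * β * σ'), C, hr, hrR, hτσ, ?_⟩⟩
  constructor
  · exact hτ
  · exact hC0
  · positivity
  · rintro ν hν h hh n hn _ ⟨z, hz, rfl⟩
    -- The iterates in `X` and in `Z` correspond as long as the orbit stays where the restrictions
    -- agree, which `hmem` guarantees.
    have key : ∀ m ≤ n, (trotter G S ν h)^[m] (i z) = i ((trotter GZ SZ ν h)^[m] z) := by
      intro m
      induction m with
      | zero => intro _; rfl
      | succ m ih =>
        intro hm
        have hmm : (m : ℝ) * h ≤ τ := by
          refine le_trans ?_ hn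
          have := hh.1.le
          gcongr
          omega
        have hb := hA (hmem ν hν h hh m hmm z hz)
        have hs := (mul_mem_Ico hν (hIco hh)).1
        rw [Function.iterate_succ_apply', Function.iterate_succ_apply', ih (by omega), trotter,
          trotter, B.map_GZ H (hIco hh) (B.ball_R₂ (B.mapsTo₁ _ hs _ hb).1),
          B.map_SZ H hs (B.ball_R₁ hb)]
    rw [key n le_rfl]
    exact ⟨_, hmem ν hν h hh n hn z hz, rfl⟩
  · intro ν hν h hh n hn x y δ hδ hx hy hxs hys
    have hAX : ∀ {x}, x ∈ i '' ball z₀ (R₁ / 2) → x ∈ ball (i z₀) ρ' := fun hx =>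
      ball_subset_ball hρ (hcl (subset_closure hx))
    exact hX.norm_sub_le hν ⟨hh.1.le, (hIco hh).2.trans_le hσX⟩ (hn.trans (hτσ.le.trans hσX)) hδ
      (hAX (hx 0 n.zero_le)) (fun k hk => hAX (hx k hk.le)) (fun k hk => hAX (hy k hk)) hxs hys
  · rintro ν hν h hh _ ⟨z, hz, rfl⟩
    exact (B.norm_trotter_sub_le H hν (hIco hh) (hA hz)).trans
      (mul_le_mul_of_nonneg_right hC1 hh.1.le)
  · rintro ν hν h h0 hh _ ⟨z, hz, rfl⟩ -
    exact (B.norm_consistent_le H hν h0.le (hh.trans_lt hτσ) (hA hz)).trans (by gcongr)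
  · rintro ν hν ν' hν' h hh _ ⟨z, hz, rfl⟩
    exact (B.norm_trotter_param_le H hν hν' (hIco hh) (hA hz)).trans
      (by have := hh.1.le; gcongr)
  · rintro ν hν h hh _ ⟨z, hz, rfl⟩
    exact (B.norm_trotter_tangent_le H hν (hIco hh)
      (ball_subset_ball (B.R₁_le.trans B.R₂_le) (hA hz))).trans (by gcongr)
  · intro ν hν x hx y hy
    exact (B.vectorField_lip hν (hcl hx) (hcl hy)).trans (by gcongr)

/-- The limit of the Lie-Trotter approximations near `z₀`. -/
noncomputable def LocalScheme.sol (L : LocalScheme i j U T G S GZ SZ Ξ z₀) (ν : ℝ) (z : Z)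
    (t : ℝ) : X := OneStepScheme.limit (trotter G S) L.τ ν (i z) t

namespace LocalScheme

variable [CompleteSpace X] {L : LocalScheme i j U T G S GZ SZ Ξ z₀} {ν t : ℝ}

/-- The convergence takes place in the norm of `X` only; the limit is in `Z` because the image of a
closed `Z`-ball is closed in `X`. -/
theorem sol_mem (H : Splitting i j k U T G S GZ SZ Ξ ΞZ) (hν : ν ∈ Icc (0 : ℝ) 1)
    (hz : z ∈ ball z₀ L.r) (ht : t ∈ Icc 0 L.τ) :
    L.sol ν z t ∈ i '' closedBall z₀ (L.R₁ / 2) :=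
  closure_minimal (image_mono ball_subset_closedBall)
    (isClosed_image_of_reflexive i H.reflexive isClosed_closedBall (convex_closedBall _ _)
      isBounded_closedBall) (L.scheme.limit_mem_closure hν ⟨z, hz, rfl⟩ ht)

omit [CompleteSpace X] in
theorem mem_ball_of_mem (hz : z ∈ closedBall z₀ (L.R₁ / 2)) : z ∈ ball z₀ L.R₁ :=
  closedBall_subset_ball (half_lt_self L.bounds.R₁_pos) hz

omit [CompleteSpace X] in
theorem image_mem_ball (hz : z ∈ closedBall z₀ (L.R₁ / 2)) : i z ∈ ball (i z₀) L.ρ :=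
  L.bounds.mapsTo_i _ (L.bounds.ball_R₁ (mem_ball_of_mem hz))

theorem sol_mem_ball (H : Splitting i j k U T G S GZ SZ Ξ ΞZ) (hν : ν ∈ Icc (0 : ℝ) 1)
    (hz : z ∈ ball z₀ L.r) (ht : t ∈ Icc 0 L.τ) : L.sol ν z t ∈ ball (i z₀) L.ρ := by
  obtain ⟨w, hw, hwt⟩ := L.sol_mem H hν hz ht
  rw [← hwt]
  exact image_mem_ball hw

theorem continuousOn_sol (hν : ν ∈ Icc (0 : ℝ) 1) (hz : z ∈ ball z₀ L.r) :
    ContinuousOn (L.sol ν z) (Icc 0 L.τ) :=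
  (LipschitzOnWith.of_dist_le_mul (K := ⟨L.C, L.scheme.C_nonneg⟩) fun t ht s hs => by
    rw [dist_eq_norm, Real.dist_eq]
    exact L.scheme.norm_limit_sub_le hν ⟨z, hz, rfl⟩ hs ht).continuousOn

theorem hasDerivWithinAt_sol (hν : ν ∈ Icc (0 : ℝ) 1) (hz : z ∈ ball z₀ L.r)
    (ht : t ∈ Icc 0 L.τ) : HasDerivWithinAt (fun s => j (L.sol ν z s))
      (vectorField j G Ξ ν (L.sol ν z t)) (Icc 0 L.τ) t :=
  L.scheme.hasDerivWithinAt_limit hν ⟨z, hz, rfl⟩ ht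

theorem sol_zero (hν : ν ∈ Icc (0 : ℝ) 1) (hz : z ∈ ball z₀ L.r) : L.sol ν z 0 = i z :=
  L.scheme.limit_zero hν ⟨z, hz, rfl⟩

end LocalScheme

end

/-! ### Comparison of curves tangent to the Lie-Trotter step. -/

section

variable {X : Type*} [NormedAddCommGroup X] [NormedSpace ℝ X] {G S : ℝ → X → X} {ν : ℝ}

/-- The Lipschitz curve `v` is almost everywhere on `[a,b]` tangent to the Lie-Trotter step. -/
def TangentOn (G S : ℝ → X → X) (ν : ℝ) (v : ℝ → X) (a b : ℝ) : Prop :=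
  (∃ K, LipschitzOnWith K v (Icc a b)) ∧
    ∀ᵐ s, s ∈ Ioo a b → ∃ w, HasDerivAt v w s ∧
      HasDerivWithinAt (fun h => trotter G S ν h (v s)) w (Ici 0) 0

/-- `v` is tangent to the Lie-Trotter step on an interval to the right of `s`. -/
def RightTangent (G S : ℝ → X → X) (ν : ℝ) (v : ℝ → X) (s : ℝ) : Prop :=
  ∃ ε > 0, TangentOn G S ν v s (s + ε)

theorem TangentOn.mono {v : ℝ → X} {a b a' b' : ℝ} (h : TangentOn G S ν v a b) (ha : a ≤ a')
    (hb : b' ≤ b) : TangentOn G S ν v a' b' := by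
  obtain ⟨⟨K, hK⟩, h⟩ := h
  refine ⟨⟨K, hK.mono (Icc_subset_Icc ha hb)⟩, ?_⟩
  filter_upwards [h] with s hs hs'
  exact hs ⟨ha.trans_lt hs'.1, hs'.2.trans_le hb⟩

theorem TangentOn.rightTangent {v : ℝ → X} {a b s : ℝ} (h : TangentOn G S ν v a b)
    (hs : s ∈ Ico a b) : RightTangent G S ν v s :=
  ⟨b - s, sub_pos.2 hs.2, h.mono hs.1 (by linarith)⟩

theorem RightTangent.exists_le {v : ℝ → X} {s b : ℝ} (h : RightTangent G S ν v s) (hb : s < b) :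
    ∃ c ∈ Ioc s b, TangentOn G S ν v s c := by
  obtain ⟨ε, hε, h⟩ := h
  exact ⟨min (s + ε) b, ⟨lt_min (by linarith) hb, min_le_right _ _⟩,
    h.mono le_rfl (min_le_left _ _)⟩

theorem hasDerivWithinAt_shift {f : ℝ → X} {f' : X} {s : ℝ} (hf : HasDerivAt f f' s) :
    HasDerivWithinAt (fun h => f (s + h)) f' (Ici 0) 0 :=
  (HasDerivAt.comp_const_add s 0 (by rwa [add_zero])).hasDerivWithinAt

theorem hasDerivWithinAt_norm_of_zero {e : ℝ → X} (h0 : e 0 = 0)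
    (h : HasDerivWithinAt e 0 (Ici 0) 0) : HasDerivWithinAt (fun t => ‖e t‖) 0 (Ici 0) 0 := by
  rw [hasDerivWithinAt_iff_isLittleO] at h ⊢
  simpa [h0] using h

theorem nonneg_of_hasDerivWithinAt {g : ℝ → ℝ} {g' δ : ℝ} (hδ : 0 < δ) (h0 : g 0 = 0)
    (hg : ∀ t ∈ Ioo 0 δ, 0 ≤ g t) (h : HasDerivWithinAt g g' (Ici 0) 0) : 0 ≤ g' := by
  have h1 := (hasDerivWithinAt_iff_tendsto_slope' self_notMem_Ioi).1 h.Ioi_of_Ici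
  refine ge_of_tendsto h1 ?_
  filter_upwards [Ioo_mem_nhdsGT hδ] with t ht
  rw [slope_def_field, h0, sub_zero, sub_zero]
  exact div_nonneg (hg t ht) ht.1.le

variable {U N : Set X} {x₀ : X} {d : X → X → ℝ} {L₁ L₂ β ρ σ : ℝ} {v y : ℝ → X} {a b : ℝ}

omit [NormedSpace ℝ X] in
theorem ContractiveNear.trotter_mem (H : ContractiveNear G S U x₀ N d L₁ L₂ β ρ σ)
    (hν : ν ∈ Icc (0 : ℝ) 1) {h : ℝ} (hh : h ∈ Ico 0 σ) {x : X} (hx : x ∈ ball x₀ ρ) :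
    trotter G S ν h x ∈ N := (H.mem _ (mul_mem_Ico hν hh).1 _ hh x hx).2

omit [NormedSpace ℝ X] in
theorem ContractiveNear.nonneg (H : ContractiveNear G S U x₀ N d L₁ L₂ β ρ σ) {x y : X}
    (hx : x ∈ N) (hy : y ∈ N) : 0 ≤ d x y :=
  nonneg_of_mul_nonneg_right ((norm_nonneg _).trans (H.norm_le x hx y hy)) H.L₂_pos

omit [NormedSpace ℝ X] in
theorem ContractiveNear.trotter_contr (H : ContractiveNear G S U x₀ N d L₁ L₂ β ρ σ)
    (hν : ν ∈ Icc (0 : ℝ) 1) {h : ℝ} (hh : h ∈ Ico 0 σ) {x y : X} (hx : x ∈ ball x₀ ρ)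
    (hy : y ∈ ball x₀ ρ) :
    d (trotter G S ν h x) (trotter G S ν h y) ≤ Real.exp (2 * β * h) * d x y := by
  obtain ⟨hs, hsh⟩ := mul_mem_Ico hν hh
  refine (H.contr _ hs _ hh x hx y hy).trans (mul_le_mul_of_nonneg_right (Real.exp_le_exp.2 ?_)
    (H.nonneg (H.ball_subset hx) (H.ball_subset hy)))
  linarith [mul_le_mul_of_nonneg_left hsh H.β_pos.le]

omit [NormedSpace ℝ X] in
theorem ContractiveNear.le_div (H : ContractiveNear G S U x₀ N d L₁ L₂ β ρ σ) {x y : X}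
    (hx : x ∈ N) (hy : y ∈ N) : d x y ≤ ‖x - y‖ / L₁ := by
  rw [le_div_iff₀ H.L₁_pos, mul_comm]
  exact H.le_norm x hx y hy

omit [NormedSpace ℝ X] in
theorem ContractiveNear.sub_le (H : ContractiveNear G S U x₀ N d L₁ L₂ β ρ σ) {x y x' y' : X}
    (hx : x ∈ N) (hy : y ∈ N) (hx' : x' ∈ N) (hy' : y' ∈ N) :
    d x y - d x' y' ≤ (‖x - x'‖ + ‖y - y'‖) / L₁ := by
  have h1 := H.triangle x hx x' hx' y hy
  have h2 := H.triangle x' hx' y' hy' y hy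
  have h3 := H.le_div hx hx'
  have h4 := H.le_div hy hy'
  rw [H.symm y hy y' hy'] at h4
  rw [add_div]
  linarith

omit [NormedSpace ℝ X] in
theorem ContractiveNear.lipschitzOnWith_dist (H : ContractiveNear G S U x₀ N d L₁ L₂ β ρ σ)
    {s : Set ℝ} {K K' : NNReal} (hv : LipschitzOnWith K v s) (hy : LipschitzOnWith K' y s)
    (hvN : ∀ t ∈ s, v t ∈ N) (hyN : ∀ t ∈ s, y t ∈ N) :
    ∃ M, LipschitzOnWith M (fun t => d (v t) (y t)) s := by
  have hL₁ := H.L₁_pos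
  refine ⟨⟨(K + K') / L₁, by positivity⟩, LipschitzOnWith.of_dist_le_mul fun t ht r hr => ?_⟩
  have key : ∀ t ∈ s, ∀ r ∈ s, d (v t) (y t) - d (v r) (y r) ≤ (K + K') / L₁ * dist t r := by
    intro t ht r hr
    refine (H.sub_le (hvN t ht) (hyN t ht) (hvN r hr) (hyN r hr)).trans ?_
    have h1 := hv.dist_le_mul t ht r hr
    have h2 := hy.dist_le_mul t ht r hr
    rw [dist_eq_norm] at h1 h2
    rw [div_mul_eq_mul_div, add_mul]
    gcongr
  rw [Real.dist_eq, abs_le']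
  refine ⟨key t ht r hr, ?_⟩
  rw [neg_sub, dist_comm]
  exact key r hr t ht

/-- Two curves tangent to the Lie-Trotter step move apart at most exponentially. -/
theorem ContractiveNear.dist_le_of_tangentOn (H : ContractiveNear G S U x₀ N d L₁ L₂ β ρ σ)
    (hν : ν ∈ Icc (0 : ℝ) 1) (h0 : ∀ x ∈ ball x₀ ρ, trotter G S ν 0 x = x) (hab : a ≤ b)
    (hv : TangentOn G S ν v a b) (hy : TangentOn G S ν y a b)
    (hvN : ∀ t ∈ Icc a b, v t ∈ ball x₀ ρ) (hyN : ∀ t ∈ Icc a b, y t ∈ ball x₀ ρ) :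
    d (v b) (y b) ≤ Real.exp (2 * β * (b - a)) * d (v a) (y a) := by
  have hL₁ := H.L₁_pos
  obtain ⟨⟨K, hK⟩, hv'⟩ := hv
  obtain ⟨⟨K', hK'⟩, hy'⟩ := hy
  obtain ⟨M, hM⟩ := H.lipschitzOnWith_dist hK hK' (fun t ht => H.ball_subset (hvN t ht))
    fun t ht => H.ball_subset (hyN t ht)
  refine le_exp_mul_of_ae_deriv_le hab hM ?_
  filter_upwards [hv', hy'] with s h1 h2 hs φ' hφ'
  obtain ⟨w, hw, hFw⟩ := h1 hs
  obtain ⟨w₂, hw₂, hFw₂⟩ := h2 hs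
  have hsI := Ioo_subset_Icc_self hs
  -- The curve and the Lie-Trotter step share their velocity at `s`, so their difference is `o(h)`.
  have err : ∀ {v : ℝ → X} {w : X}, v s ∈ ball x₀ ρ → HasDerivAt v w s →
      HasDerivWithinAt (fun h => trotter G S ν h (v s)) w (Ici 0) 0 →
      HasDerivWithinAt (fun h => ‖v (s + h) - trotter G S ν h (v s)‖) 0 (Ici 0) 0 := by
    intro v w hvs hw hF
    refine hasDerivWithinAt_norm_of_zero (by simp [h0 _ hvs]) ?_
    have := (hasDerivWithinAt_shift hw).sub hF
    rw [sub_self] at this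
    exact this
  have e1 := err (hvN s hsI) hw hFw
  have e2 := err (hyN s hsI) hw₂ hFw₂
  have hexp : HasDerivWithinAt (fun h => Real.exp (2 * β * h)) (2 * β) (Ici 0) 0 := by
    have := (((hasDerivAt_id (0 : ℝ)).const_mul (2 * β)).exp).hasDerivWithinAt (s := Ici 0)
    simpa using this
  -- The function is `(err v + err y) / L₁ + e^{2βh} d(v s, y s) - d(v (s+h), y (s+h))`. It vanishes
  -- at `h = 0` and is nonnegative for small `h > 0`, so its right derivative `2β d(v s, y s) - φ'`
  -- is nonnegative. No differentiability of `d` itself is used.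
  have hg := (((e1.add e2).div_const L₁).add (hexp.mul_const (d (v s) (y s)))).sub
    (hasDerivWithinAt_shift hφ')
  rw [add_zero, zero_div, zero_add] at hg
  have hδ : 0 < min σ (b - s) := lt_min H.σ_pos (sub_pos.2 hs.2)
  refine sub_nonneg.1 (nonneg_of_hasDerivWithinAt hδ ?_ ?_ hg)
  · simp [h0 _ (hvN s hsI), h0 _ (hyN s hsI)]
  · intro h hh
    have hhσ : h ∈ Ico 0 σ := ⟨hh.1.le, hh.2.trans_le (min_le_left _ _)⟩
    have hsh : s + h ∈ Icc a b :=
      ⟨by linarith [hsI.1, hh.1], by linarith [hh.2.trans_le (min_le_right _ _)]⟩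
    have c1 := H.sub_le (H.ball_subset (hvN _ hsh)) (H.ball_subset (hyN _ hsh))
      (H.trotter_mem hν hhσ (hvN s hsI)) (H.trotter_mem hν hhσ (hyN s hsI))
    have c2 := H.trotter_contr hν hhσ (hvN s hsI) (hyN s hsI)
    simp only [Pi.sub_apply, Pi.add_apply]
    linarith

omit [NormedSpace ℝ X] in
theorem ContractiveNear.continuousOn_dist (H : ContractiveNear G S U x₀ N d L₁ L₂ β ρ σ)
    {s : Set ℝ} (hv : ContinuousOn v s) (hy : ContinuousOn y s)
    (hvN : ∀ t ∈ s, v t ∈ N) (hyN : ∀ t ∈ s, y t ∈ N) :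
    ContinuousOn (fun t => d (v t) (y t)) s := by
  intro t ht
  rw [ContinuousWithinAt, tendsto_iff_dist_tendsto_zero]
  have h1 := tendsto_iff_norm_sub_tendsto_zero.1 (hv t ht)
  have h2 := tendsto_iff_norm_sub_tendsto_zero.1 (hy t ht)
  have h3 := (h1.add h2).div_const L₁
  rw [add_zero, zero_div] at h3
  refine squeeze_zero' (Eventually.of_forall fun _ => dist_nonneg) ?_ h3
  filter_upwards [self_mem_nhdsWithin] with r hr
  rw [Real.dist_eq, abs_le']
  refine ⟨H.sub_le (hvN r hr) (hyN r hr) (hvN t ht) (hyN t ht), ?_⟩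
  rw [neg_sub, norm_sub_rev (v r), norm_sub_rev (y r)]
  exact H.sub_le (hvN t ht) (hyN t ht) (hvN r hr) (hyN r hr)

/-- Tangency is available only on a short interval to the right of each point. The estimate spreads
by continuous induction, since the exponential factors multiply. -/
theorem ContractiveNear.dist_le_of_rightTangent (H : ContractiveNear G S U x₀ N d L₁ L₂ β ρ σ)
    (hν : ν ∈ Icc (0 : ℝ) 1) (h0 : ∀ x ∈ ball x₀ ρ, trotter G S ν 0 x = x) (hab : a ≤ b)
    (hvc : ContinuousOn v (Icc a b)) (hyc : ContinuousOn y (Icc a b))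
    (hv : ∀ s ∈ Ico a b, RightTangent G S ν v s) (hy : ∀ s ∈ Ico a b, RightTangent G S ν y s)
    (hvN : ∀ t ∈ Icc a b, v t ∈ ball x₀ ρ) (hyN : ∀ t ∈ Icc a b, y t ∈ ball x₀ ρ) :
    d (v b) (y b) ≤ Real.exp (2 * β * (b - a)) * d (v a) (y a) := by
  have hc := H.continuousOn_dist hvc hyc (fun t ht => H.ball_subset (hvN t ht))
    fun t ht => H.ball_subset (hyN t ht)
  set s := {t | d (v t) (y t) ≤ Real.exp (2 * β * (t - a)) * d (v a) (y a)} with hs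
  have hcl : IsClosed (s ∩ Icc a b) := by
    rw [inter_comm]
    exact isClosed_Icc.isClosed_le hc (by fun_prop)
  refine hcl.Icc_subset_of_forall_exists_gt (by simp [hs]) ?_ ⟨hab, le_rfl⟩
  rintro x ⟨hxs, hx⟩ z hz
  obtain ⟨c₁, hc₁, ht₁⟩ := (hv x hx).exists_le (lt_min hz hx.2)
  obtain ⟨c₂, hc₂, ht₂⟩ := (hy x hx).exists_le (lt_min hz hx.2)
  have hxc : x < min c₁ c₂ := lt_min hc₁.1 hc₂.1
  have hcb : min c₁ c₂ ≤ b := (min_le_left _ _).trans (hc₁.2.trans (min_le_right _ _))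
  have hsub : Icc x (min c₁ c₂) ⊆ Icc a b := Icc_subset_Icc hx.1 hcb
  have key := H.dist_le_of_tangentOn hν h0 hxc.le (ht₁.mono le_rfl (min_le_left _ _))
    (ht₂.mono le_rfl (min_le_right _ _)) (fun t ht => hvN t (hsub ht))
    fun t ht => hyN t (hsub ht)
  refine ⟨min c₁ c₂, ?_, hxc, (min_le_left _ _).trans (hc₁.2.trans (min_le_left _ _))⟩
  refine key.trans ((mul_le_mul_of_nonneg_left hxs (Real.exp_nonneg _)).trans (le_of_eq ?_))
  rw [← mul_assoc, ← Real.exp_add]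
  ring_nf

/-- Tangent curves with the same initial value agree; tangency is not needed at the end points. -/
theorem ContractiveNear.eq_of_rightTangent (H : ContractiveNear G S U x₀ N d L₁ L₂ β ρ σ)
    (hν : ν ∈ Icc (0 : ℝ) 1) (h0 : ∀ x ∈ ball x₀ ρ, trotter G S ν 0 x = x) (hab : a ≤ b)
    (hvc : ContinuousOn v (Icc a b)) (hyc : ContinuousOn y (Icc a b))
    (hv : ∀ s ∈ Ioo a b, RightTangent G S ν v s) (hy : ∀ s ∈ Ioo a b, RightTangent G S ν y s)
    (hvN : ∀ t ∈ Icc a b, v t ∈ ball x₀ ρ) (hyN : ∀ t ∈ Icc a b, y t ∈ ball x₀ ρ)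
    (heq : v a = y a) : v b = y b := by
  rcases hab.eq_or_lt with rfl | hab
  · exact heq
  have hc := H.continuousOn_dist hvc hyc (fun t ht => H.ball_subset (hvN t ht))
    fun t ht => H.ball_subset (hyN t ht)
  have haN := H.ball_subset (hvN a ⟨le_rfl, hab.le⟩)
  have hbN := H.ball_subset (hvN b ⟨hab.le, le_rfl⟩)
  have hbN' := H.ball_subset (hyN b ⟨hab.le, le_rfl⟩)
  have hzero : d (v a) (y a) = 0 := by
    refine le_antisymm ?_ (H.nonneg haN (heq ▸ haN))
    have := H.le_div haN (heq ▸ haN : y a ∈ N)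
    rwa [show v a - y a = 0 from sub_eq_zero.2 heq, norm_zero, zero_div] at this
  -- The estimate is applied on `[t, b]` with `t > a`, and then `t` tends to `a`; this is why
  -- nothing is required of the curves at `a`.
  have hlim : Tendsto (fun t => Real.exp (2 * β * (b - t)) * d (v t) (y t)) (𝓝[>] a)
      (𝓝 (Real.exp (2 * β * (b - a)) * d (v a) (y a))) := by
    have h1 : Tendsto (fun t => Real.exp (2 * β * (b - t))) (𝓝[>] a)
        (𝓝 (Real.exp (2 * β * (b - a)))) :=
      (Continuous.tendsto (by fun_prop) a).mono_left nhdsWithin_le_nhds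
    refine h1.mul ?_
    have := (hc a ⟨le_rfl, hab.le⟩).mono_left (nhdsWithin_mono a Ioc_subset_Icc_self)
    rwa [nhdsWithin_Ioc_eq_nhdsGT hab] at this
  have hle : d (v b) (y b) ≤ 0 := by
    rw [hzero, mul_zero] at hlim
    refine ge_of_tendsto hlim ?_
    filter_upwards [Ioo_mem_nhdsGT hab] with t ht
    have hsub : Icc t b ⊆ Icc a b := Icc_subset_Icc ht.1.le le_rfl
    have hsub' : ∀ s ∈ Ico t b, s ∈ Ioo a b := fun s hs => ⟨ht.1.trans_le hs.1, hs.2⟩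
    exact H.dist_le_of_rightTangent hν h0 ht.2.le (hvc.mono hsub) (hyc.mono hsub)
      (fun s hs => hv s (hsub' s hs)) (fun s hs => hy s (hsub' s hs))
      (fun s hs => hvN s (hsub hs)) fun s hs => hyN s (hsub hs)
  have := H.norm_le _ hbN _ hbN'
  have h2 : ‖v b - y b‖ ≤ 0 := this.trans (mul_nonpos_of_nonneg_of_nonpos H.L₂_pos.le hle)
  exact sub_eq_zero.1 (norm_le_zero_iff.1 h2)

/-- A tangent curve agrees with a tangent curve in `ball x₀ ρ` that has the same initial value. -/
theorem ContractiveNear.eqOn_of_rightTangent (H : ContractiveNear G S U x₀ N d L₁ L₂ β ρ σ)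
    (hν : ν ∈ Icc (0 : ℝ) 1) (h0 : ∀ x ∈ ball x₀ ρ, trotter G S ν 0 x = x)
    (hvc : ContinuousOn v (Icc a b)) (hyc : ContinuousOn y (Icc a b))
    (hv : ∀ s ∈ Ico a b, RightTangent G S ν v s) (hy : ∀ s ∈ Ico a b, RightTangent G S ν y s)
    (hyN : ∀ t ∈ Icc a b, y t ∈ ball x₀ ρ) (heq : v a = y a) : EqOn v y (Icc a b) := by
  have hcl : IsClosed ({t | v t = y t} ∩ Icc a b) := by
    have h1 := (hvc.sub hyc).preimage_isClosed_of_isClosed isClosed_Icc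
      (isClosed_singleton (x := (0 : X)))
    convert h1 using 1
    ext t
    simp [sub_eq_zero, and_comm]
  refine hcl.Icc_subset_of_forall_exists_gt heq ?_
  rintro x ⟨hx, hxab⟩ z hz
  have hxI := Ico_subset_Icc_self hxab
  have hvx : v x ∈ ball x₀ ρ := by
    rw [show v x = y x from hx]
    exact hyN x hxI
  -- Only `y` is known to stay in the ball; `v` agrees with it at `x` and remains in the ball for a
  -- short time by continuity.
  have hev : ∀ᶠ t in 𝓝[≥] x, v t ∈ ball x₀ ρ := by
    have h1 := (hvc x hxI).mono (Icc_subset_Icc hxab.1 le_rfl) |>.eventually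
      (isOpen_ball.mem_nhds hvx)
    rwa [nhdsWithin_Icc_eq_nhdsGE hxab.2] at h1
  obtain ⟨c, hc, hball⟩ := (nhdsGE_basis x).eventually_iff.1 hev
  obtain ⟨c', hc', hc'l⟩ := exists_between (lt_min (show x < c from hc) (lt_min hz hxab.2))
  have hle := le_min_iff.1 hc'l.le
  have hle2 := le_min_iff.1 hle.2
  have hsub : Icc x c' ⊆ Icc a b := Icc_subset_Icc hxab.1 hle2.2
  refine ⟨c', ?_, hc', hle2.1⟩
  exact H.eq_of_rightTangent hν h0 hc'.le (hvc.mono hsub) (hyc.mono hsub)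
    (fun s hs => hv s ⟨hxab.1.trans hs.1.le, hs.2.trans_le hle2.2⟩)
    (fun s hs => hy s ⟨hxab.1.trans hs.1.le, hs.2.trans_le hle2.2⟩)
    (fun t ht => hball ⟨ht.1, ht.2.trans_lt (hc'l.trans_le (min_le_left _ _))⟩)
    (fun t ht => hyN t (hsub ht)) hx

end

/-! ### From solutions in the larger space to tangent curves in `X`. -/

section

variable {X Z Xt Zt : Type*}
    [NormedAddCommGroup X] [NormedSpace ℝ X] [NormedAddCommGroup Z] [NormedSpace ℝ Z]
    [NormedAddCommGroup Xt] [NormedSpace ℝ Xt] [NormedAddCommGroup Zt] [NormedSpace ℝ Zt]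
    {i : Z →L[ℝ] X} {j : X →L[ℝ] Xt} {k : Zt →L[ℝ] X} {U : Set X} {T : ℝ}
    {G S : ℝ → X → X} {GZ SZ : ℝ → Z → Z} {Ξ : X → Xt} {ΞZ : Z → Zt} {ν a b : ℝ}
    {v : ℝ → X} {ζ : ℝ → Z} {x : X} {z : Z}

/-- A curve whose derivative in a larger space is given by a bounded measurable curve is almost
everywhere differentiable. -/
theorem tangentOn_of_measurable [CompleteSpace X] [CompleteSpace Xt]
    (hj : Function.Injective j) {w : ℝ → X} {M : ℝ} (hv : ContinuousOn v (Icc a b))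
    (hd : ∀ s ∈ Icc a b, HasDerivWithinAt (fun t => j (v t)) (j (w s)) (Icc a b) s)
    (hw : AEStronglyMeasurable w (volume.restrict (Icc a b))) (hM : ∀ s ∈ Icc a b, ‖w s‖ ≤ M)
    (hF : ∀ s ∈ Icc a b, HasDerivWithinAt (fun h => trotter G S ν h (v s)) (w s) (Ici 0) 0) :
    TangentOn G S ν v a b := by
  rcases lt_or_ge b a with hba | hab
  · refine ⟨⟨0, by simp [Icc_eq_empty_of_lt hba]⟩, ?_⟩
    simp [Ioo_eq_empty_of_le hba.le]
  have hint : IntegrableOn w (Icc a b) :=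
    Integrable.of_bound hw M ((ae_restrict_iff' measurableSet_Icc).2 (Eventually.of_forall hM))
  have hII : ∀ s ∈ Icc a b, ∀ t ∈ Icc a b, IntervalIntegrable w volume s t := fun s hs t ht =>
    (hint.mono_set (uIcc_subset_Icc hs ht)).intervalIntegrable
  have ha : a ∈ Icc a b := ⟨le_rfl, hab⟩
  -- The Bochner integral is formed in `X`; its image under `j` equals the increment of `j ∘ v`, and
  -- `j` is injective.
  have hV : ∀ t ∈ Icc a b, v t = v a + ∫ s in a..t, w s := by
    intro t ht
    have hsub : Icc a t ⊆ Icc a b := Icc_subset_Icc le_rfl ht.2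
    have h1 : ∫ s in a..t, j (w s) = j (v t) - j (v a) := by
      refine intervalIntegral.integral_eq_sub_of_hasDeriv_right_of_le ht.1
        (j.continuous.comp_continuousOn (hv.mono hsub)) (fun s hs => ?_) ?_
      · exact (hd s (hsub (Ioo_subset_Icc_self hs))).mono_of_mem_nhdsWithin
          (mem_nhdsWithin_of_mem_nhds (Icc_mem_nhds hs.1 (hs.2.trans_le ht.2)))
      · have h := hII a ha t ht
        exact ⟨j.integrable_comp h.1, j.integrable_comp h.2⟩
    rw [j.intervalIntegral_comp_comm (hII a ha t ht), ← map_sub] at h1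
    rw [hj h1]
    abel
  refine ⟨⟨⟨max M 0, le_max_right _ _⟩, LipschitzOnWith.of_dist_le_mul fun t ht s hs => ?_⟩, ?_⟩
  · rw [dist_eq_norm, hV t ht, hV s hs, add_sub_add_left_eq_sub,
      intervalIntegral.integral_interval_sub_left (hII a ha t ht) (hII a ha s hs), Real.dist_eq]
    refine intervalIntegral.norm_integral_le_of_norm_le_const fun r hr => ?_
    exact (hM r (uIcc_subset_Icc hs ht (uIoc_subset_uIcc hr))).trans (le_max_left _ _)
  -- Lebesgue's differentiation theorem in `X`.
  · filter_upwards [(hII a ha b ⟨hab, le_rfl⟩).ae_hasDerivAt_integral] with s h1 hs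
    have hsI := Ioo_subset_Icc_self hs
    have h2 := h1 (by rwa [uIcc_of_le hab]) a (by rwa [uIcc_of_le hab])
    refine ⟨w s, (h2.const_add (v a)).congr_of_eventuallyEq ?_, hF s hsI⟩
    filter_upwards [Icc_mem_nhds hs.1 hs.2] with t ht using hV t ht

theorem Splitting.continuousOn_generator (H : Splitting i j k U T G S GZ SZ Ξ ΞZ) :
    ContinuousOn (generator G) U := by
  intro x hx
  obtain ⟨σ, -, -, ρ, hρ, -, K, hK, -, h, -⟩ := exists_estimates_of_contDiffOn H.T_pos H.isOpen hx
    H.contDiffOn_G fun x hx => (H.semigroup_G x hx).1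
  have : LipschitzOnWith ⟨K, hK⟩ (generator G) (ball x ρ) :=
    LipschitzOnWith.of_dist_le_mul fun y hy z hz => by
      rw [dist_eq_norm, dist_eq_norm]
      exact h y hy z hz
  exact (this.continuousOn.continuousAt (ball_mem_nhds x hρ)).continuousWithinAt

theorem Splitting.trotter_zero (H : Splitting i j k U T G S GZ SZ Ξ ΞZ) (hx : x ∈ U) :
    trotter G S ν 0 x = x := by
  rw [trotter, mul_zero, (H.semigroup_S x hx).1, (H.semigroup_G x hx).1]

theorem Splitting.hasDerivWithinAt_trotter (H : Splitting i j k U T G S GZ SZ Ξ ΞZ)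
    (hν : ν ∈ Icc (0 : ℝ) 1) (hz : z ∈ i ⁻¹' U) :
    HasDerivWithinAt (fun h => trotter G S ν h (i z))
      (generator G (i z) + ν • generator S (i z)) (Ici 0) 0 := by
  obtain ⟨ρ, σ, R, R₃, R₂, R₁, K, B, -⟩ := H.exists_localBounds hz one_pos one_pos one_pos
  have hzR : z ∈ ball z R₃ := mem_ball_self (B.R₁_pos.trans_le (B.R₁_le.trans B.R₂_le))
  refine HasDerivWithinAt.mono_of_mem_nhdsWithin (t := Ico 0 σ) ?_ (Ico_mem_nhdsGE B.σ_pos)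
  refine hasDerivWithinAt_of_norm_le_sq (C := 2 * K + K ^ 2) fun h hh => ?_
  obtain ⟨hs, hsh⟩ := mul_mem_Ico hν hh
  have := B.norm_tangent_le H hs hh hsh hzR
  rw [H.trotter_zero hz, sub_zero, trotter]
  refine le_trans (le_of_eq ?_) this
  congr 1
  module

theorem Splitting.hasDerivWithinAt_trotter_zero (H : Splitting i j k U T G S GZ SZ Ξ ΞZ)
    (hx : x ∈ U) :
    HasDerivWithinAt (fun h => trotter G S 0 h x) (generator G x) (Ici 0) 0 := by
  obtain ⟨σ, hσ, -, ρ, hρ, -, K, hK, h, -⟩ := exists_estimates_of_contDiffOn H.T_pos H.isOpen hx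
    H.contDiffOn_G fun x hx => (H.semigroup_G x hx).1
  refine HasDerivWithinAt.mono_of_mem_nhdsWithin (t := Ico 0 σ) ?_ (Ico_mem_nhdsGE hσ)
  refine hasDerivWithinAt_of_norm_le_sq (C := K) fun t ht => ?_
  have := h t ht x (mem_ball_self hρ)
  rwa [H.trotter_zero hx, sub_zero, trotter, zero_mul, (H.semigroup_S x hx).1]

/-- Solutions of the equation with `ν = 0` are tangent to the Lie-Trotter step. -/
theorem Splitting.tangentOn_zero [CompleteSpace X] [CompleteSpace Xt]
    (H : Splitting i j k U T G S GZ SZ Ξ ΞZ) (hU : ∀ s ∈ Icc a b, v s ∈ U)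
    (hv : ContinuousOn v (Icc a b))
    (hd : ∀ s ∈ Icc a b, HasDerivWithinAt (fun t => j (v t)) (vectorField j G Ξ 0 (v s))
      (Icc a b) s) : TangentOn G S 0 v a b := by
  have hc : ContinuousOn (fun s => generator G (v s)) (Icc a b) :=
    H.continuousOn_generator.comp hv hU
  -- The velocity is continuous in `X` here, so `Z`-valuedness plays no role.
  obtain ⟨M, hM⟩ := isCompact_Icc.exists_bound_of_continuousOn hc
  refine tangentOn_of_measurable H.j_injective hv (fun s hs => ?_)
    (hc.aestronglyMeasurable measurableSet_Icc) hM
    fun s hs => H.hasDerivWithinAt_trotter_zero (hU s hs)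
  simpa [vectorField] using hd s hs

/-- The lift `ζ` need not be continuous, but reflexivity makes it measurable with separable range,
and the generator of `S` along it is the continuous map `k ∘ ΞZ` of `ζ`. -/
theorem Splitting.aestronglyMeasurable_generator (H : Splitting i j k U T G S GZ SZ Ξ ΞZ)
    (hvζ : ∀ s ∈ Icc a b, v s = i (ζ s)) (hU : ∀ s ∈ Icc a b, v s ∈ U)
    (hv : ContinuousOn v (Icc a b)) :
    AEStronglyMeasurable (fun s => generator S (v s)) (volume.restrict (Icc a b)) := by
  borelize Z
  borelize Zt
  have hcont : Continuous fun s : Icc a b => i (ζ s) := by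
    have := continuousOn_iff_continuous_domRestrict.1 hv
    convert this using 2 with s
    exact (hvζ s s.2).symm
  have hζU : ∀ s : Icc a b, ζ s ∈ i ⁻¹' U := fun s => by
    change i (ζ s) ∈ U
    rw [← hvζ s s.2]
    exact hU s s.2
  have hmeas : Measurable fun s : Icc a b => ζ s :=
    measurable_of_reflexive H.i_injective H.reflexive hcont
  have hsep := isSeparable_range_of_reflexive H.i_injective H.reflexive hcont
  have hΞ : StronglyMeasurable fun s : Icc a b => ΞZ (ζ s) := by
    rw [stronglyMeasurable_iff_measurable_separable]
    constructor
    · refine measurable_of_isOpen fun O hO => ?_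
      have h1 := H.contDiffOn_ΞZ.continuousOn.isOpen_inter_preimage H.isOpen_Z hO
      convert hmeas h1.measurableSet using 1
      ext s
      exact ⟨fun hs => ⟨hζU s, hs⟩, fun hs => hs.2⟩
    · have := (H.contDiffOn_ΞZ.continuousOn.mono (range_subset_iff.2 hζU)).isSeparable_image hsep
      rwa [← range_comp] at this
  have h2 : StronglyMeasurable fun s : Icc a b => generator S (v s) := by
    convert k.continuous.comp_stronglyMeasurable hΞ using 2 with s
    rw [H.ΞZ_eq _ (hζU s), hvζ s s.2]
  rw [← map_comap_subtype_coe measurableSet_Icc,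
    (MeasurableEmbedding.subtype_coe measurableSet_Icc).aestronglyMeasurable_map_iff]
  exact h2.aestronglyMeasurable

/-- `Z`-valued solutions along which the generator of `S` is bounded are tangent to the
Lie-Trotter step. -/
theorem Splitting.tangentOn_of_bounded [CompleteSpace X] [CompleteSpace Xt]
    (H : Splitting i j k U T G S GZ SZ Ξ ΞZ) (hν : ν ∈ Icc (0 : ℝ) 1)
    (hvζ : ∀ s ∈ Icc a b, v s = i (ζ s)) (hU : ∀ s ∈ Icc a b, v s ∈ U)
    (hv : ContinuousOn v (Icc a b))
    (hd : ∀ s ∈ Icc a b, HasDerivWithinAt (fun t => j (v t)) (vectorField j G Ξ ν (v s))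
      (Icc a b) s) {M : ℝ} (hM : ∀ s ∈ Icc a b, ‖generator S (v s)‖ ≤ M) :
    TangentOn G S ν v a b := by
  have hc : ContinuousOn (fun s => generator G (v s)) (Icc a b) :=
    H.continuousOn_generator.comp hv hU
  obtain ⟨M', hM'⟩ := isCompact_Icc.exists_bound_of_continuousOn hc
  have hζU : ∀ s ∈ Icc a b, ζ s ∈ i ⁻¹' U := fun s hs => by
    change i (ζ s) ∈ U
    rw [← hvζ s hs]
    exact hU s hs
  refine tangentOn_of_measurable (w := fun s => generator G (v s) + ν • generator S (v s))
    (M := M' + M) H.j_injective hv (fun s hs => ?_)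
    ((hc.aestronglyMeasurable measurableSet_Icc).add
      ((H.aestronglyMeasurable_generator hvζ hU hv).const_smul ν)) (fun s hs => ?_)
    fun s hs => ?_
  · have := hd s hs
    rwa [vectorField, hvζ s hs, H.Ξ_eq _ (hζU s hs), ← map_smul, ← map_add, ← hvζ s hs] at this
  · refine (norm_add_le _ _).trans (add_le_add (hM' s hs) ?_)
    rw [norm_smul, Real.norm_of_nonneg hν.1]
    exact (mul_le_of_le_one_left (norm_nonneg _) hν.2).trans (hM s hs)
  · rw [hvζ s hs]
    exact H.hasDerivWithinAt_trotter hν (hζU s hs)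

end

/-! ### Tangency of arbitrary `Z`-valued solutions by Baire's theorem. -/

section

variable {X Z Xt Zt : Type*}
    [NormedAddCommGroup X] [NormedSpace ℝ X] [NormedAddCommGroup Z] [NormedSpace ℝ Z]
    [NormedAddCommGroup Xt] [NormedSpace ℝ Xt] [NormedAddCommGroup Zt] [NormedSpace ℝ Zt]
    {i : Z →L[ℝ] X} {j : X →L[ℝ] Xt} {k : Zt →L[ℝ] X} {U : Set X} {T : ℝ}
    {G S : ℝ → X → X} {GZ SZ : ℝ → Z → Z} {Ξ : X → Xt} {ΞZ : Z → Zt} {ν a b : ℝ}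
    {v : ℝ → X} {ζ : ℝ → Z} {x : X} {z₀ z : Z}

namespace LocalScheme

/-- On a `Z`-ball the generator of `S` is Lipschitz for the norm of `Z`, hence bounded, so
`Splitting.tangentOn_of_bounded` applies. -/
theorem tangentOn_of_mem [CompleteSpace X] [CompleteSpace Xt]
    (L : LocalScheme i j U T G S GZ SZ Ξ z₀) (H : Splitting i j k U T G S GZ SZ Ξ ΞZ)
    (hν : ν ∈ Icc (0 : ℝ) 1) (hvζ : ∀ s ∈ Icc a b, v s ∈ i '' closedBall z₀ (L.R₁ / 2))
    (hv : ContinuousOn v (Icc a b))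
    (hd : ∀ s ∈ Icc a b, HasDerivWithinAt (fun t => j (v t)) (vectorField j G Ξ ν (v s))
      (Icc a b) s) : TangentOn G S ν v a b := by
  have hex : ∀ s, ∃ z, s ∈ Icc a b → z ∈ closedBall z₀ (L.R₁ / 2) ∧ v s = i z := fun s => by
    by_cases hs : s ∈ Icc a b
    · obtain ⟨z, hz, hzs⟩ := hvζ s hs
      exact ⟨z, fun _ => ⟨hz, hzs.symm⟩⟩
    · exact ⟨0, fun h => absurd h hs⟩
  choose ζ hζ using hex
  have hR₁ := L.bounds.R₁_pos
  have hball : ∀ s ∈ Icc a b, ζ s ∈ ball z₀ L.R := fun s hs =>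
    L.bounds.ball_R₁ (mem_ball_of_mem (hζ s hs).1)
  refine H.tangentOn_of_bounded hν (fun s hs => (hζ s hs).2) (fun s hs => ?_) hv hd
    (M := L.K * (L.R₁ / 2) + ‖generator S (i z₀)‖) fun s hs => ?_
  · rw [(hζ s hs).2]
    exact L.bounds.mem_U (hball s hs)
  · have h1 := L.bounds.genS_lip _ (hball s hs) z₀ (L.bounds.ball_R₁ (mem_ball_self hR₁))
    have h2 := (hζ s hs).1
    rw [mem_closedBall, dist_eq_norm] at h2
    rw [(hζ s hs).2]
    have h3 := norm_sub_norm_le (generator S (i (ζ s))) (generator S (i z₀))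
    have h4 := mul_le_mul_of_nonneg_left h2 L.bounds.K_nonneg
    linarith

theorem trotter_zero (L : LocalScheme i j U T G S GZ SZ Ξ z₀)
    (H : Splitting i j k U T G S GZ SZ Ξ ΞZ) (hx : x ∈ ball (i z₀) L.ρ) :
    trotter G S ν 0 x = x := H.trotter_zero (L.bounds.ball_subset hx)

/-- The quasi-contraction property on the ball on which the other estimates hold. -/
theorem contractive' (L : LocalScheme i j U T G S GZ SZ Ξ z₀) :
    ContractiveNear G S U (i z₀) L.N L.d L.L₁ L.L₂ L.β L.ρ L.σ' where
  __ := L.contractive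
  ρ_pos := L.bounds.ρ_pos
  ball_subset := (ball_subset_ball L.ρ_le).trans L.contractive.ball_subset
  mem s hs t ht x hx := L.contractive.mem s hs t ht x (ball_subset_ball L.ρ_le hx)
  contr s hs t ht x hx y hy := L.contractive.contr s hs t ht x (ball_subset_ball L.ρ_le hx) y
    (ball_subset_ball L.ρ_le hy)

theorem tangentOn_sol [CompleteSpace X] [CompleteSpace Xt]
    (L : LocalScheme i j U T G S GZ SZ Ξ z₀) (H : Splitting i j k U T G S GZ SZ Ξ ΞZ)
    (hν : ν ∈ Icc (0 : ℝ) 1) (hz : z ∈ ball z₀ L.r) (c : ℝ) :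
    TangentOn G S ν (fun s => L.sol ν z (s - c)) c (c + L.τ) := by
  have hmaps : MapsTo (fun s => s - c) (Icc c (c + L.τ)) (Icc 0 L.τ) := fun s hs =>
    ⟨by linarith [hs.1], by linarith [hs.2]⟩
  refine L.tangentOn_of_mem H hν (fun s hs => L.sol_mem H hν hz (hmaps hs))
    ((continuousOn_sol hν hz).comp (by fun_prop) hmaps) fun s hs => ?_
  have h1 : HasDerivWithinAt (fun s : ℝ => s - c) 1 (Icc c (c + L.τ)) s :=
    (hasDerivWithinAt_id s _).sub_const c
  have := (L.hasDerivWithinAt_sol (j := j) hν hz (hmaps hs)).scomp s h1 hmaps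
  rw [one_smul] at this
  exact this

end LocalScheme

/-- Every `Z`-valued solution is tangent to the Lie-Trotter step to the right of every point: by
Baire's theorem it is locally close in `Z` to a point on a portion of the set of exceptional
points. -/
theorem Splitting.rightTangent_of_solution [CompleteSpace X] [CompleteSpace Xt]
    (H : Splitting i j k U T G S GZ SZ Ξ ΞZ) (hν : ν ∈ Icc (0 : ℝ) 1) {τ : ℝ}
    (hvζ : ∀ s ∈ Ico 0 τ, v s = i (ζ s)) (hU : ∀ s ∈ Ico 0 τ, v s ∈ U)
    (hv : ContinuousOn v (Ico 0 τ))
    (hd : ∀ s ∈ Ico 0 τ, HasDerivWithinAt (fun t => j (v t)) (vectorField j G Ξ ν (v s))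
      (Ico 0 τ) s) : ∀ s ∈ Ico 0 τ, RightTangent G S ν v s := by
  by_contra hcon
  push Not at hcon
  obtain ⟨t₀, ht₀, hbad⟩ := hcon
  obtain ⟨τ', htτ', hτ'⟩ := exists_between ht₀.2
  have hsubτ : Icc 0 τ' ⊆ Ico 0 τ := fun s hs => ⟨hs.1, hs.2.trans_lt hτ'⟩
  -- `B` is the set of bad times; its closure `P` is compact, hence a Baire space.
  set B := {t ∈ Ico 0 τ' | ¬ RightTangent G S ν v t} with hB
  set P := closure B with hP
  have hPsub : P ⊆ Icc 0 τ' := closure_minimal (fun t ht => Ico_subset_Icc_self ht.1) isClosed_Icc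
  have hPc : IsCompact P := isCompact_Icc.of_isClosed_subset isClosed_closure hPsub
  have : CompactSpace P := isCompact_iff_compactSpace.1 hPc
  have : Nonempty P := ⟨⟨t₀, subset_closure ⟨⟨ht₀.1, htτ'⟩, hbad⟩⟩⟩
  have hPτ : ∀ s : P, (s : ℝ) ∈ Ico 0 τ := fun s => hsubτ (hPsub s.2)
  have hζU : ∀ s ∈ Ico 0 τ, ζ s ∈ i ⁻¹' U := fun s hs => by
    change i (ζ s) ∈ U
    rw [← hvζ s hs]
    exact hU s hs
  have hcont : Continuous fun s : P => i (ζ s) := by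
    have := continuousOn_iff_continuous_domRestrict.1 (hv.mono (hPsub.trans hsubτ))
    convert this using 2 with s
    exact (hvζ s (hPτ s)).symm
  have hsep := isSeparable_range_of_reflexive H.i_injective H.reflexive hcont
  -- The strict inequality `r < L.r` lets the closed ball of radius `r` fit into the open ball of
  -- admissible initial values.
  have hLex : ∀ z : Z, ∃ r : ℝ, z ∈ i ⁻¹' U →
      ∃ L : LocalScheme i j U T G S GZ SZ Ξ z, 0 < r ∧ r < L.r := fun z => by
    by_cases hz : z ∈ i ⁻¹' U
    · obtain ⟨L⟩ := H.exists_localScheme hz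
      exact ⟨L.r / 2, fun _ => ⟨L, half_pos L.r_pos, half_lt_self L.r_pos⟩⟩
    · exact ⟨0, fun h => absurd h hz⟩
  choose r hr using hLex
  have hrange : ∀ z ∈ range (fun s : P => ζ s), z ∈ i ⁻¹' U := by
    rintro _ ⟨s, rfl⟩
    exact hζU s (hPτ s)
  obtain ⟨c, hcs, hcc, hcov⟩ := exists_countable_cover_ball hsep r fun z hz => by
    obtain ⟨L, h1, -⟩ := hr z (hrange z hz)
    exact h1
  have hcl : ∀ z : c, IsClosed ((fun s : P => ζ s) ⁻¹' closedBall (z : Z) (r z)) := fun z =>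
    isClosed_preimage_of_reflexive H.i_injective H.reflexive hcont isClosed_closedBall
      (convex_closedBall _ _) isBounded_closedBall
  have huniv : ⋃ z : c, (fun s : P => ζ s) ⁻¹' closedBall (z : Z) (r z) = univ := by
    refine eq_univ_of_forall fun s => ?_
    have := hcov (mem_range_self s)
    simp only [mem_iUnion, exists_prop] at this
    obtain ⟨z, hz, hzs⟩ := this
    exact mem_iUnion.2 ⟨⟨z, hz⟩, ball_subset_closedBall hzs⟩
  have := hcc.to_subtype
  -- Countably many closed sets cover `P`, so on a relatively open portion of `P` the lift `ζ` stays
  -- in one closed ball about `z`.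
  obtain ⟨⟨z, hzc⟩, p, hp⟩ := nonempty_interior_of_iUnion_of_closed hcl huniv
  obtain ⟨L, -, hrL⟩ := hr z (hrange z (hcs hzc))
  obtain ⟨O, hO, hpO, hOsub⟩ : ∃ O : Set ℝ, IsOpen O ∧ (p : ℝ) ∈ O ∧
      ∀ s ∈ O, s ∈ P → ζ s ∈ ball z L.r := by
    obtain ⟨O', hO'sub, hO', hpO'⟩ := mem_interior.1 hp
    obtain ⟨O, hO, rfl⟩ := isOpen_induced_iff.1 hO'
    exact ⟨O, hO, hpO', fun s hs hsP => closedBall_subset_ball hrL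
      (hO'sub (show (⟨s, hsP⟩ : P) ∈ Subtype.val ⁻¹' O from hs))⟩
  have hrR : L.r ≤ L.R₁ / 2 := L.r_le
  have hball_r : ∀ {w}, w ∈ ball z L.r → w ∈ closedBall z (L.R₁ / 2) := fun hw =>
    ball_subset_closedBall (ball_subset_ball hrR hw)
  have hvp : v p ∈ ball (i z) L.ρ := by
    rw [hvζ p (hPτ p)]
    exact LocalScheme.image_mem_ball (hball_r (hOsub p hpO p.2))
  have hnear : ∀ᶠ s in 𝓝 (p : ℝ), s ∈ O ∧ (s ∈ Ico 0 τ → v s ∈ ball (i z) L.ρ) :=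
    (hO.eventually_mem hpO).and (eventually_nhdsWithin_iff.1
      ((hv p (hPτ p)).eventually (isOpen_ball.mem_nhds hvp)))
  obtain ⟨δ, hδ, hδsub⟩ := Metric.eventually_nhds_iff.1 hnear
  -- A bad time `b₀` is chosen near `p`, and then `b₁ > b₀`. Both lie within `L.τ / 2` of `p`, so a
  -- constructed solution started anywhere in `[b₀, b₁]` lives until `b₁`.
  obtain ⟨b₀, hb₀B, hb₀⟩ := Metric.mem_closure_iff.1 p.2 (min δ (L.τ / 2))
    (lt_min hδ (half_pos L.scheme.τ_pos))
  rw [dist_comm, Real.dist_eq, abs_lt] at hb₀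
  have hb₀' : b₀ < min τ' (p + min δ (L.τ / 2)) := lt_min hb₀B.1.2 (by linarith)
  obtain ⟨b₁, hb₀₁, hb₁⟩ := exists_between hb₀'
  have hb₁τ : b₁ < τ' := hb₁.trans_le (min_le_left _ _)
  have hb₁p : b₁ < p + min δ (L.τ / 2) := hb₁.trans_le (min_le_right _ _)
  have hδ1 : min δ (L.τ / 2) ≤ δ := min_le_left _ _
  have hδ2 : min δ (L.τ / 2) ≤ L.τ / 2 := min_le_right _ _
  have hIcc : Icc b₀ b₁ ⊆ Ico 0 τ := fun s hs =>
    ⟨hb₀B.1.1.trans hs.1, hs.2.trans_lt (hb₁τ.trans hτ')⟩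
  have hdist : ∀ s ∈ Icc b₀ b₁, dist s p < δ := fun s hs => by
    rw [Real.dist_eq, abs_lt]
    constructor <;> linarith [hs.1, hs.2]
  have hζP : ∀ s ∈ Icc b₀ b₁, s ∈ P → ζ s ∈ ball z L.r := fun s hs hsP =>
    hOsub s (hδsub (hdist s hs)).1 hsP
  have hvball : ∀ s ∈ Icc b₀ b₁, v s ∈ ball (i z) L.ρ := fun s hs =>
    (hδsub (hdist s hs)).2 (hIcc hs)
  have hmem : ∀ t ∈ Icc b₀ b₁, v t ∈ i '' closedBall z (L.R₁ / 2) := by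
    intro t ht
    -- `c` is the last time in `P` up to `t`. There `ζ c` is an admissible initial value, and `v` is
    -- compared with the constructed solution started from it at time `c`.
    obtain ⟨c, ⟨hcP, hct⟩, hcmax⟩ := (hPc.inter_right isClosed_Icc).exists_isGreatest
      (s := P ∩ Icc b₀ t) ⟨b₀, subset_closure hb₀B, le_rfl, ht.1⟩
    have hcI : c ∈ Icc b₀ b₁ := ⟨hct.1, hct.2.trans ht.2⟩
    have hζc := hζP c hcI hcP
    have hsub : Icc c t ⊆ Icc b₀ b₁ := Icc_subset_Icc hct.1 ht.2
    have htc : t ≤ c + L.τ := by linarith [hct.1, ht.2]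
    have hmaps : ∀ s ∈ Icc c t, s - c ∈ Icc 0 L.τ := fun s hs =>
      ⟨by linarith [hs.1], by linarith [hs.2]⟩
    have htan := L.tangentOn_sol H hν hζc c
    have heq := L.contractive'.eq_of_rightTangent hν (fun x hx => L.trotter_zero H hx) hct.2
      (hv.mono (hsub.trans hIcc))
      ((LocalScheme.continuousOn_sol hν hζc).comp (f := fun s => s - c) (by fun_prop) hmaps)
      -- A bad time in `(c, t)` would contradict the maximality of `c`. The time `c` itself may be
      -- bad, so the comparison must not need tangency there.
      (fun s hs => by
        by_contra hs'
        have hsB : s ∈ B := ⟨⟨hb₀B.1.1.trans (hct.1.trans hs.1.le),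
          hs.2.trans_le (ht.2.trans hb₁τ.le)⟩, hs'⟩
        exact absurd (hcmax ⟨subset_closure hsB, hct.1.trans hs.1.le, hs.2.le⟩) (not_le.2 hs.1))
      (fun s hs => htan.rightTangent ⟨hs.1.le, hs.2.trans_le htc⟩)
      (fun s hs => hvball s (hsub hs)) (fun s hs => L.sol_mem_ball H hν hζc (hmaps s hs))
      (by
        simp only [Function.comp_apply, sub_self]
        rw [LocalScheme.sol_zero hν hζc, hvζ c (hIcc hcI)])
    rw [heq]
    exact L.sol_mem H hν hζc (hmaps t ⟨hct.2, le_rfl⟩)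
  -- On `[b₀, b₁]` the solution lies in one closed `Z`-ball, so it is tangent to the right of the
  -- bad time `b₀`.
  exact hb₀B.2 ((L.tangentOn_of_mem H hν hmem (hv.mono hIcc)
    fun s hs => (hd s (hIcc hs)).mono hIcc).rightTangent ⟨le_rfl, hb₀₁⟩)

end

/-! ### Regularity, uniqueness and continuous dependence of the constructed solution. -/

section

variable {X Z Xt Zt : Type*}
    [NormedAddCommGroup X] [NormedSpace ℝ X] [NormedAddCommGroup Z] [NormedSpace ℝ Z]
    [NormedAddCommGroup Xt] [NormedSpace ℝ Xt] [NormedAddCommGroup Zt] [NormedSpace ℝ Zt]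
    {i : Z →L[ℝ] X} {j : X →L[ℝ] Xt} {k : Zt →L[ℝ] X} {U : Set X} {T : ℝ}
    {G S : ℝ → X → X} {GZ SZ : ℝ → Z → Z} {Ξ : X → Xt} {ΞZ : Z → Zt} {ν : ℝ}
    {v : ℝ → X} {x : X} {z₀ z : Z}

theorem MemCb.exists_boundedContinuousFunction {E : Type*} [NormedAddCommGroup E] {τ : ℝ}
    {f : ℝ → E} (h : MemCb τ f) : ∃ g : Ico 0 τ →ᵇ E, ∀ t : Ico 0 τ, g t = f t := by
  obtain ⟨M, hM⟩ := h.2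
  exact ⟨BoundedContinuousFunction.ofNormedAddCommGroup (fun t : Ico 0 τ => f t)
    (continuousOn_iff_continuous_domRestrict.1 h.1) M fun t => hM t t.2, fun _ => rfl⟩

theorem MemCb.of_lipschitz {E F : Type*} [NormedAddCommGroup E] [NormedAddCommGroup F] {τ : ℝ}
    {f : ℝ → E} {g : E → F} {x₀ : E} {ρ K : ℝ} (hρ : 0 < ρ) (hK : 0 ≤ K)
    (hf : ContinuousOn f (Ico 0 τ)) (hmem : ∀ t ∈ Ico 0 τ, f t ∈ ball x₀ ρ)
    (hg : ∀ x ∈ ball x₀ ρ, ∀ y ∈ ball x₀ ρ, ‖g x - g y‖ ≤ K * ‖x - y‖) :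
    MemCb τ fun t => g (f t) := by
  have hlip : LipschitzOnWith ⟨K, hK⟩ g (ball x₀ ρ) :=
    LipschitzOnWith.of_dist_le_mul fun x hx y hy => by
      rw [dist_eq_norm, dist_eq_norm]
      exact hg x hx y hy
  refine ⟨hlip.continuousOn.comp hf hmem, K * ρ + ‖g x₀‖, fun t ht => ?_⟩
  have h1 := hg _ (hmem t ht) x₀ (mem_ball_self hρ)
  have h2 := mem_ball_iff_norm.1 (hmem t ht)
  have h3 := norm_sub_norm_le (g (f t)) (g x₀)
  have h4 := mul_le_mul_of_nonneg_left h2.le hK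
  linarith

namespace LocalScheme

variable [CompleteSpace X] (L : LocalScheme i j U T G S GZ SZ Ξ z₀)

theorem memCb_sol (H : Splitting i j k U T G S GZ SZ Ξ ΞZ) (hν : ν ∈ Icc (0 : ℝ) 1)
    (hz : z ∈ ball z₀ L.r) : MemCb L.τ (L.sol ν z) :=
  MemCb.of_lipschitz (g := id) L.bounds.ρ_pos zero_le_one
    ((continuousOn_sol hν hz).mono Ico_subset_Icc_self)
    (fun t ht => L.sol_mem_ball H hν hz (Ico_subset_Icc_self ht)) fun x _ y _ => by simp

theorem memCb1_sol (H : Splitting i j k U T G S GZ SZ Ξ ΞZ) (hν : ν ∈ Icc (0 : ℝ) 1)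
    (hz : z ∈ ball z₀ L.r) : MemCb1 L.τ fun t => j (L.sol ν z t) := by
  have hc := (continuousOn_sol (L := L) hν hz).mono Ico_subset_Icc_self
  have hm : ∀ t ∈ Ico 0 L.τ, L.sol ν z t ∈ ball (i z₀) L.ρ := fun t ht =>
    L.sol_mem_ball H hν hz (Ico_subset_Icc_self ht)
  have hd : ∀ t ∈ Ico 0 L.τ, HasDerivWithinAt (fun s => j (L.sol ν z s))
      (vectorField j G Ξ ν (L.sol ν z t)) (Ico 0 L.τ) t := fun t ht =>
    (hasDerivWithinAt_sol hν hz (Ico_subset_Icc_self ht)).mono Ico_subset_Icc_self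
  have hW : MemCb L.τ fun t => vectorField j G Ξ ν (L.sol ν z t) :=
    MemCb.of_lipschitz L.bounds.ρ_pos
      (add_nonneg (mul_nonneg (norm_nonneg j) L.bounds.K_nonneg) L.bounds.K_nonneg) hc hm
      fun x hx y hy => L.bounds.vectorField_lip hν hx hy
  have heq : ∀ t ∈ Ico 0 L.τ, derivWithin (fun s => j (L.sol ν z s)) (Ico 0 L.τ) t
      = vectorField j G Ξ ν (L.sol ν z t) := fun t ht =>
    (hd t ht).derivWithin (uniqueDiffOn_Ico 0 L.τ t ht)
  refine ⟨MemCb.of_lipschitz (g := j) L.bounds.ρ_pos (norm_nonneg j) hc hm fun x _ y _ => by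
    rw [← map_sub]; exact j.le_opNorm _, fun t ht => (hd t ht).differentiableWithinAt,
    hW.1.congr heq, ?_⟩
  obtain ⟨M, hM⟩ := hW.2
  exact ⟨M, fun t ht => by rw [heq t ht]; exact hM t ht⟩

theorem isSolution_sol (H : Splitting i j k U T G S GZ SZ Ξ ΞZ) (hν : ν ∈ Icc (0 : ℝ) 1)
    (hz : z ∈ ball z₀ L.r) : IsSolution j U (generator G) Ξ ν L.τ (i z) (L.sol ν z) where
  mem _ ht := L.bounds.ball_subset (L.sol_mem_ball H hν hz (Ico_subset_Icc_self ht))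
  continuousOn := (continuousOn_sol hν hz).mono Ico_subset_Icc_self
  initial := sol_zero hν hz
  hasDeriv _ ht :=
    (hasDerivWithinAt_sol hν hz (Ico_subset_Icc_self ht)).mono Ico_subset_Icc_self

theorem eqOn_sol [CompleteSpace Xt] (H : Splitting i j k U T G S GZ SZ Ξ ΞZ)
    (hν : ν ∈ Icc (0 : ℝ) 1) (hz : z ∈ ball z₀ L.r)
    (hv : IsSolution j U (generator G) Ξ ν L.τ (i z) v)
    (hvt : ∀ s ∈ Ico 0 L.τ, RightTangent G S ν v s) : EqOn v (L.sol ν z) (Ico 0 L.τ) := by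
  intro t ht
  have hsub : Icc 0 t ⊆ Ico 0 L.τ := fun s hs => ⟨hs.1, hs.2.trans_lt ht.2⟩
  have hsub' : Icc 0 t ⊆ Icc 0 L.τ := Icc_subset_Icc le_rfl ht.2.le
  have htan := L.tangentOn_sol H hν hz 0
  simp only [sub_zero, zero_add] at htan
  exact L.contractive'.eqOn_of_rightTangent hν (fun x hx => L.trotter_zero H hx)
    (hv.continuousOn.mono hsub) ((continuousOn_sol hν hz).mono hsub')
    (fun s hs => hvt s (hsub (Ico_subset_Icc_self hs)))
    (fun s hs => htan.rightTangent ⟨hs.1, hs.2.trans ht.2⟩)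
    (fun s hs => L.sol_mem_ball H hν hz (hsub' hs)) (hv.initial.trans (sol_zero hν hz).symm)
    ⟨ht.1, le_rfl⟩

theorem eqOn_sol_of_mem_range [CompleteSpace Xt] (H : Splitting i j k U T G S GZ SZ Ξ ΞZ)
    (hν : ν ∈ Icc (0 : ℝ) 1) (hz : z ∈ ball z₀ L.r)
    (hv : IsSolution j U (generator G) Ξ ν L.τ (i z) v)
    (hvZ : ∀ t ∈ Ico 0 L.τ, v t ∈ range i) : EqOn v (L.sol ν z) (Ico 0 L.τ) := by
  have hex : ∀ s, ∃ w, s ∈ Ico 0 L.τ → v s = i w := fun s => by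
    by_cases hs : s ∈ Ico 0 L.τ
    · obtain ⟨w, hw⟩ := hvZ s hs
      exact ⟨w, fun _ => hw.symm⟩
    · exact ⟨0, fun h => absurd h hs⟩
  choose ζ hζ using hex
  exact L.eqOn_sol H hν hz hv
    (H.rightTangent_of_solution hν hζ hv.mem hv.continuousOn hv.hasDeriv)

theorem eqOn_sol_zero [CompleteSpace Xt] (H : Splitting i j k U T G S GZ SZ Ξ ΞZ)
    (hz : z ∈ ball z₀ L.r) (hv : IsSolution j U (generator G) Ξ 0 L.τ (i z) v) :
    EqOn v (L.sol 0 z) (Ico 0 L.τ) := by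
  refine L.eqOn_sol H ⟨le_rfl, zero_le_one⟩ hz hv fun s hs => ?_
  obtain ⟨b, hsb, hb⟩ := exists_between hs.2
  have hsub : Icc s b ⊆ Ico 0 L.τ := fun t ht => ⟨hs.1.trans ht.1, ht.2.trans_lt hb⟩
  exact (H.tangentOn_zero (fun t ht => hv.mem t (hsub ht)) (hv.continuousOn.mono hsub)
    fun t ht => (hv.hasDeriv t (hsub ht)).mono hsub).rightTangent ⟨le_rfl, hsb⟩

theorem norm_sol_sub_le (hν : ν ∈ Icc (0 : ℝ) 1) {ν' : ℝ} (hν' : ν' ∈ Icc (0 : ℝ) 1)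
    (hz : z ∈ ball z₀ L.r) {z' : Z} (hz' : z' ∈ ball z₀ L.r) {t : ℝ} (ht : t ∈ Ico 0 L.τ) :
    ‖L.sol ν z t - L.sol ν' z' t‖ ≤ L.κ * (‖i z - i z'‖ + L.C * L.τ * |ν - ν'|) :=
  L.scheme.norm_limit_sub_limit_le hν hν' ⟨z, hz, rfl⟩ ⟨z', hz', rfl⟩ (Ico_subset_Icc_self ht)

theorem exists_continuousOn_bcf (H : Splitting i j k U T G S GZ SZ Ξ ΞZ) :
    ∃ Φ : Z × ℝ → (Ico 0 L.τ →ᵇ X) × (Ico 0 L.τ →ᵇ Xt),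
      (∀ z ∈ ball z₀ L.r, ∀ ν ∈ Icc (0 : ℝ) 1, ∀ t : Ico 0 L.τ,
        (Φ (z, ν)).1 t = L.sol ν z t ∧ (Φ (z, ν)).2 t = j (L.sol ν z t)) ∧
      ContinuousOn Φ (ball z₀ L.r ×ˢ Icc (0 : ℝ) 1) := by
  have hex : ∀ p : Z × ℝ, ∃ g : (Ico 0 L.τ →ᵇ X) × (Ico 0 L.τ →ᵇ Xt),
      p ∈ ball z₀ L.r ×ˢ Icc (0 : ℝ) 1 →
      ∀ t : Ico 0 L.τ, g.1 t = L.sol p.2 p.1 t ∧ g.2 t = j (L.sol p.2 p.1 t) := fun p => by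
    by_cases hp : p ∈ ball z₀ L.r ×ˢ Icc (0 : ℝ) 1
    · obtain ⟨g₁, h1⟩ := (L.memCb_sol H hp.2 hp.1).exists_boundedContinuousFunction
      obtain ⟨g₂, h2⟩ := (L.memCb1_sol H hp.2 hp.1).1.exists_boundedContinuousFunction
      exact ⟨(g₁, g₂), fun _ t => ⟨h1 t, h2 t⟩⟩
    · exact ⟨0, fun h => absurd h hp⟩
  choose Φ hΦ using hex
  refine ⟨Φ, fun z hz ν hν t => hΦ (z, ν) ⟨hz, hν⟩ t, fun p hp => ?_⟩
  have hC := L.scheme.C_nonneg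
  have hκ := L.scheme.κ_nonneg
  have hτ := L.scheme.τ_pos
  -- The Lipschitz bound in the initial value and in `ν` is uniform in `t`, so it bounds the
  -- supremum distance.
  set b : Z × ℝ → ℝ := fun q => L.κ * (‖i q.1 - i p.1‖ + L.C * L.τ * |q.2 - p.2|) with hb
  have hb0 : ∀ q, 0 ≤ b q := fun q => by positivity
  have hbt : Tendsto b (𝓝[ball z₀ L.r ×ˢ Icc (0 : ℝ) 1] p) (𝓝 0) := by
    have h1 : Continuous b := by fun_prop
    have h2 := h1.tendsto p
    simp only [hb, sub_self, norm_zero, abs_zero, mul_zero, add_zero] at h2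
    exact h2.mono_left nhdsWithin_le_nhds
  have key : ∀ q ∈ ball z₀ L.r ×ˢ Icc (0 : ℝ) 1, ∀ t : Ico 0 L.τ,
      ‖L.sol q.2 q.1 t - L.sol p.2 p.1 t‖ ≤ b q := fun q hq t =>
    L.norm_sol_sub_le hq.2 hp.2 hq.1 hp.1 t.2
  refine Tendsto.prodMk_nhds (x := (Φ p).1) (y := (Φ p).2) ?_ ?_
  · rw [tendsto_iff_dist_tendsto_zero]
    refine squeeze_zero' (Eventually.of_forall fun _ => dist_nonneg) ?_ hbt
    filter_upwards [self_mem_nhdsWithin] with q hq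
    refine (BoundedContinuousFunction.dist_le (hb0 q)).2 fun t => ?_
    rw [(hΦ q hq t).1, (hΦ p hp t).1, dist_eq_norm]
    exact key q hq t
  · rw [tendsto_iff_dist_tendsto_zero]
    have hbt' := hbt.const_mul ‖j‖
    rw [mul_zero] at hbt'
    refine squeeze_zero' (Eventually.of_forall fun _ => dist_nonneg) ?_ hbt'
    filter_upwards [self_mem_nhdsWithin] with q hq
    refine (BoundedContinuousFunction.dist_le (mul_nonneg (norm_nonneg j) (hb0 q))).2 fun t => ?_
    rw [(hΦ q hq t).2, (hΦ p hp t).2, dist_eq_norm, ← map_sub]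
    exact (j.le_opNorm _).trans (mul_le_mul_of_nonneg_left (key q hq t) (norm_nonneg j))

end LocalScheme

end

end

end LieTrotter

/-! ### The main theorem. -/

theorem mainTheorem6
    {X Z D Xt Zt : Type*}
    [NormedAddCommGroup X] [NormedSpace ℝ X] [CompleteSpace X]
    [NormedAddCommGroup Z] [NormedSpace ℝ Z] [CompleteSpace Z]
    [NormedAddCommGroup D] [NormedSpace ℝ D] [CompleteSpace D]
    [NormedAddCommGroup Xt] [NormedSpace ℝ Xt] [CompleteSpace Xt]
    [NormedAddCommGroup Zt] [NormedSpace ℝ Zt] [CompleteSpace Zt]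
    -- the bounded embeddings `Z ⊆ X`, `D ⊆ Z`, `X ⊆ Xt`, `Z ⊆ Zt ⊆ X`
    (i : Z →L[ℝ] X) (hi : Function.Injective i) (hi_dense : DenseRange i)
    (hZ_refl : Function.Surjective (NormedSpace.inclusionInDoubleDual ℝ Z))
    (e : D →L[ℝ] Z) (he : Function.Injective e) (he_dense : DenseRange e)
    (j : X →L[ℝ] Xt) (hj : Function.Injective j)
    (l : Z →L[ℝ] Zt) (k : Zt →L[ℝ] X) (hk : Function.Injective k) (hkl : ∀ z, k (l z) = i z)
    -- the open set `U`, the time `T`, and the maps `G`, `S` with their restrictions to `Z`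
    (U : Set X) (hU : IsOpen U) (hU_ne : U.Nonempty) (T : ℝ) (hT : 0 < T)
    (G S : ℝ → X → X) (GZ SZ : ℝ → Z → Z)
    (hGZ : ∀ t ∈ Set.Ico 0 T, ∀ z ∈ i ⁻¹' U, i (GZ t z) = G t (i z))
    (hSZ : ∀ t ∈ Set.Ico 0 T, ∀ z ∈ i ⁻¹' U, i (SZ t z) = S t (i z))
    (hG_cont : ContinuousOn (fun p : ℝ × X => G p.1 p.2) (Set.Ico 0 T ×ˢ U))
    (hS_cont : ContinuousOn (fun p : ℝ × X => S p.1 p.2) (Set.Ico 0 T ×ˢ U))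
    (hGZ_cont : ContinuousOn (fun p : ℝ × Z => GZ p.1 p.2) (Set.Ico 0 T ×ˢ (i ⁻¹' U)))
    (hSZ_cont : ContinuousOn (fun p : ℝ × Z => SZ p.1 p.2) (Set.Ico 0 T ×ˢ (i ⁻¹' U)))
    (hG_sg : LieTrotter.LocalSemigroup T U G) (hS_sg : LieTrotter.LocalSemigroup T U S)
    (hGZ_sg : LieTrotter.LocalSemigroup T (i ⁻¹' U) GZ)
    (hSZ_sg : LieTrotter.LocalSemigroup T (i ⁻¹' U) SZ)
    -- (a)
    (hG_C2 : ContDiffOn ℝ 2 (fun p : ℝ × X => G p.1 p.2) (Set.Ico 0 T ×ˢ U))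
    (hGZ_C2 : ContDiffOn ℝ 2 (fun p : ℝ × Z => GZ p.1 p.2) (Set.Ico 0 T ×ˢ (i ⁻¹' U)))
    (hS_C2 : LieTrotter.ContDiffAlongCurves 2 T (i ⁻¹' U) (fun t z => S t (i z)))
    -- (b)
    (hGD_C1 : LieTrotter.ContDiffAlongCurves 1 T (e ⁻¹' (i ⁻¹' U)) (fun t x => GZ t (e x)))
    (hSD_C1 : LieTrotter.ContDiffAlongCurves 1 T (e ⁻¹' (i ⁻¹' U)) (fun t x => SZ t (e x)))
    -- (c)
    (hX_qc : LieTrotter.LocallyQuasiContraction T U G S)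
    (hZ_qc : LieTrotter.LocallyQuasiContraction T (i ⁻¹' U) GZ SZ)
    -- (d): the generator of `S` on `U ∩ Z` extends to `C¹` maps `U ∩ Z → Zt` and `U → Xt`
    (Ξ : X → Xt) (ΞZ : Z → Zt)
    (hΞ : ∀ z ∈ i ⁻¹' U, Ξ (i z) = j (LieTrotter.generator S (i z)))
    (hΞZ : ∀ z ∈ i ⁻¹' U, k (ΞZ z) = LieTrotter.generator S (i z))
    (hΞ_C1 : ContDiffOn ℝ 1 Ξ U) (hΞZ_C1 : ContDiffOn ℝ 1 ΞZ (i ⁻¹' U)) :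
    ∀ z₀ ∈ i ⁻¹' U, ∃ τ : ℝ, 0 < τ ∧ τ ≤ T ∧
      ∃ O : Set Z, IsOpen O ∧ z₀ ∈ O ∧ O ⊆ i ⁻¹' U ∧
      ∃ u : ℝ → Z → ℝ → X,
        -- existence and uniqueness of a `Z`-valued solution, for all `ν` and `z`
        (∀ ν ∈ Set.Icc (0 : ℝ) 1, ∀ z ∈ O,
          LieTrotter.IsSolution j U (LieTrotter.generator G) Ξ ν τ (i z) (u ν z) ∧
          (∀ t ∈ Set.Ico 0 τ, u ν z t ∈ Set.range i) ∧
          LieTrotter.MemCb τ (u ν z) ∧ LieTrotter.MemCb1 τ (fun t => j (u ν z t)) ∧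
          ∀ v : ℝ → X,
            LieTrotter.IsSolution j U (LieTrotter.generator G) Ξ ν τ (i z) v →
            (∀ t ∈ Set.Ico 0 τ, v t ∈ Set.range i) → Set.EqOn v (u ν z) (Set.Ico 0 τ)) ∧
        -- for `ν = 0` the solution is unique among all solutions with values in `U`
        (∀ z ∈ O, ∀ v : ℝ → X,
          LieTrotter.IsSolution j U (LieTrotter.generator G) Ξ 0 τ (i z) v →
          Set.EqOn v (u 0 z) (Set.Ico 0 τ)) ∧
        -- Lipschitz dependence on the initial data
        (∃ L : ℝ, ∀ ν ∈ Set.Icc (0 : ℝ) 1, ∀ z₁ ∈ O, ∀ z₂ ∈ O, ∀ t ∈ Set.Ico 0 τ,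
          ‖u ν z₁ t - u ν z₂ t‖ ≤ L * ‖i z₁ - i z₂‖) ∧
        -- continuity of `(z, ν) ↦ u` into `C_b([0,τ), X) ∩ C_b([0,τ), Xt)`, and the limit `ν → 0+`
        ∃ Φ : Z × ℝ → (Set.Ico 0 τ →ᵇ X) × (Set.Ico 0 τ →ᵇ Xt),
          (∀ z ∈ O, ∀ ν ∈ Set.Icc (0 : ℝ) 1, ∀ t : Set.Ico 0 τ,
            (Φ (z, ν)).1 t = u ν z t ∧ (Φ (z, ν)).2 t = j (u ν z t)) ∧
          ContinuousOn Φ (O ×ˢ Set.Icc (0 : ℝ) 1) ∧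
          ∀ z ∈ O, Tendsto (fun ν => Φ (z, ν)) (𝓝[>] 0) (𝓝 (Φ (z, 0))) := by
  have H : LieTrotter.Splitting i j k U T G S GZ SZ Ξ ΞZ :=
    { i_injective := hi
      reflexive := hZ_refl
      j_injective := hj
      isOpen := hU
      T_pos := hT
      map_GZ := hGZ
      map_SZ := hSZ
      continuousOn_G := hG_cont
      continuousOn_S := hS_cont
      continuousOn_GZ := hGZ_cont
      continuousOn_SZ := hSZ_cont
      semigroup_G := hG_sg
      semigroup_S := hS_sg
      semigroup_GZ := hGZ_sg
      semigroup_SZ := hSZ_sg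
      contDiffOn_G := hG_C2
      contDiffOn_GZ := hGZ_C2
      contDiff_S := hS_C2
      -- Points of the dense space `D` are used; the empty word in `hSD_C1` gives differentiability
      -- in time of `SZ` itself.
      dense_differentiable := fun z hz η hη => by
        obtain ⟨x, hx⟩ := he_dense.exists_mem_open
          (Metric.isOpen_ball.inter (hU.preimage i.continuous)) ⟨z, Metric.mem_ball_self hη, hz⟩
        exact ⟨e x, hx.1, ((hSD_C1 []).1 (by simp) (fun _ => 0) 0 ⟨le_rfl, hT⟩ x hx.2).1⟩
      contraction_X := hX_qc
      contraction_Z := hZ_qc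
      Ξ_eq := hΞ
      ΞZ_eq := hΞZ
      contDiffOn_Ξ := hΞ_C1
      contDiffOn_ΞZ := hΞZ_C1 }
  intro z₀ hz₀
  obtain ⟨L⟩ := H.exists_localScheme hz₀
  have hB := L.bounds
  have hr : Metric.ball z₀ L.r ⊆ i ⁻¹' U := fun z hz =>
    hB.mem_U (hB.ball_R₁ (LieTrotter.LocalScheme.mem_ball_of_mem
      (Metric.ball_subset_closedBall (Metric.ball_subset_ball L.r_le hz))))
  obtain ⟨Φ, hΦ, hΦc⟩ := L.exists_continuousOn_bcf H
  refine ⟨L.τ, L.scheme.τ_pos, L.τ_lt.le.trans hB.σ_le, Metric.ball z₀ L.r, Metric.isOpen_ball,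
    Metric.mem_ball_self L.r_pos, hr, L.sol,
    fun ν hν z hz => ⟨L.isSolution_sol H hν hz, fun t ht => ?_, L.memCb_sol H hν hz,
      L.memCb1_sol H hν hz, fun v hv hvZ => L.eqOn_sol_of_mem_range H hν hz hv hvZ⟩,
    fun z hz v hv => L.eqOn_sol_zero H hz hv,
    ⟨L.κ, fun ν hν z₁ hz₁ z₂ hz₂ t ht => by simpa using L.norm_sol_sub_le hν hν hz₁ hz₂ ht⟩,
    Φ, hΦ, hΦc, fun z hz => ?_⟩
  · exact image_subset_range _ _ (L.sol_mem H hν hz (Ico_subset_Icc_self ht))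
  · refine (hΦc (z, 0) ⟨hz, le_rfl, zero_le_one⟩).tendsto.comp
      (tendsto_nhdsWithin_iff.2 ⟨?_, ?_⟩)
    · exact ((Continuous.prodMk_right z).tendsto 0).mono_left nhdsWithin_le_nhds
    · filter_upwards [Ioo_mem_nhdsGT (zero_lt_one (α := ℝ))] with ν hν
      exact ⟨hz, Ioo_subset_Icc_self hν⟩
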